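/- **Setting.** Let $n\ge 1$ and let $S=(v_1,\dots,v_m)$ be a finite list of vectors of $\mathbb Z^n$. Write $(\cdot,\cdot)$ for the standard scalar product and $|a|^2=(a,a)$. Two distinct points $a,b$ are joined by a *black edge* with marking $(h,k)$, $h\ne k$, oriented from $a$ to $b$, if $b-a=v_k-v_h$ and $|b|^2-|a|^2=|v_k|^2-|v_h|^2$; they are joined by a *red edge* with marking $(h,k)$, $h\neq k$, if $a+b=v_h+v_k$ and $|a|^2+|b|^2=|v_h|^2+|v_k|^2$. These edges define the geometric graph $\Gamma_S$, with vertex set $\mathbb Z^n$; the same rules define a graph $\Gamma_S^{\mathbb R}$ with vertex set $\mathbb R^n$. The *special component* is the one whose set of vertices is $\{v_1,\dots,v_m\}$. An *abstract marked graph* is a connected graph with a colour (black or red) on each edge and a marking $(i,j)$, $1\le i\ne j\le m$, on each oriented edge, the opposite orientation having the marking $(j,i)$. A *solution* of such a graph $G$ assigns to each vertex of $G$ a point of $\mathbb Z^n$ so that each edge of $G$ goes to a pair of points satisfying the two equations of an edge of $\Gamma_S$ with the same colour and marking. A *realization* of $G$ is a solution that is a graph isomorphism of $G$ with a connected component of $\Gamma_S$.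 **Theorem.** For each $n\ge 1$ there is a finite list of nonzero polynomials with integer coefficients (the resonances), depending only on $n$, each one in some number $p\le 2(n+1)$ of vector variables with $n$ coordinates each, such that the following holds for all $m$ and all *generic* lists $S=(v_1,\dots,v_m)$ in $\mathbb Z^n$, that is, lists such that no resonance in $p$ vector variables vanishes at $(v_{i_1},\dots,v_{i_p})$ for pairwise different indices $i_1,\dots,i_p$. 1. The vertices of every connected component of $\Gamma_S$ other than the special one are affinely independent; hence there are at most $n+1$ of them. The same is true for $\Gamma_S^{\mathbb R}$. 2. Only finitely many connected components of $\Gamma_S$ contain red edges. 3. The connected components of $\Gamma_S$ without red edges are divided into finitely many families. Each family is indexed by an abstract marked graph $G$ with only black edges and with $k+1$ vertices, $k\le n$ (so that a spanning tree of $G$ has $k$ edges): there are finitely many such $G$ such that each component without red edges is the image of a realization of exactly one of them. For each $G$ in this finite list, the family of $G$ depends on the elements of an $(n-k)$-dimensional sublattice, in the following sense. There are $x_0$, assigning a point $x_0(a)\in\mathbb Z^n$ to each vertex $a$ of $G$, and a sublattice $L\subset\mathbb Z^n$ of rank $n-k$ such that - the solutions of $G$ are exactly the translates $x_0+y$, $y\in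 L$; - for each component in the family of $G$ there is exactly one $y\in L$ such that $x_0+y$ is a realization of $G$ on this component; - for all $y\in L$ outside a finite union of cosets of sublattices of $L$ of rank $<n-k$, the translate $x_0+y$ is a realization of $G$ on a component of $\Gamma_S$. -/

import Mathlib

/-!
The geometric graph `Γ_S` of a list `S = (v₁, …, v_m)` of vectors, and abstract coloured marked
graphs together with their geometric realizations.
Vectors are functions `Fin n → R`, with the standard scalar product `dotProduct`.
-/

/-- `a` and `b` are joined by a black edge, oriented from `a` to `b`, with marking `(h, k)`, that is
`b - a = v_k - v_h` and `|b|² - |a|² = |v_k|² - |v_h|²`. -/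
def IsBlackEdge {R : Type*} [CommRing R] {n m : ℕ} (v : Fin m → Fin n → R) (h k : Fin m)
    (a b : Fin n → R) : Prop :=
  b - a = v k - v h ∧
    dotProduct b b - dotProduct a a = dotProduct (v k) (v k) - dotProduct (v h) (v h)

/-- `a` and `b` are joined by a red edge with marking `(h, k)`, that is
`a + b = v_h + v_k` and `|a|² + |b|² = |v_h|² + |v_k|²`. -/
def IsRedEdge {R : Type*} [CommRing R] {n m : ℕ} (v : Fin m → Fin n → R) (h k : Fin m)
    (a b : Fin n → R) : Prop :=
  a + b = v h + v k ∧
    dotProduct a a + dotProduct b b = dotProduct (v h) (v h) + dotProduct (v k) (v k)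

theorem IsBlackEdge.symm {R : Type*} [CommRing R] {n m : ℕ} {v : Fin m → Fin n → R}
    {h k : Fin m} {a b : Fin n → R} (H : IsBlackEdge v h k a b) : IsBlackEdge v k h b a := by
  refine ⟨?_, ?_⟩
  · have h1 := congrArg Neg.neg H.1
    simpa using h1
  · have h2 := congrArg Neg.neg H.2
    simpa using h2

theorem IsRedEdge.symm {R : Type*} [CommRing R] {n m : ℕ} {v : Fin m → Fin n → R}
    {h k : Fin m} {a b : Fin n → R} (H : IsRedEdge v h k a b) : IsRedEdge v h k b a :=
  ⟨(add_comm b a).trans H.1, (add_comm _ _).trans H.2⟩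

/-- The geometric graph `Γ_S` on all vectors with entries in `R`: the vertices are the points of
`Rⁿ` (for us `R = ℝ` or `R = ℤ`), the edges are the black and the red edges. -/
def geomGraph {R : Type*} [CommRing R] {n m : ℕ} (v : Fin m → Fin n → R) :
    SimpleGraph (Fin n → R) where
  Adj a b := a ≠ b ∧ ∃ h k : Fin m, h ≠ k ∧ (IsBlackEdge v h k a b ∨ IsRedEdge v h k a b)
  symm := ⟨by
    rintro a b ⟨hab, h, k, hhk, H⟩
    rcases H with H | H
    · exact ⟨hab.symm, k, h, hhk.symm, Or.inl H.symm⟩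
    · exact ⟨hab.symm, h, k, hhk, Or.inr H.symm⟩⟩
  loopless := ⟨fun _ H => H.1 rfl⟩

/-- The connected component `C` of `Γ_S` contains a red edge. -/
def HasRedEdge {R : Type*} [CommRing R] {n m : ℕ} (v : Fin m → Fin n → R)
    (C : (geomGraph v).ConnectedComponent) : Prop :=
  ∃ a ∈ C.supp, ∃ b ∈ C.supp, a ≠ b ∧ ∃ h k : Fin m, h ≠ k ∧ IsRedEdge v h k a b

/-- The list of vectors `v` is generic with respect to a finite list of polynomials (the
resonances), each one in `p` vector variables `y₁, …, y_p` with `n` coordinates each: no resonance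
vanishes at any list of `p` of the vectors of `v` with pairwise different indices. -/
def IsGeneric {n m : ℕ} (res : Finset (Σ p : ℕ, MvPolynomial (Fin p × Fin n) ℤ))
    (v : Fin m → Fin n → ℤ) : Prop :=
  ∀ P ∈ res, ∀ s : Fin P.1 ↪ Fin m,
    MvPolynomial.eval (fun q : Fin P.1 × Fin n => v (s q.1) q.2) P.2 ≠ 0

/-- The two colours of edges. -/
inductive EdgeColor : Type
  | black : EdgeColor
  | red : EdgeColor

/-- An abstract coloured marked graph: a connected graph with a colour on each edge and with a
marking `(i, j)`, `i ≠ j`, on each oriented edge, the opposite orientation having the exchanged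
marking. -/
structure MGraph (m : ℕ) (V : Type*) where
  /-- The underlying graph. -/
  graph : SimpleGraph V
  connected : graph.Connected
  /-- The colour of an edge. -/
  color : graph.Dart → EdgeColor
  color_symm : ∀ d, color d.symm = color d
  /-- The marking of an oriented edge. -/
  mark : graph.Dart → Fin m × Fin m
  mark_ne : ∀ d, (mark d).1 ≠ (mark d).2
  mark_symm : ∀ d, mark d.symm = (mark d).swap

/-- All edges of the abstract marked graph are black. -/
def MGraph.IsBlack {m : ℕ} {V : Type*} (G : MGraph m V) : Prop :=
  ∀ d, G.color d = EdgeColor.black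

/-- The assignment `x` of points to the vertices satisfies the equations encoded by `G`: each edge
of `G` goes to a pair of points that satisfies the equations of an edge of `Γ_S` with the same
colour and the same marking. -/
def MGraph.IsSolution {R : Type*} [CommRing R] {n m : ℕ} {V : Type*} (G : MGraph m V)
    (v : Fin m → Fin n → R) (x : V → Fin n → R) : Prop :=
  ∀ d : G.graph.Dart,
    (G.color d = EdgeColor.black →
      IsBlackEdge v (G.mark d).1 (G.mark d).2 (x d.fst) (x d.snd)) ∧
    (G.color d = EdgeColor.red →
      IsRedEdge v (G.mark d).1 (G.mark d).2 (x d.fst) (x d.snd))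

/-- `x` is a geometric realization of `G` on the component `C`: a graph isomorphism of `G` with the
connected component `C` of `Γ_S` that is compatible with the colours and the markings. -/
def MGraph.IsRealization {R : Type*} [CommRing R] {n m : ℕ} {V : Type*} (G : MGraph m V)
    (v : Fin m → Fin n → R) (C : (geomGraph v).ConnectedComponent) (x : V → Fin n → R) : Prop :=
  Function.Injective x ∧ Set.range x = C.supp ∧
    (∀ a b, G.graph.Adj a b ↔ (geomGraph v).Adj (x a) (x b)) ∧ G.IsSolution v x

/-!
Every point of the component of `x` is a formal point `± x + ∑ Y_j v_j`, and the edges join formal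
points whose difference, after multiplication by the signs, is a root of type `D` in the symbols
`v_j`. Each such point satisfies a quadratic equation in `x` and the `v_j`.

Suppose that the points of a component other than the special one were affinely dependent. A minimal
dependent configuration has at most `n + 2` points and, up to renaming, involves at most `2 (n + 1)`
of the `v_j`, so that there are finitely many formal configurations to exclude. If one of them were
not excluded by a polynomial condition on the `v_j`, an ultraproduct would realize it with
algebraically independent coordinates. Differentiating the equations of the points along the
derivations dual to these coordinates shows that the affine relation `∑ c_i x_i = 0` makes every
coordinate of the symbols a critical point of the Lagrangian `∑ ± c_i q_i`, where `q_i` is the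
quadratic equation of the `i`-th point.

If `y` and `y'` are adjacent, then the sum or the difference of their equations is a product
`2 (u, w)`, where `u = y - v_h` and `w` is `y - v_k` or `v_k - v_h`. Here neither `u` nor `w`
vanishes, as `y` is not one of the `v_j`. There are three cases, according to the rank of the
Lagrangian.

* Rank `0` is a combinatorial statement about roots: two points of the configuration would be of
  the form `y` and `2 v_j - y`, and the sum of their equations forces `y = v_j`.
* A form of rank `1` is a multiple of the square of a linear form. Taking standard parts, a real
  linear combination of the equations of the points is such a square, so that its linear form
  vanishes on the coordinates and `x` is a real combination of the `v_j`. Differentiating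
  `(u, w) = 0` now shows that `u` and `w` are proportional, whence one of them vanishes.
* If the rank is at least `2`, there are enough derivations killing all the `c_i` to show that all
  the equations vanish on the kernel of the Lagrangian. So does then one of the linear forms `u`
  and `w`, but the kernel contains the coordinates.

A red edge confines its end points to a sphere. The solutions of a black graph differ by the
translations orthogonal to the differences of its vertices. Such a translate fails to be a
realization only if there is an additional edge at one of its points: a red one is possible for
finitely many translates only, and a black one amounts to a nontrivial affine linear condition.
-/

/-- A root of type `D`: an integer vector `± e_a ± e_b` with `a ≠ b`, the two indices being
specified. -/
def IsRootOn {J : Type*} (w : J → ℤ) (a b : J) : Prop :=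
  a ≠ b ∧ (w a = 1 ∨ w a = -1) ∧ (w b = 1 ∨ w b = -1) ∧ ∀ j, j ≠ a → j ≠ b → w j = 0

/-- A root of type `D`: an integer vector `± e_a ± e_b` with `a ≠ b`. Differences and sums of the
coefficient vectors of adjacent points are of this form. -/
def IsRoot {J : Type*} (w : J → ℤ) : Prop := ∃ a b, IsRootOn w a b

section Root

variable {J : Type*} {w w' : J → ℤ} {a b : J}

theorem IsRootOn.neg (h : IsRootOn w a b) : IsRootOn (-w) a b := by
  obtain ⟨hab, ha, hb, h0⟩ := h
  refine ⟨hab, ?_, ?_, fun j hja hjb => by simp [h0 j hja hjb]⟩ <;>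
    simp only [Pi.neg_apply] <;> omega

theorem IsRootOn.swap (h : IsRootOn w a b) : IsRootOn w b a :=
  ⟨h.1.symm, h.2.2.1, h.2.1, fun j hb ha => h.2.2.2 j ha hb⟩

theorem IsRootOn.apply_left_ne_zero (h : IsRootOn w a b) : w a ≠ 0 := by
  obtain ⟨-, ha, -⟩ := h
  omega

theorem IsRootOn.sub_comm {x y : J → ℤ} (h : IsRootOn (x - y) a b) : IsRootOn (y - x) a b :=
  neg_sub x y ▸ h.neg

theorem IsRootOn.apply_left_ne {x y : J → ℤ} (h : IsRootOn (x - y) a b) : x a ≠ y a :=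
  sub_ne_zero.1 h.apply_left_ne_zero

theorem IsRootOn.apply_right_ne {x y : J → ℤ} (h : IsRootOn (x - y) a b) : x b ≠ y b :=
  h.swap.apply_left_ne

theorem IsRoot.neg (h : IsRoot w) : IsRoot (-w) :=
  let ⟨a, b, h⟩ := h; ⟨a, b, h.neg⟩

theorem IsRoot.ne_zero (h : IsRoot w) : w ≠ 0 := by
  rintro rfl
  obtain ⟨a, b, h⟩ := h
  exact h.apply_left_ne_zero rfl

theorem IsRoot.exists_isRootOn (h : IsRoot w) (ha : w a ≠ 0) : ∃ b, IsRootOn w a b := by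
  obtain ⟨c, d, hcd⟩ := h
  by_cases hac : a = c
  · exact ⟨d, hac ▸ hcd⟩
  · obtain rfl : a = d := by
      by_contra had
      exact ha (hcd.2.2.2 a hac had)
    exact ⟨c, hcd.swap⟩

theorem IsRoot.isRootOn_of_ne (h : IsRoot w) (hab : a ≠ b) (ha : w a ≠ 0) (hb : w b ≠ 0) :
    IsRootOn w a b := by
  obtain ⟨c, hc⟩ := h.exists_isRootOn ha
  obtain rfl : b = c := by
    by_contra hbc
    exact hb (hc.2.2.2 b hab.symm hbc)
  exact hc

theorem IsRootOn.eq_or_eq_neg_or_exists_single [DecidableEq J] (h : IsRootOn w a b)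
    (h' : IsRootOn w' a b) :
    w' = w ∨ w' = -w ∨ ∃ j, w' - w = Pi.single j 2 ∨ w - w' = Pi.single j 2 := by
  obtain ⟨hab, ha, hb, h0⟩ := h
  obtain ⟨-, ha', hb', h0'⟩ := h'
  have ext_on_pair {y y' : J → ℤ} (hya : y a = y' a) (hyb : y b = y' b)
      (hy : ∀ j, j ≠ a → j ≠ b → y j = y' j) : y = y' := by
    ext j
    by_cases hja : j = a
    · exact hja ▸ hya
    by_cases hjb : j = b
    · exact hjb ▸ hyb
    exact hy j hja hjb
  have h_single {c d : J} (hcd : c ≠ d) (hc : w c ≠ w' c) (hc1 : w c = 1 ∨ w c = -1)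
      (hc1' : w' c = 1 ∨ w' c = -1) (hd : w d = w' d) (hj : ∀ j, j ≠ c → j ≠ d → w j = w' j) :
      ∃ j, w' - w = Pi.single j 2 ∨ w - w' = Pi.single j 2 := by
    have hne (j : J) (hjc : j ≠ c) : w j = w' j := by
      by_cases hjd : j = d
      · exact hjd ▸ hd
      · exact hj j hjc hjd
    refine ⟨c, (by omega : w c = -1 ∧ w' c = 1 ∨ w c = 1 ∧ w' c = -1).imp ?_ ?_⟩ <;>
    · rintro ⟨e, e'⟩
      ext j
      obtain rfl | hjc := eq_or_ne j c
      · simp [e, e']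
      · simp [hjc, hne j hjc]
  by_cases hwa : w a = w' a <;> by_cases hwb : w b = w' b
  · exact Or.inl (ext_on_pair hwa.symm hwb.symm fun j hja hjb => by
      rw [h0 j hja hjb, h0' j hja hjb])
  · exact Or.inr (Or.inr (h_single hab.symm hwb hb hb' hwa fun j hjb hja => by
      rw [h0 j hja hjb, h0' j hja hjb]))
  · exact Or.inr (Or.inr (h_single hab hwa ha ha' hwb fun j hja hjb => by
      rw [h0 j hja hjb, h0' j hja hjb]))
  · refine Or.inr (Or.inl (ext_on_pair ?_ ?_ fun j hja hjb => ?_)) <;> simp only [Pi.neg_apply]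
    · omega
    · omega
    · rw [h0 j hja hjb, h0' j hja hjb, neg_zero]

variable [Fintype J]

theorem IsRoot.sum_natAbs (h : IsRoot w) : ∑ j, (w j).natAbs = 2 := by
  obtain ⟨a, b, hab, ha, hb, h0⟩ := h
  rw [Finset.sum_eq_add a b hab (fun j _ hj => by simp [h0 j hj.1 hj.2]) (by simp) (by simp)]
  omega

theorem isRoot_or_eq_single_of_sum_natAbs [DecidableEq J] (h : ∑ j, (w j).natAbs = 2) :
    IsRoot w ∨ ∃ j, w = Pi.single j 2 ∨ w = Pi.single j (-2) := by
  obtain ⟨a, ha⟩ : ∃ a, w a ≠ 0 := by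
    by_contra! hw
    simp [hw] at h
  have h_split := Finset.add_sum_erase Finset.univ (fun j => (w j).natAbs) (Finset.mem_univ a)
  rw [h] at h_split
  by_cases h2 : (w a).natAbs = 2
  · have h_zero : ∀ j, j ≠ a → w j = 0 := fun j hj => Int.natAbs_eq_zero.1
      (Finset.sum_eq_zero_iff.1 (by omega : ∑ j ∈ Finset.univ.erase a, (w j).natAbs = 0) j
        (by simp [hj]))
    have hw : w = Pi.single a (w a) := by
      ext j
      obtain rfl | hj := eq_or_ne j a
      · simp
      · simp [hj, h_zero j hj]
    obtain h3 | h3 : w a = 2 ∨ w a = -2 := by omega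
    · exact Or.inr ⟨a, Or.inl (h3 ▸ hw)⟩
    · exact Or.inr ⟨a, Or.inr (h3 ▸ hw)⟩
  · obtain ⟨b, hb, hb0⟩ : ∃ b ∈ Finset.univ.erase a, (w b).natAbs ≠ 0 := by
      by_contra! hw
      have := Finset.sum_eq_zero hw
      omega
    have hba : b ≠ a := Finset.ne_of_mem_erase hb
    have h_split' := Finset.add_sum_erase _ (fun j => (w j).natAbs) hb
    refine Or.inl ⟨a, b, hba.symm, by omega, by omega, fun j hja hjb => ?_⟩
    exact Int.natAbs_eq_zero.1 (Finset.sum_eq_zero_iff.1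
      (by omega : ∑ j ∈ (Finset.univ.erase a).erase b, (w j).natAbs = 0) j (by simp [hja, hjb]))

end Root

/-- The graph of the pairs of vectors whose difference is a root. -/
def rootGraph {I J : Type*} (z : I → J → ℤ) : SimpleGraph I where
  Adj i j := IsRoot (z i - z j)
  symm := ⟨fun _ _ h => by simpa using h.neg⟩
  loopless := ⟨fun _ h => h.ne_zero (sub_self _)⟩

theorem exists_adj_mem_notMem {V : Type*} {G : SimpleGraph V} (hG : G.Connected) {S : Set V}
    {x y : V} (hx : x ∈ S) (hy : y ∉ S) : ∃ a ∈ S, ∃ b ∉ S, G.Adj a b := by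
  obtain ⟨w⟩ := hG.preconnected x y
  obtain ⟨d, -, hd, hd'⟩ := w.exists_boundary_dart S hx hy
  exact ⟨_, hd, _, hd', d.adj⟩

/-- The variation of an integer sequence over its first `L` steps. -/
def variation (ζ : ℕ → ℤ) (L : ℕ) : ℕ := ∑ t ∈ Finset.range L, (ζ (t + 1) - ζ t).natAbs

section Variation

variable (ζ : ℕ → ℤ)

theorem variation_succ (L : ℕ) :
    variation ζ (L + 1) = variation ζ L + (ζ (L + 1) - ζ L).natAbs :=
  Finset.sum_range_succ _ _

theorem natAbs_sub_le_variation (L : ℕ) : (ζ L - ζ 0).natAbs ≤ variation ζ L := by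
  induction L with
  | zero => simp
  | succ L ih =>
    rw [variation_succ]
    omega

theorem even_variation_add_natAbs (L : ℕ) : Even (variation ζ L + (ζ L - ζ 0).natAbs) := by
  induction L with
  | zero => simp [variation]
  | succ L ih =>
    rw [variation_succ, Nat.even_iff] at *
    omega

theorem eq_of_variation_eq_zero {ζ : ℕ → ℤ} {L t : ℕ} (h : variation ζ L = 0) (ht : t ≤ L) :
    ζ t = ζ 0 := by
  have h_le : variation ζ t ≤ variation ζ L :=
    Finset.sum_le_sum_of_subset (Finset.range_mono ht)
  have := natAbs_sub_le_variation ζ t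
  omega

theorem sum_variation_of_isRoot {J : Type*} [Fintype J] {ζ : ℕ → J → ℤ} {L : ℕ}
    (h : ∀ t < L, IsRoot (ζ (t + 1) - ζ t)) : ∑ j, variation (ζ · j) L = 2 * L := by
  calc ∑ j, variation (ζ · j) L = ∑ t ∈ Finset.range L, ∑ j, ((ζ (t + 1) - ζ t) j).natAbs :=
        Finset.sum_comm
    _ = ∑ t ∈ Finset.range L, 2 :=
        Finset.sum_congr rfl fun t ht => (h t (Finset.mem_range.1 ht)).sum_natAbs
    _ = 2 * L := by rw [Finset.sum_const, Finset.card_range, smul_eq_mul, mul_comm]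

theorem sum_natAbs_sub_eq_two_of_isRoot {J : Type*} [Fintype J] {ζ : ℕ → J → ℤ}
    {f : ℕ} (h : ∀ t < f + 1, IsRoot (ζ (t + 1) - ζ t)) (hne : ζ (f + 1) ≠ ζ 0) {N : Finset J}
    (hN : ∀ j ∈ N, ζ (f + 1) j = ζ 0 j ∧ variation (ζ · j) (f + 1) ≠ 0) (hcard : f ≤ N.card) :
    ∑ j, ((ζ (f + 1) - ζ 0) j).natAbs = 2 := by
  classical
  have h_even : Even (∑ j, ((ζ (f + 1) - ζ 0) j).natAbs) := by
    have h_total : Even (∑ j, (variation (ζ · j) (f + 1) + ((ζ (f + 1) - ζ 0) j).natAbs)) :=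
      Finset.even_sum _ fun j _ => even_variation_add_natAbs (ζ · j) (f + 1)
    rw [Finset.sum_add_distrib, sum_variation_of_isRoot h, Nat.even_add] at h_total
    exact h_total.1 (even_two_mul _)
  have h_pos : ∑ j, ((ζ (f + 1) - ζ 0) j).natAbs ≠ 0 := fun h0 => hne <| sub_eq_zero.1 <|
    funext fun j => Int.natAbs_eq_zero.1 (Finset.sum_eq_zero_iff.1 h0 j (Finset.mem_univ j))
  have h_le : ∑ j, ((ζ (f + 1) - ζ 0) j).natAbs + 2 * N.card ≤ 2 * (f + 1) := by
    rw [← sum_variation_of_isRoot h, mul_comm, ← smul_eq_mul, ← Finset.sum_const,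
      ← Finset.sum_add_sum_compl N, ← Finset.sum_add_sum_compl N, add_right_comm,
      ← Finset.sum_add_distrib]
    refine add_le_add (Finset.sum_le_sum fun j hj => ?_)
      (Finset.sum_le_sum fun j _ => natAbs_sub_le_variation (ζ · j) _)
    obtain ⟨hj0, hj1⟩ := hN j hj
    have h_par := even_variation_add_natAbs (ζ · j) (f + 1)
    simp only [Pi.sub_apply, hj0, sub_self, Int.natAbs_zero, add_zero, zero_add] at h_par ⊢
    obtain ⟨k, hk⟩ := h_par
    omega
  obtain ⟨k, hk⟩ := h_even
  omega

end Variation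

/-- The diagonal entries of the quadratic form `∑ i, s i • z i ⊗ z i`. -/
def weight {K I J : Type*} [Field K] [Fintype I] (z : I → J → ℤ) (s : I → K) (j : J) : K :=
  ∑ i, s i * z i j * z i j

/-- A linear relation `s` between the integer vectors `z i`, of sum zero, for which the quadratic
form `∑ i, s i • z i ⊗ z i` is diagonal and which is the only affine relation up to scalars. -/
structure IsResonantRelation {K I J : Type*} [Field K] [Fintype I] (z : I → J → ℤ) (s : I → K) :
    Prop where
  ne_zero : s ≠ 0
  sum : ∑ i, s i = 0
  sum_mul : ∀ j, ∑ i, s i * z i j = 0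
  diag : ∀ j l, j ≠ l → ∑ i, s i * z i j * z i l = 0
  unique : ∀ c : I → K, ∑ i, c i = 0 → (∀ j, ∑ i, c i * z i j = 0) → ∃ θ, ∀ i, c i = θ * s i
  inj : Function.Injective z

/-- The bilinear form inverse to `∑ i, s i • z i ⊗ z i`. The coordinates of weight zero do not
contribute, by the convention `x / 0 = 0`. -/
def form {K I J : Type*} [Field K] [Fintype I] [Fintype J] (z : I → J → ℤ) (s : I → K)
    (u : J → K) (w : J → ℤ) : K :=
  ∑ j, u j * w j / weight z s j

section Form

variable {K I J : Type*} [Field K] [Fintype I] [Fintype J] {z : I → J → ℤ} {s : I → K}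

theorem form_sub_right (u : J → K) (w w' : J → ℤ) :
    form z s u (w - w') = form z s u w - form z s u w' := by
  simp [form, mul_sub, sub_div, Finset.sum_sub_distrib]

theorem form_of_isRootOn {r : J → ℤ} {a b : J} (hr : IsRootOn r a b) (w : J → ℤ) :
    form z s (fun j => r j) w = r a * w a / weight z s a + r b * w b / weight z s b := by
  obtain ⟨hab, -, -, h0⟩ := hr
  rw [form, Finset.sum_eq_add a b hab (fun j _ hj => by simp [h0 j hj.1 hj.2]) (by simp) (by simp)]

end Form

namespace IsResonantRelation

section Support

variable {K I J : Type*} [Field K] [Fintype I] {z : I → J → ℤ} {s : I → K}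

theorem exists_coeff_ne_zero (H : IsResonantRelation z s) : ∃ i, s i ≠ 0 :=
  Function.ne_iff.1 H.ne_zero

theorem apply_eq_of_weight_eq_zero [CharZero K] (H : IsResonantRelation z s) {j : J}
    (hj : weight z s j = 0) {i l : I} (hi : s i ≠ 0) (hl : s l ≠ 0) : z i j = z l j := by
  obtain ⟨θ, hθ⟩ := H.unique (fun i => s i * z i j) (H.sum_mul j) fun l => by
    obtain rfl | hjl := eq_or_ne j l
    · exact hj
    · exact H.diag j l hjl
  have h_eq {i : I} (hi : s i ≠ 0) : (z i j : K) = θ :=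
    mul_left_cancel₀ hi ((hθ i).trans (mul_comm _ _))
  exact_mod_cast (h_eq hi).trans (h_eq hl).symm

theorem restrict (H : IsResonantRelation z s) [Fintype {i // s i ≠ 0}] :
    IsResonantRelation (fun i : {i // s i ≠ 0} => z i) (fun i => s i) := by
  classical
  have h_sum (g : I → K) (hg : ∀ i, s i = 0 → g i = 0) : ∑ i : {i // s i ≠ 0}, g i = ∑ i, g i := by
    rw [← Finset.sum_subtype (p := fun i => s i ≠ 0) (Finset.univ.filter fun i => s i ≠ 0)
      (fun i => by simp) g]
    exact Finset.sum_filter_of_ne fun i _ hgi hsi => hgi (hg i hsi)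
  obtain ⟨p, hp⟩ := H.exists_coeff_ne_zero
  refine ⟨fun h => hp (congrFun h ⟨p, hp⟩), (h_sum _ fun _ => id).trans H.sum,
    fun j => (h_sum (fun i => s i * z i j) fun i hi => by simp [hi]).trans (H.sum_mul j),
    fun j l hjl => (h_sum (fun i => s i * z i j * z i l) fun i hi => by simp [hi]).trans
      (H.diag j l hjl), fun c hc hcz => ?_, H.inj.comp Subtype.val_injective⟩
  let c' (i : I) : K := if h : s i ≠ 0 then c ⟨i, h⟩ else 0
  have hc' (i : {i // s i ≠ 0}) : c' i = c i := dif_pos i.2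
  have hc0 (i : I) (hi : s i = 0) : c' i = 0 := dif_neg (not_not.2 hi)
  obtain ⟨θ, hθ⟩ := H.unique c'
    (by rw [← h_sum c' hc0]; simpa only [hc'] using hc)
    (fun j => by
      rw [← h_sum (fun i => c' i * z i j) fun i hi => by rw [hc0 i hi, zero_mul]]
      simpa only [hc'] using hcz j)
  exact ⟨θ, fun i => by rw [← hc', hθ]⟩

theorem sum_form [Fintype J] (H : IsResonantRelation z s) (u : J → K) :
    ∑ i, s i * form z s u (z i) = 0 := by
  simp only [form, Finset.mul_sum]
  rw [Finset.sum_comm]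
  refine Finset.sum_eq_zero fun j _ => ?_
  calc ∑ i, s i * (u j * z i j / weight z s j)
      = (∑ i, s i * z i j) * (u j / weight z s j) := by
        rw [Finset.sum_mul]
        exact Finset.sum_congr rfl fun i _ => by ring
    _ = 0 := by rw [H.sum_mul j, zero_mul]

theorem sum_form_mul [Fintype J] (H : IsResonantRelation z s) (u : J → K) (l : J)
    (hu : weight z s l = 0 → u l = 0) :
    ∑ i, s i * form z s u (z i) * z i l = u l := by
  calc ∑ i, s i * form z s u (z i) * z i l
      = ∑ j, (∑ i, s i * z i j * z i l) * (u j / weight z s j) := by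
        simp only [form, Finset.mul_sum, Finset.sum_mul]
        rw [Finset.sum_comm]
        exact Finset.sum_congr rfl fun j _ => Finset.sum_congr rfl fun i _ => by ring
    _ = weight z s l * (u l / weight z s l) :=
        Finset.sum_eq_single l (fun j _ hj => by rw [H.diag j l hj, zero_mul]) (by simp)
    _ = u l := by
        by_cases h : weight z s l = 0
        · rw [h, hu h, zero_mul]
        · exact mul_div_cancel₀ _ h

theorem linearIndependent_of_coeff_eq_zero [Finite J] (H : IsResonantRelation z s) {f : ℕ}
    {u : Fin f → I} (hu : Function.Injective u) (hs : ∀ t, s (u t) = 0) {c : I} (hc : s c ≠ 0)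
    {N : Finset J} (hN : ∀ j, weight z s j = 0 → j ∉ N → ∀ t, z (u t) j = z c j) :
    LinearIndependent K fun (t : Fin f) (j : N) => (z (u t) j - z c j : K) := by
  classical
  have := Fintype.ofFinite J
  rw [Fintype.linearIndependent_iff]
  intro g hg
  let E : J → K := fun j => ∑ t, g t * (z (u t) j - z c j)
  have hE : ∀ j, weight z s j = 0 → E j = 0 := by
    intro j hj
    by_cases hjN : j ∈ N
    · simpa using congrFun hg ⟨j, hjN⟩
    · exact Finset.sum_eq_zero fun t _ => by simp [hN j hj hjN t]
  -- The combination `g` extends to a relation between all the vectors once it is corrected by the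
  -- inverse form, and this relation must be a multiple of `s`.
  obtain ⟨θ, hθ⟩ := H.unique
    (fun i => ∑ t, g t * ((if i = u t then 1 else 0) - if i = c then 1 else 0)
      - s i * form z s E (z i))
    (by
      rw [Finset.sum_sub_distrib, H.sum_form, sub_zero, Finset.sum_comm]
      refine Finset.sum_eq_zero fun t _ => ?_
      rw [← Finset.mul_sum, Finset.sum_sub_distrib]
      simp)
    (fun l => by
      simp only [sub_mul (∑ _, _)]
      rw [Finset.sum_sub_distrib, H.sum_form_mul E l (hE l)]
      simp only [Finset.sum_mul]
      rw [Finset.sum_comm, sub_eq_zero]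
      refine Finset.sum_congr rfl fun t _ => ?_
      simp only [mul_assoc, ← Finset.mul_sum, sub_mul, Finset.sum_sub_distrib]
      simp)
  intro t
  have h := hθ (u t)
  have hne : u t ≠ c := fun h => hc (h ▸ hs t)
  simp only [hs t, hne, if_false, sub_zero, zero_mul, mul_zero] at h
  simpa [hu.eq_iff] using h

variable [CharZero K] [Finite J] [DecidableEq J]

theorem isRoot_or_eq_single_of_path (H : IsResonantRelation z s) {f : ℕ} {w : ℕ → I}
    (hinj : Set.InjOn w (Set.Iic (f + 1))) (h0 : s (w 0) ≠ 0) (h1 : s (w (f + 1)) ≠ 0)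
    (hw : ∀ t, 1 ≤ t → t ≤ f → s (w t) = 0)
    (hroot : ∀ t < f + 1, IsRoot (z (w (t + 1)) - z (w t))) :
    IsRoot (z (w (f + 1)) - z (w 0)) ∨ ∃ j, z (w (f + 1)) - z (w 0) = Pi.single j 2 ∨
      z (w (f + 1)) - z (w 0) = Pi.single j (-2) := by
  classical
  have := Fintype.ofFinite J
  let N : Finset J := {j | weight z s j = 0 ∧ variation (fun t => z (w t) j) (f + 1) ≠ 0}
  refine isRoot_or_eq_single_of_sum_natAbs
    (sum_natAbs_sub_eq_two_of_isRoot (ζ := fun t => z (w t)) (N := N) hroot ?_ ?_ ?_)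
  · exact fun h => by simpa using hinj (by simp) (by simp) (H.inj h)
  · intro j hj
    obtain ⟨hj0, hj1⟩ := (Finset.mem_filter.1 hj).2
    exact ⟨H.apply_eq_of_weight_eq_zero hj0 h1 h0, hj1⟩
  · have h_indep := H.linearIndependent_of_coeff_eq_zero (u := fun t : Fin f => w (t + 1)) (N := N)
      (fun a b hab => Fin.ext <| by
        simpa using hinj (Set.mem_Iic.2 (by omega)) (Set.mem_Iic.2 (by omega)) hab)
      (fun t => hw _ (by omega) (by omega)) h0
      (fun j hj hjN _ => eq_of_variation_eq_zero (ζ := fun t => z (w t) j) (L := f + 1)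
        (by simpa [N, hj] using hjN) (by omega))
    simpa using h_indep.fintype_card_le_finrank

theorem exists_rootGraph_adj_getVert (H : IsResonantRelation z s) {G : SimpleGraph I}
    (hroot : ∀ i l, G.Adj i l → IsRoot (z i - z l)) (h2 : ∀ i l j, z i - z l ≠ Pi.single j 2)
    {c c' : {i // s i ≠ 0}} {p : G.Walk c c'} (hp : p.IsPath) (hc : c ≠ c') :
    ∃ t, 0 < t ∧ t ≤ p.length ∧ ∃ h : s (p.getVert t) ≠ 0,
      (rootGraph fun i : {i // s i ≠ 0} => z i).Adj c ⟨p.getVert t, h⟩ := by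
  classical
  have h_len : 0 < p.length := Nat.pos_of_ne_zero fun h =>
    hc (Subtype.ext (p.eq_of_length_eq_zero h))
  have h_ex : ∃ t, s (p.getVert (t + 1)) ≠ 0 :=
    ⟨p.length - 1, by rw [Nat.sub_add_cancel h_len, p.getVert_length]; exact c'.2⟩
  set f := Nat.find h_ex
  have h_end : s (p.getVert (f + 1)) ≠ 0 := Nat.find_spec h_ex
  have h_le : f ≤ p.length - 1 :=
    Nat.find_min' h_ex (by rw [Nat.sub_add_cancel h_len, p.getVert_length]; exact c'.2)
  refine ⟨f + 1, f.succ_pos, by omega, h_end, ?_⟩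
  have h_step := H.isRoot_or_eq_single_of_path (w := p.getVert)
    (fun a ha b hb => hp.getVert_injOn (by simp at ha ⊢; omega) (by simp at hb ⊢; omega))
    (by rw [p.getVert_zero]; exact c.2) h_end
    (fun t ht htf => by
      have := Nat.find_min h_ex (m := t - 1) (by omega)
      rwa [Nat.sub_add_cancel ht, not_not] at this)
    (fun t ht => hroot _ _ (p.adj_getVert_succ (by omega)).symm)
  rw [p.getVert_zero] at h_step
  obtain h | ⟨j, h | h⟩ := h_step
  · simpa [rootGraph] using h.neg
  · exact absurd h (h2 _ _ j)
  · refine absurd ?_ (h2 c (p.getVert (f + 1)) j)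
    rw [← neg_sub, h, ← Pi.single_neg, neg_neg]

theorem connected_rootGraph (H : IsResonantRelation z s) {G : SimpleGraph I} (hG : G.Connected)
    (hroot : ∀ i l, G.Adj i l → IsRoot (z i - z l)) (h2 : ∀ i l j, z i - z l ≠ Pi.single j 2) :
    (rootGraph fun i : {i // s i ≠ 0} => z i).Connected := by
  have h_path (L : ℕ) (c c' : {i // s i ≠ 0}) (p : G.Walk c c') (hp : p.IsPath)
      (hL : p.length = L) : (rootGraph fun i : {i // s i ≠ 0} => z i).Reachable c c' := by
    induction L using Nat.strong_induction_on generalizing c p with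
    | _ L ih =>
      by_cases hc : c = c'
      · rw [hc]
      obtain ⟨t, ht0, htL, ht, hadj⟩ := H.exists_rootGraph_adj_getVert hroot h2 hp hc
      exact hadj.reachable.trans
        (ih (p.drop t).length (by rw [p.drop_length]; omega) _ _ (hp.drop t) rfl)
  obtain ⟨p, hp⟩ := H.exists_coeff_ne_zero
  have : Nonempty {i // s i ≠ 0} := ⟨⟨p, hp⟩⟩
  refine ⟨fun c c' => ?_⟩
  obtain ⟨q, hq⟩ := (hG.preconnected c c').exists_isPath
  exact h_path _ c c' q hq rfl

end Support

end IsResonantRelation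

namespace IsResonantRelation

section FullSupport

variable {K I J : Type*} [Field K] [Fintype I] {z : I → J → ℤ} {s : I → K}

theorem linearIndependent_one_coords (H : IsResonantRelation z s) {T : Finset J}
    (hT : ∀ j ∈ T, weight z s j ≠ 0) :
    LinearIndependent K fun (o : Option T) i => o.elim (1 : K) fun j => z i j := by
  obtain ⟨p, -⟩ := H.exists_coeff_ne_zero
  rw [Fintype.linearIndependent_iff]
  intro g hg
  have hg' (i : I) : g none + ∑ j : T, g (some j) * z i j = 0 := by
    simpa [Fintype.sum_option] using congrFun hg i
  have h_some (l : T) : g (some l) = 0 := by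
    have h_zero : ∑ i, s i * z i l * (g none + ∑ j : T, g (some j) * z i j) = 0 :=
      Finset.sum_eq_zero fun i _ => by rw [hg', mul_zero]
    have h_weight : ∑ i, s i * z i l * (g none + ∑ j : T, g (some j) * z i j)
        = g (some l) * weight z s l := by
      simp only [mul_add, Finset.sum_add_distrib, ← Finset.sum_mul, H.sum_mul, zero_mul, zero_add,
        Finset.mul_sum]
      rw [Finset.sum_comm, Finset.sum_eq_single l _ (by simp), weight, Finset.mul_sum]
      · exact Finset.sum_congr rfl fun i _ => by ring
      · intro j _ hj
        rw [← mul_zero (g (some j)), ← H.diag l j fun h => hj (Subtype.ext h.symm),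
          Finset.mul_sum]
        exact Finset.sum_congr rfl fun i _ => by ring
    exact (mul_eq_zero.1 (h_weight.symm.trans h_zero)).resolve_right (hT l l.2)
  rintro (_ | l)
  · simpa [h_some] using hg' p
  · exact h_some l

theorem card_add_two_le (H : IsResonantRelation z s) {T : Finset J}
    (hT : ∀ j ∈ T, weight z s j ≠ 0) : T.card + 2 ≤ Fintype.card I := by
  classical
  let e : Option T → I → K := fun o i => o.elim 1 fun j => z i j
  let φ : (I → K) →ₗ[K] K := ∑ i, s i • LinearMap.proj i
  have hφ (f : I → K) : φ f = ∑ i, s i * f i := by simp [φ]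
  obtain ⟨p, hp⟩ := H.exists_coeff_ne_zero
  have h_le : Submodule.span K (Set.range e) ≤ LinearMap.ker φ := by
    rw [Submodule.span_le]
    rintro _ ⟨_ | j, rfl⟩
    · simpa [e, hφ] using H.sum
    · simpa [e, hφ] using H.sum_mul j
  have h_lt : LinearMap.ker φ < ⊤ := lt_top_iff_ne_top.2 fun h => hp <| by
    simpa [hφ, Pi.single_apply] using LinearMap.congr_fun (LinearMap.ker_eq_top.1 h) (Pi.single p 1)
  have h_finrank := Submodule.finrank_lt (h_le.trans_lt h_lt).ne
  rw [finrank_span_eq_card (H.linearIndependent_one_coords hT),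
    Module.finrank_fintype_fun_eq_card, Fintype.card_option, Fintype.card_coe] at h_finrank
  omega

variable [CharZero K]

theorem weight_ne_zero (H : IsResonantRelation z s) (hs : ∀ i, s i ≠ 0) {p q : I} {a : J}
    (ha : z p a ≠ z q a) : weight z s a ≠ 0 :=
  fun h => ha (H.apply_eq_of_weight_eq_zero h (hs p) (hs q))

theorem four_le_card (H : IsResonantRelation z s) (hs : ∀ i, s i ≠ 0) {p q : I} {a b : J}
    (hr : IsRootOn (z p - z q) a b) : 4 ≤ Fintype.card I := by
  classical
  have := H.card_add_two_le (T := {a, b}) (by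
    simp only [Finset.mem_insert, Finset.mem_singleton, forall_eq_or_imp, forall_eq]
    exact ⟨H.weight_ne_zero hs hr.apply_left_ne, H.weight_ne_zero hs hr.apply_right_ne⟩)
  rwa [Finset.card_pair hr.1] at this

section Form

variable [Fintype J]

theorem exists_coeff_mul_form_eq [DecidableEq I] (H : IsResonantRelation z s) (hs : ∀ i, s i ≠ 0)
    (p q : I) :
    ∃ θ, ∀ i, s i * form z s (fun j => (z p - z q) j) (z i)
      = (if i = p then 1 else 0) - (if i = q then 1 else 0) + θ * s i := by
  obtain ⟨θ, hθ⟩ := H.unique (fun i => s i * form z s (fun j => (z p - z q) j) (z i)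
      - (if i = p then 1 else 0) + (if i = q then 1 else 0))
    (by simp [Finset.sum_add_distrib, Finset.sum_sub_distrib, H.sum_form])
    (fun l => by
      simp only [add_mul, sub_mul, Finset.sum_add_distrib, Finset.sum_sub_distrib]
      rw [H.sum_form_mul _ l fun h => by simp [H.apply_eq_of_weight_eq_zero h (hs p) (hs q)]]
      simp)
  exact ⟨θ, fun i => by rw [← hθ i]; ring⟩

theorem form_sub_sub_eq_zero (H : IsResonantRelation z s) (hs : ∀ i, s i ≠ 0) {p q u w : I}
    (hup : u ≠ p) (huq : u ≠ q) (hwp : w ≠ p) (hwq : w ≠ q) :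
    form z s (fun j => (z p - z q) j) (z u - z w) = 0 := by
  classical
  obtain ⟨θ, hθ⟩ := H.exists_coeff_mul_form_eq hs p q
  have h_form {i : I} (hip : i ≠ p) (hiq : i ≠ q) :
      form z s (fun j => (z p - z q) j) (z i) = θ :=
    mul_left_cancel₀ (hs i) (by rw [hθ, if_neg hip, if_neg hiq, sub_zero, zero_add, mul_comm])
  rw [form_sub_right, h_form hup huq, h_form hwp hwq, sub_self]

theorem form_sub_sub_eq_inv (H : IsResonantRelation z s) (hs : ∀ i, s i ≠ 0) {p q u : I}
    (hup : u ≠ p) (huq : u ≠ q) (hpq : p ≠ q) :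
    form z s (fun j => (z p - z q) j) (z u - z q) = (s q)⁻¹ := by
  classical
  obtain ⟨θ, hθ⟩ := H.exists_coeff_mul_form_eq hs p q
  have hu := hθ u
  have hq := hθ q
  rw [if_neg hup, if_neg huq, sub_zero, zero_add, mul_comm] at hu
  rw [if_neg hpq.symm, if_pos rfl] at hq
  have hsq := hs q
  rw [form_sub_right, mul_right_cancel₀ (hs u) hu]
  field_simp
  linear_combination -hq

end Form

variable [Finite J]

theorem apply_eq_iff_of_disjoint (H : IsResonantRelation z s) (hs : ∀ i, s i ≠ 0) {p q u w : I}
    {a b : J} (hr : IsRootOn (z p - z q) a b) (hup : u ≠ p) (huq : u ≠ q) (hwp : w ≠ p)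
    (hwq : w ≠ q) : z u a = z w a ↔ z u b = z w b := by
  have := Fintype.ofFinite J
  have h_imp {a b : J} (hr : IsRootOn (z p - z q) a b) (ha : z u a = z w a) : z u b = z w b := by
    have h := H.form_sub_sub_eq_zero hs hup huq hwp hwq
    rw [form_of_isRootOn hr, Pi.sub_apply (z u), ha, sub_self, Int.cast_zero, mul_zero, zero_div,
      zero_add, div_eq_zero_iff, or_iff_left (H.weight_ne_zero hs hr.apply_right_ne), mul_eq_zero,
      Int.cast_eq_zero, or_iff_right hr.swap.apply_left_ne_zero, Int.cast_eq_zero] at h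
    exact sub_eq_zero.1 h
  exact ⟨h_imp hr, h_imp hr.swap⟩

theorem sub_ne_neg_sub (H : IsResonantRelation z s) (hs : ∀ i, s i ≠ 0) {p q u : I} {a b : J}
    (hr : IsRootOn (z p - z q) a b) (huq : u ≠ q) : z u - z q ≠ -(z p - z q) := by
  classical
  have := Fintype.ofFinite J
  intro h_neg
  obtain ⟨l, -, hl⟩ := Finset.exists_mem_notMem_of_card_lt_card
    (Finset.card_le_three.trans_lt (H.four_le_card hs hr) : ({p, q, u} : Finset I).card < _)
  simp only [Finset.mem_insert, Finset.mem_singleton, not_or] at hl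
  obtain ⟨hlp, hlq, hlu⟩ := hl
  have hpq : p ≠ q := fun h => hr.apply_left_ne (h ▸ rfl)
  have h_inv := H.form_sub_sub_eq_inv hs hlu hlq huq
  have h_form : form z s (fun j => ((-(z p - z q)) j : ℤ)) (z l - z q) =
      -form z s (fun j => (z p - z q) j) (z l - z q) := by
    rw [form_of_isRootOn hr.neg, form_of_isRootOn hr]
    simp only [Pi.neg_apply, Int.cast_neg]
    ring
  rw [h_neg, h_form, H.form_sub_sub_eq_inv hs hlp hlq hpq, neg_eq_iff_add_eq_zero, ← two_mul,
    mul_eq_zero, inv_eq_zero] at h_inv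
  exact h_inv.elim two_ne_zero (hs q)

variable [DecidableEq J]

theorem apply_eq_or_apply_eq_of_isRoot (H : IsResonantRelation z s) (hs : ∀ i, s i ≠ 0)
    (h2 : ∀ i l j, z i - z l ≠ Pi.single j 2) {p q u : I} {a b : J}
    (hr : IsRootOn (z p - z q) a b) (hu : IsRoot (z u - z q)) (hup : u ≠ p) :
    z u a = z q a ∨ z u b = z q b := by
  by_contra! hne
  have hu' := hu.isRootOn_of_ne hr.1 (sub_ne_zero.2 hne.1) (sub_ne_zero.2 hne.2)
  obtain h | h | ⟨j, h | h⟩ := hr.eq_or_eq_neg_or_exists_single hu'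
  · exact hup (H.inj (sub_left_injective h))
  · exact H.sub_ne_neg_sub hs hr (fun huq => hne.1 (huq ▸ rfl)) h
  · exact h2 u p j (by rwa [sub_sub_sub_cancel_right] at h)
  · exact h2 p u j (by rwa [sub_sub_sub_cancel_right] at h)

theorem apply_ne_iff_of_isRoot (H : IsResonantRelation z s) (hs : ∀ i, s i ≠ 0)
    (h2 : ∀ i l j, z i - z l ≠ Pi.single j 2) {p q u : I} {a b : J}
    (hr : IsRootOn (z p - z q) a b) (hu : IsRoot (z u - z q)) (hup : u ≠ p) :
    z u a ≠ z q a ↔ z u b = z q b := by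
  have := Fintype.ofFinite J
  refine ⟨(H.apply_eq_or_apply_eq_of_isRoot hs h2 hr hu hup).resolve_left, fun hb ha => hs q ?_⟩
  have huq : u ≠ q := fun h => hu.ne_zero (sub_eq_zero.2 (h ▸ rfl))
  have hpq : p ≠ q := fun h => hr.apply_left_ne (h ▸ rfl)
  have h_inv := H.form_sub_sub_eq_inv hs hup huq hpq
  rw [form_of_isRootOn hr] at h_inv
  simpa [ha, hb] using h_inv.symm

theorem exists_apply_ne_of_isRoot (H : IsResonantRelation z s) (hs : ∀ i, s i ≠ 0)
    (h2 : ∀ i l j, z i - z l ≠ Pi.single j 2) {p q u : I} {a b : J}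
    (hr : IsRootOn (z p - z q) a b) (hu : IsRoot (z u - z q)) (hup : u ≠ p) :
    ∃ c, c ≠ a ∧ c ≠ b ∧ z u c ≠ z q c := by
  have h_iff := H.apply_ne_iff_of_isRoot hs h2 hr hu hup
  by_cases ha : z u a = z q a
  · have hb : z u b ≠ z q b := fun hb => h_iff.2 hb ha
    obtain ⟨c, hc⟩ := hu.exists_isRootOn (sub_ne_zero.2 hb)
    exact ⟨c, fun h => hc.apply_right_ne (h ▸ ha), hc.1.symm, hc.apply_right_ne⟩
  · obtain ⟨c, hc⟩ := hu.exists_isRootOn (sub_ne_zero.2 ha)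
    exact ⟨c, hc.1.symm, fun h => hc.apply_right_ne (h ▸ h_iff.1 ha), hc.apply_right_ne⟩

theorem five_le_card (H : IsResonantRelation z s) (hs : ∀ i, s i ≠ 0)
    (h2 : ∀ i l j, z i - z l ≠ Pi.single j 2) (hC : (rootGraph z).Connected) {p q : I} {a b : J}
    (hr : IsRootOn (z p - z q) a b) : 5 ≤ Fintype.card I := by
  classical
  have h_card {p q u : I} (hr : IsRootOn (z p - z q) a b) (hu : IsRoot (z u - z q)) (hup : u ≠ p) :
      5 ≤ Fintype.card I := by
    obtain ⟨c, hca, hcb, hc⟩ := H.exists_apply_ne_of_isRoot hs h2 hr hu hup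
    have := H.card_add_two_le (T := {c, a, b}) (by
      simp only [Finset.mem_insert, Finset.mem_singleton, forall_eq_or_imp, forall_eq]
      exact ⟨H.weight_ne_zero hs hc, H.weight_ne_zero hs hr.apply_left_ne,
        H.weight_ne_zero hs hr.apply_right_ne⟩)
    rwa [Finset.card_eq_three.2 ⟨c, a, b, hca, hcb, hr.1, rfl⟩] at this
  obtain ⟨l, -, hl⟩ := Finset.exists_mem_notMem_of_card_lt_card
    ((Finset.card_le_two.trans (by norm_num)).trans_lt (H.four_le_card hs hr) :
      ({p, q} : Finset I).card < _)
  obtain ⟨x, hx, y, hy, hxy⟩ := exists_adj_mem_notMem hC (S := ({p, q} : Finset I))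
    (x := p) (by simp) hl
  obtain ⟨hyp, hyq⟩ : y ≠ p ∧ y ≠ q := by simpa using hy
  obtain rfl | rfl : x = p ∨ x = q := by simpa using hx
  · exact h_card hr.sub_comm hxy.symm hyq
  · exact h_card hr hxy.symm hyp

theorem exists_isRoot_mem_notMem (H : IsResonantRelation z s) (hs : ∀ i, s i ≠ 0)
    (h2 : ∀ i l j, z i - z l ≠ Pi.single j 2) (hC : (rootGraph z).Connected) {p q : I} {a b : J}
    (hr : IsRootOn (z p - z q) a b) {S : Finset I} (hS : S.card ≤ 4) (hp : p ∈ S) :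
    ∃ x ∈ S, ∃ t ∉ S, IsRoot (z t - z x) := by
  obtain ⟨l, -, hl⟩ := Finset.exists_mem_notMem_of_card_lt_card
    (hS.trans_lt (H.five_le_card hs h2 hC hr) : S.card < _)
  obtain ⟨x, hx, t, ht, hxt⟩ := exists_adj_mem_notMem hC (S := (S : Set I)) hp hl
  exact ⟨x, hx, t, ht, hxt.symm⟩

theorem not_isRoot_of_isRootOn_of_isRootOn (H : IsResonantRelation z s) (hs : ∀ i, s i ≠ 0)
    (h2 : ∀ i l j, z i - z l ≠ Pi.single j 2) {p q u w t : I} {a b : J}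
    (hpq : IsRootOn (z p - z q) a b) (huw : IsRootOn (z u - z w) a b) (hqu : q ≠ u) (hqw : q ≠ w)
    (htp : t ≠ p) (htu : t ≠ u) (htw : t ≠ w) : ¬ IsRoot (z t - z q) := by
  intro ht
  have := H.apply_ne_iff_of_isRoot hs h2 hpq ht htp
  have := H.apply_eq_iff_of_disjoint hs huw htu htw hqu hqw
  tauto

theorem apply_eq_of_isRoot_of_disjoint (H : IsResonantRelation z s) (hs : ∀ i, s i ≠ 0)
    (h2 : ∀ i l j, z i - z l ≠ Pi.single j 2) (hC : (rootGraph z).Connected) {p q u w : I}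
    {a b : J} (hpq : IsRootOn (z p - z q) a b) (huw : IsRoot (z u - z w)) (hup : u ≠ p)
    (huq : u ≠ q) (hwp : w ≠ p) (hwq : w ≠ q) : z u a = z w a := by
  classical
  by_contra ha
  have hb := mt (H.apply_eq_iff_of_disjoint hs hpq hup huq hwp hwq).2 ha
  have huw' := huw.isRootOn_of_ne hpq.1 (sub_ne_zero.2 ha) (sub_ne_zero.2 hb)
  obtain ⟨x, hx, t, ht, hroot⟩ := H.exists_isRoot_mem_notMem hs h2 hC hpq (S := {p, q, u, w})
    Finset.card_le_four (by simp)
  simp only [Finset.mem_insert, Finset.mem_singleton, not_or] at hx ht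
  obtain ⟨htp, htq, htu, htw⟩ := ht
  obtain rfl | rfl | rfl | rfl := hx
  · exact H.not_isRoot_of_isRootOn_of_isRootOn hs h2 hpq.sub_comm huw' hup.symm hwp.symm htq htu htw
      hroot
  · exact H.not_isRoot_of_isRootOn_of_isRootOn hs h2 hpq huw' huq.symm hwq.symm htp htu htw hroot
  · exact H.not_isRoot_of_isRootOn_of_isRootOn hs h2 huw'.sub_comm hpq hup huq htw htp htq hroot
  · exact H.not_isRoot_of_isRootOn_of_isRootOn hs h2 huw' hpq hwp hwq htu htp htq hroot

omit [Finite J] [DecidableEq J] in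
theorem exists_isRoot_apply_ne_of_ne (H : IsResonantRelation z s)
    (hs : ∀ i, s i ≠ 0) {p q : I} (hp : ((rootGraph z).induce {p}ᶜ).Connected) (hqp : q ≠ p) {x : J}
    (hx : z p x ≠ z q x) : ∃ u w, u ≠ p ∧ w ≠ p ∧ IsRoot (z u - z w) ∧ z u x ≠ z w x := by
  by_contra! h_const
  have h_eq (i : I) (hi : i ≠ p) : z i x = z q x := by
    by_contra hne
    obtain ⟨c, hc, d, hd, hcd⟩ := exists_adj_mem_notMem hp
      (S := {i : ({p}ᶜ : Set I) | z i.1 x = z q x}) (x := ⟨q, hqp⟩) (y := ⟨i, hi⟩) rfl hne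
    exact hd ((h_const c.1 d.1 c.2 d.2 hcd).symm.trans hc)
  have h_sum : ∑ i, s i * (z i x - z q x : K) = 0 := by
    simp only [mul_sub, Finset.sum_sub_distrib, H.sum_mul, ← Finset.sum_mul, H.sum, zero_mul,
      sub_zero]
  rw [Finset.sum_eq_single p (fun i _ hi => by rw [h_eq i hi, sub_self, mul_zero]) (by simp),
    mul_eq_zero, or_iff_right (hs p), sub_eq_zero, Int.cast_inj] at h_sum
  exact hx h_sum

theorem exists_isRoot_apply_ne (H : IsResonantRelation z s) (hs : ∀ i, s i ≠ 0)
    (h2 : ∀ i l j, z i - z l ≠ Pi.single j 2) (hC : (rootGraph z).Connected) {p q : I}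
    (hp : ((rootGraph z).induce {p}ᶜ).Connected) {a b : J} (hr : IsRootOn (z p - z q) a b) :
    ∃ u, u ≠ p ∧ IsRoot (z u - z q) ∧ z u a ≠ z q a := by
  have hqp : q ≠ p := fun h => hr.apply_left_ne (h ▸ rfl)
  obtain ⟨u, w, hup, hwp, huw, hne⟩ := H.exists_isRoot_apply_ne_of_ne hs hp hqp hr.apply_left_ne
  by_cases huq : u = q
  · exact ⟨w, hwp, huq ▸ (rootGraph z).adj_symm huw, huq ▸ hne.symm⟩
  by_cases hwq : w = q
  · exact ⟨u, hup, hwq ▸ huw, hwq ▸ hne⟩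
  · exact absurd (H.apply_eq_of_isRoot_of_disjoint hs h2 hC hr huw hup huq hwp hwq) hne

theorem not_isRoot_center_of_triangle (H : IsResonantRelation z s) (hs : ∀ i, s i ≠ 0)
    (h2 : ∀ i l j, z i - z l ≠ Pi.single j 2) {p q u w t : I} {a b c : J}
    (hp : IsRootOn (z p - z q) a b) (hu : IsRootOn (z u - z q) a c) (hw : IsRootOn (z w - z q) b c)
    (htp : t ≠ p) (htu : t ≠ u) (htw : t ≠ w) : ¬ IsRoot (z t - z q) := by
  intro ht
  have := H.apply_ne_iff_of_isRoot hs h2 hp ht htp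
  have := H.apply_ne_iff_of_isRoot hs h2 hu ht htu
  have := H.apply_ne_iff_of_isRoot hs h2 hw ht htw
  tauto

theorem not_isRoot_leaf_of_triangle (H : IsResonantRelation z s) (hs : ∀ i, s i ≠ 0)
    (h2 : ∀ i l j, z i - z l ≠ Pi.single j 2) {p q u w t : I} {a b c : J}
    (hp : IsRootOn (z p - z q) a b) (hu : IsRootOn (z u - z q) a c) (hw : IsRootOn (z w - z q) b c)
    (hpu : p ≠ u) (hpw : p ≠ w) (htq : t ≠ q) (htu : t ≠ u) (htw : t ≠ w) :
    ¬ IsRoot (z t - z p) := by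
  intro ht
  have hpq : p ≠ q := fun h => hp.apply_left_ne (h ▸ rfl)
  have := H.apply_ne_iff_of_isRoot hs h2 hp.sub_comm ht htq
  have := H.apply_eq_iff_of_disjoint hs hu htu htq hpu hpq
  have := H.apply_eq_iff_of_disjoint hs hw htw htq hpw hpq
  tauto

theorem exists_triangle (H : IsResonantRelation z s) (hs : ∀ i, s i ≠ 0)
    (h2 : ∀ i l j, z i - z l ≠ Pi.single j 2) (hC : (rootGraph z).Connected) {p q : I}
    (hp : ((rootGraph z).induce {p}ᶜ).Connected) {a b : J} (hr : IsRootOn (z p - z q) a b) :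
    ∃ u w c, u ≠ p ∧ w ≠ p ∧ u ≠ w ∧ IsRootOn (z u - z q) a c ∧ IsRootOn (z w - z q) b c := by
  obtain ⟨u, hup, hu, hua⟩ := H.exists_isRoot_apply_ne hs h2 hC hp hr
  obtain ⟨w, hwp, hw, hwb⟩ := H.exists_isRoot_apply_ne hs h2 hC hp hr.swap
  have hub := (H.apply_ne_iff_of_isRoot hs h2 hr hu hup).1 hua
  have hwa := (H.apply_ne_iff_of_isRoot hs h2 hr.swap hw hwp).1 hwb
  have huw : u ≠ w := fun h => hua (h ▸ hwa)
  obtain ⟨c, huc⟩ := hu.exists_isRootOn (sub_ne_zero.2 hua)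
  have hbc : b ≠ c := fun h => huc.apply_right_ne (h ▸ hub)
  have hwc := (H.apply_ne_iff_of_isRoot hs h2 huc.swap hw huw.symm).2 hwa
  exact ⟨u, w, c, hup, hwp, huw, huc,
    hw.isRootOn_of_ne hbc (sub_ne_zero.2 hwb) (sub_ne_zero.2 hwc)⟩

theorem exists_sub_eq_single_two_of_forall_ne_zero (H : IsResonantRelation z s)
    (hs : ∀ i, s i ≠ 0) (hC : (rootGraph z).Connected) : ∃ i l j, z i - z l = Pi.single j 2 := by
  classical
  by_contra! h2
  obtain ⟨i, l, hil⟩ : ∃ i l : I, i ≠ l := by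
    obtain ⟨p, hp⟩ := H.exists_coeff_ne_zero
    by_contra! h
    exact hp ((Finset.sum_eq_single p (fun i _ hi => absurd (h i p) hi) (by simp)).symm.trans H.sum)
  have : Nontrivial I := ⟨i, l, hil⟩
  obtain ⟨p, hp⟩ := hC.exists_connected_induce_compl_singleton_of_finite_nontrivial
  obtain ⟨q, a, b, hr⟩ := hC.preconnected.exists_adj_of_nontrivial p
  obtain ⟨u, w, c, hup, hwp, huw, hu, hw⟩ := H.exists_triangle hs h2 hC hp hr
  obtain ⟨x, hx, t, ht, hroot⟩ := H.exists_isRoot_mem_notMem hs h2 hC hr (S := {p, q, u, w})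
    Finset.card_le_four (by simp)
  simp only [Finset.mem_insert, Finset.mem_singleton, not_or] at hx ht
  obtain ⟨htp, htq, htu, htw⟩ := ht
  obtain rfl | rfl | rfl | rfl := hx
  · exact H.not_isRoot_leaf_of_triangle hs h2 hr hu hw hup.symm hwp.symm htq htu htw hroot
  · exact H.not_isRoot_center_of_triangle hs h2 hr hu hw htp htu htw hroot
  · exact H.not_isRoot_leaf_of_triangle hs h2 hu hr hw.swap hup huw htq htp htw hroot
  · exact H.not_isRoot_leaf_of_triangle hs h2 hw hr.swap hu.swap hwp huw.symm htq htp htu hroot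

end FullSupport

theorem exists_sub_eq_single_two {K I J : Type*} [Field K] [CharZero K] [Fintype I] [Finite J]
    [DecidableEq J] {z : I → J → ℤ} {s : I → K} (H : IsResonantRelation z s) {G : SimpleGraph I}
    (hG : G.Connected) (hroot : ∀ i l, G.Adj i l → IsRoot (z i - z l)) :
    ∃ i l j, z i - z l = Pi.single j 2 := by
  classical
  by_contra! h2
  obtain ⟨i, l, j, h⟩ := H.restrict.exists_sub_eq_single_two_of_forall_ne_zero (fun i => i.2)
    (H.connected_rootGraph hG hroot h2)
  exact h2 i l j h

end IsResonantRelation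

section Derivations

open MvPolynomial

theorem exists_derivation_algebraMap_eq {k A K : Type*} [CommRing k] [CommRing A] [CommRing K]
    [Algebra k A] [Algebra k K] [Algebra A K] [IsScalarTower k A K] [Algebra.FormallyEtale A K]
    (D : Derivation k A K) : ∃ E : Derivation k K K, ∀ a, E (algebraMap A K a) = D a := by
  let ℓ : Ω[K⁄k] →ₗ[K] K := D.liftKaehlerDifferential.liftBaseChange K ∘ₗ
    (KaehlerDifferential.tensorKaehlerEquivOfFormallyEtale k A K).symm.toLinearMap
  refine ⟨ℓ.compDer (KaehlerDifferential.D k K), fun a => ?_⟩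
  change ℓ (KaehlerDifferential.D k K (algebraMap A K a)) = D a
  simp only [ℓ, LinearMap.comp_apply, LinearEquiv.coe_coe, LinearMap.liftBaseChange_tmul,
    KaehlerDifferential.tensorKaehlerEquivOfFormallyEtale_symm_D_algebraMap,
    Derivation.liftKaehlerDifferential_comp_D, one_smul]

theorem formallyEtale_of_isAlgebraic (A K : Type*) [CommRing A] [IsDomain A] [CharZero A] [Field K]
    [Algebra A K] [FaithfulSMul A K] [Algebra.IsAlgebraic A K] : Algebra.FormallyEtale A K := by
  let : Algebra (FractionRing A) K := FractionRing.liftAlgebra A K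
  have : Algebra.IsAlgebraic (FractionRing A) K :=
    (IsFractionRing.comap_isAlgebraic_iff (A := A)).1 inferInstance
  have : Algebra.FormallyEtale (FractionRing A) K := .of_isSeparable _ _
  have : Algebra.FormallyEtale A (FractionRing A) := .of_isLocalization (nonZeroDivisors A)
  exact .comp A (FractionRing A) K

variable {k K ι : Type*} [Field k] [CharZero k] [Field K] [Algebra k K] {v : ι → K}

theorem exists_derivation_of_isTranscendenceBasis (hv : IsTranscendenceBasis k v) (d : ι → K) :
    ∃ D : Derivation k K K, ∀ i, D (v i) = d i := by
  let f : MvPolynomial ι k →ₐ[k] K := aeval v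
  let : Algebra (MvPolynomial ι k) K := f.toRingHom.toAlgebra
  have : IsScalarTower k (MvPolynomial ι k) K := .of_algebraMap_eq' f.comp_algebraMap.symm
  have : FaithfulSMul (MvPolynomial ι k) K := (faithfulSMul_iff_algebraMap_injective _ _).2 hv.1
  have : Algebra.IsAlgebraic (MvPolynomial ι k) K := by
    refine ⟨fun x => ?_⟩
    have h_comp : (RingHom.id K).comp (algebraMap (MvPolynomial ι k) K) =
        (algebraMap (Algebra.adjoin k (Set.range v)) K).comp hv.1.aevalEquiv :=
      RingHom.ext fun p => (hv.1.algebraMap_aevalEquiv p).symm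
    rw [← isAlgebraic_ringHom_iff_of_comp_eq hv.1.aevalEquiv (RingHom.id K)
      Function.injective_id h_comp]
    exact hv.isAlgebraic.1 x
  have := formallyEtale_of_isAlgebraic (MvPolynomial ι k) K
  obtain ⟨D, hD⟩ := exists_derivation_algebraMap_eq (mkDerivation k d)
  refine ⟨D, fun i => ?_⟩
  rw [← mkDerivation_X k d i, ← hD]
  exact congrArg D (aeval_X v i).symm

theorem exists_derivation_of_algebraicIndependent (hv : AlgebraicIndependent k v) (d : ι → K) :
    ∃ D : Derivation k K K, ∀ i, D (v i) = d i := by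
  obtain ⟨t, hst, ht⟩ := exists_isTranscendenceBasis_superset hv.coe_range
  obtain ⟨D, hD⟩ := exists_derivation_of_isTranscendenceBasis ht
    fun x : t => Function.extend v d 0 x
  exact ⟨D, fun i => (hD ⟨v i, hst ⟨i, rfl⟩⟩).trans (hv.injective.extend_apply d 0 i)⟩

end Derivations

/-- The value of the formal point `∑ Y t • t` when the symbols `t` take the values `u t`. -/
def formalEval {R ι : Type*} [CommRing R] [Fintype ι] (Y : ι → ℤ) (u : ι → R) : R :=
  ∑ t, Y t * u t

/-- The bilinear form whose sum over the coordinates of the symbols vanishes exactly when the formal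
point `∑ Y t • t` satisfies the equation `|∑ Y t • t|² = ∑ Y t |t|²`. -/
def vertexForm {R ι : Type*} [CommRing R] [Fintype ι] (Y : ι → ℤ) (u w : ι → R) : R :=
  formalEval Y u * formalEval Y w - ∑ t, Y t * (u t * w t)

/-- The matrix of `vertexForm`. -/
def vertexMatrix {ι : Type*} [DecidableEq ι] (Y : ι → ℤ) : Matrix ι ι ℤ :=
  Matrix.vecMulVec Y Y - Matrix.diagonal Y

theorem vertexMatrix_apply {ι : Type*} [DecidableEq ι] (Y : ι → ℤ) (t t' : ι) :
    vertexMatrix Y t t' = Y t * Y t' - if t = t' then Y t else 0 := by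
  simp [vertexMatrix, Matrix.vecMulVec_apply, Matrix.diagonal_apply]

theorem vertexMatrix_comm {ι : Type*} [DecidableEq ι] (Y : ι → ℤ) (t t' : ι) :
    vertexMatrix Y t t' = vertexMatrix Y t' t := by
  obtain rfl | h := eq_or_ne t t'
  · rfl
  · simp [vertexMatrix_apply, h, h.symm, mul_comm]

section Forms

variable {R ι : Type*} [CommRing R] [Fintype ι]

theorem formalEval_add_left (Y Y' : ι → ℤ) (u : ι → R) :
    formalEval (Y + Y') u = formalEval Y u + formalEval Y' u := by
  simp [formalEval, add_mul, Finset.sum_add_distrib]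

theorem formalEval_sub_left (Y Y' : ι → ℤ) (u : ι → R) :
    formalEval (Y - Y') u = formalEval Y u - formalEval Y' u := by
  simp [formalEval, sub_mul, Finset.sum_sub_distrib]

theorem formalEval_single [DecidableEq ι] (t : ι) (c : ℤ) (u : ι → R) :
    formalEval (Pi.single t c) u = c * u t := by
  rw [formalEval, Fintype.sum_eq_single t fun b hb => by simp [hb], Pi.single_eq_same]

theorem formalEval_single_right [DecidableEq ι] (Y : ι → ℤ) (t : ι) :
    formalEval Y (Pi.single t 1 : ι → R) = Y t := by
  rw [formalEval, Fintype.sum_eq_single t fun b hb => by simp [hb], Pi.single_eq_same, mul_one]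

theorem formalEval_add (Y : ι → ℤ) (u w : ι → R) :
    formalEval Y (u + w) = formalEval Y u + formalEval Y w := by
  simp [formalEval, mul_add, Finset.sum_add_distrib]

theorem formalEval_smul (Y : ι → ℤ) (r : R) (u : ι → R) :
    formalEval Y (r • u) = r * formalEval Y u := by
  simp only [formalEval, Finset.mul_sum, Pi.smul_apply, smul_eq_mul, mul_left_comm]

theorem formalEval_map {S : Type*} [CommRing S] (f : R →+* S) (Y : ι → ℤ) (u : ι → R) :
    formalEval Y (fun t => f (u t)) = f (formalEval Y u) := by
  simp [formalEval]

theorem vertexForm_map {S : Type*} [CommRing S] (f : R →+* S) (Y : ι → ℤ) (u w : ι → R) :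
    vertexForm Y (fun t => f (u t)) (fun t => f (w t)) = f (vertexForm Y u w) := by
  simp [vertexForm, formalEval_map]

theorem vertexForm_self (Y : ι → ℤ) (u : ι → R) :
    vertexForm Y u u = formalEval Y u ^ 2 - formalEval Y fun t => u t ^ 2 := by
  simp [vertexForm, formalEval, sq]

theorem vertexForm_comm (Y : ι → ℤ) (u w : ι → R) : vertexForm Y u w = vertexForm Y w u := by
  simp only [vertexForm, mul_comm (formalEval Y u), mul_comm (u _)]

theorem vertexForm_zero_right (Y : ι → ℤ) (u : ι → R) : vertexForm Y u 0 = 0 := by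
  simp [vertexForm, formalEval]

theorem vertexForm_eq_sum_vertexMatrix [DecidableEq ι] (Y : ι → ℤ) (u w : ι → R) :
    vertexForm Y u w = ∑ t, ∑ t', vertexMatrix Y t t' * (u t * w t') := by
  simp only [vertexForm, vertexMatrix_apply, Int.cast_sub, Int.cast_mul, sub_mul,
    Finset.sum_sub_distrib]
  congr 1
  · simp only [formalEval, Finset.sum_mul_sum, mul_mul_mul_comm]
  · simp

/-- The linear map with matrix `vertexMatrix Y`. -/
def vertexMap (R : Type*) [CommRing R] (Y : ι → ℤ) : (ι → R) →ₗ[R] (ι → R) where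
  toFun u t := Y t * formalEval Y u - Y t * u t
  map_add' u w := by
    ext t
    simp only [formalEval_add, Pi.add_apply]
    ring
  map_smul' r u := by
    ext t
    simp only [formalEval_smul, Pi.smul_apply, smul_eq_mul, RingHom.id_apply]
    ring

theorem vertexMap_apply (Y : ι → ℤ) (u : ι → R) (t : ι) :
    vertexMap R Y u t = Y t * formalEval Y u - Y t * u t := rfl

theorem vertexMap_single [DecidableEq ι] (Y : ι → ℤ) (t t' : ι) :
    vertexMap R Y (Pi.single t' 1) t = vertexMatrix Y t t' := by
  rw [vertexMap_apply, formalEval_single_right, vertexMatrix_apply]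
  by_cases h : t = t' <;> simp [h]

theorem vertexForm_eq_sum_vertexMap (Y : ι → ℤ) (u w : ι → R) :
    vertexForm Y u w = ∑ t, vertexMap R Y u t * w t := by
  simp only [vertexMap_apply, sub_mul, Finset.sum_sub_distrib, vertexForm, mul_assoc]
  congr 1
  rw [formalEval, formalEval, mul_comm, Finset.sum_mul]
  exact Finset.sum_congr rfl fun t _ => by ring

theorem derivation_formalEval {k : Type*} [CommRing k] [Algebra k R] (D : Derivation k R R)
    (Y : ι → ℤ) (u : ι → R) : D (formalEval Y u) = formalEval Y fun t => D (u t) := by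
  simp [formalEval]

theorem derivation_vertexForm {k : Type*} [CommRing k] [Algebra k R] (D : Derivation k R R)
    (Y : ι → ℤ) (u w : ι → R) : D (vertexForm Y u w) =
      vertexForm Y (fun t => D (u t)) w + vertexForm Y u fun t => D (w t) := by
  simp only [vertexForm, map_sub, map_sum, Derivation.leibniz, smul_eq_mul, derivation_formalEval,
    Derivation.map_intCast, mul_zero, add_zero, mul_add, Finset.sum_add_distrib, mul_comm (w _)]
  ring

end Forms

/-- The formal points `Y` and `Y'` satisfy the linear equation of an edge of `Γ_S` with marking
`(h, k)`. The symbol `some j` stands for `v j` and the symbol `none` for a point of `Γ_S`. -/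
def IsFormalEdge {J : Type*} [DecidableEq J] (h k : J) (Y Y' : Option J → ℤ) : Prop :=
  h ≠ k ∧ (Y' - Y = Pi.single (some k) 1 - Pi.single (some h) 1 ∨
    Y + Y' = Pi.single (some h) 1 + Pi.single (some k) 1)

theorem IsFormalEdge.exists_mul_eq (R : Type*) [CommRing R] {J : Type*} [Fintype J]
    [DecidableEq J] {h k : J} {Y Y' : Option J → ℤ} (H : IsFormalEdge h k Y Y') :
    ∃ (w : Option J → ℤ) (ε : ℤ),
      (w = Pi.single (some k) 1 - Pi.single (some h) 1 ∨ w = Y - Pi.single (some k) 1) ∧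
      ∀ u : Option J → R, 2 * (formalEval (Y - Pi.single (some h) 1) u * formalEval w u) =
        vertexForm Y' u u + ε * vertexForm Y u u := by
  rcases H.2 with H | H
  · refine ⟨_, -1, Or.inl rfl, fun u => ?_⟩
    obtain rfl : Y' = Y + Pi.single (some k) 1 - Pi.single (some h) 1 := by
      rw [add_sub_assoc, ← H]; simp
    simp only [vertexForm_self, formalEval_add_left, formalEval_sub_left, formalEval_single]
    push_cast
    ring
  · refine ⟨_, 1, Or.inr rfl, fun u => ?_⟩
    obtain rfl : Y' = Pi.single (some h) 1 + Pi.single (some k) 1 - Y := by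
      rw [← H]; simp
    simp only [vertexForm_self, formalEval_add_left, formalEval_sub_left, formalEval_single]
    push_cast
    ring

/-- A connected set of distinct formal points, each of total mass `1` and in which the symbol `none`
has coefficient `± 1`: the formal version of a connected subgraph of `Γ_S`. -/
structure IsFormalConfig {I J : Type*} [Fintype J] [DecidableEq J] (Y : I → Option J → ℤ) :
    Prop where
  sign : ∀ i, Y i none = 1 ∨ Y i none = -1
  mass : ∀ i, ∑ t, Y i t = 1
  inj : Function.Injective Y
  conn : ∃ G : SimpleGraph I, G.Connected ∧
    ∀ i l, G.Adj i l → ∃ h k, IsFormalEdge h k (Y i) (Y l)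

/-- `c` is an affine relation between the values of the formal points `Y i`, where `V a t` is the
`a`-th coordinate of the value of the symbol `t`. -/
structure IsFormalRelation {K I ι : Type*} [CommRing K] [Fintype I] [Fintype ι] {n : ℕ}
    (Y : I → ι → ℤ) (V : Fin n → ι → K) (c : I → K) : Prop where
  sum : ∑ i, c i = 0
  sum_mul : ∀ a, ∑ i, c i * formalEval (Y i) (V a) = 0

/-- The values `V` of the symbols satisfy the equations of the formal points `Y i`, none of which
has the value of one of the `v j`, and the only affine relation between these values involves the
point `o`. As before, `V a t` is the `a`-th coordinate of the value of the symbol `t`. -/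
structure IsDegenerate {K I J : Type*} [CommRing K] [Fintype I] [Fintype J] {n : ℕ}
    (Y : I → Option J → ℤ) (o : I) (V : Fin n → Option J → K) : Prop where
  quad : ∀ i, ∑ a, vertexForm (Y i) (V a) (V a) = 0
  not_special : ∀ i j, ∃ a, formalEval (Y i) (V a) ≠ V a (some j)
  indep : ∀ c : I → K, IsFormalRelation Y V c → c o = 0 → c = 0
  dep : ∃ c : I → K, IsFormalRelation Y V c ∧ c o = 1

/-- Derivations dual to the coordinates of the vectors `v j`. -/
def IsDualFamily {k K J : Type*} [CommRing k] [Field K] [Algebra k K] [DecidableEq J] {n : ℕ}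
    (D : J → Fin n → Derivation k K K) (V : Fin n → Option J → K) : Prop :=
  ∀ l b j a, D l b (V a (some j)) = if j = l ∧ a = b then 1 else 0

/-- The linear map of the quadratic form obtained by combining the equations of the points `Y i`
with the multipliers `± c i`. -/
def lagrangian {K I ι : Type*} [Field K] [Fintype I] [Fintype ι] (Y : I → Option ι → ℤ)
    (c : I → K) : (Option ι → K) →ₗ[K] (Option ι → K) :=
  ∑ i, ((Y i none : K) * c i) • vertexMap K (Y i)

section Relations

variable {K I J : Type*} [Fintype I] [Fintype J] {n : ℕ} {Y : I → Option J → ℤ} {o : I}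
  {V : Fin n → Option J → K} {c d : I → K}

theorem IsFormalRelation.of_sum_mul_eq_zero [CommRing K] (hY : ∀ i, ∑ t, Y i t = 1)
    (h : ∀ t, ∑ i, c i * Y i t = 0) : IsFormalRelation Y V c where
  sum := by
    calc ∑ i, c i = ∑ i, ∑ t, c i * Y i t := by
          simp only [← Finset.mul_sum, ← Int.cast_sum, hY, Int.cast_one, mul_one]
      _ = 0 := by rw [Finset.sum_comm, Finset.sum_eq_zero fun t _ => h t]
  sum_mul a := by
    simp only [formalEval, Finset.mul_sum, ← mul_assoc]
    rw [Finset.sum_comm]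
    exact Finset.sum_eq_zero fun t _ => by rw [← Finset.sum_mul, h, zero_mul]

theorem IsDegenerate.eq_mul [CommRing K] (hV : IsDegenerate Y o V) (hc : IsFormalRelation Y V c)
    (ho : c o = 1) (hd : IsFormalRelation Y V d) (i : I) : d i = d o * c i := by
  have h := hV.indep (fun i => d i - d o * c i)
    ⟨by rw [Finset.sum_sub_distrib, ← Finset.mul_sum, hd.sum, hc.sum, mul_zero, sub_zero],
      fun a => by
        simp only [sub_mul, mul_assoc, Finset.sum_sub_distrib, ← Finset.mul_sum, hd.sum_mul,
          hc.sum_mul, mul_zero, sub_zero]⟩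
    (by rw [ho, mul_one, sub_self])
  exact sub_eq_zero.1 (congrFun h i)

variable [Field K]

theorem lagrangian_apply (u : Option J → K) (t : Option J) :
    lagrangian Y c u t = ∑ i, (Y i none : K) * c i * vertexMap K (Y i) u t := by
  simp [lagrangian]

theorem lagrangian_single [DecidableEq J] (t t' : Option J) :
    lagrangian Y c (Pi.single t' 1) t = ∑ i, (Y i none : K) * c i * vertexMatrix (Y i) t t' := by
  simp only [lagrangian_apply, vertexMap_single]

theorem derivation_lagrangian {k : Type*} [CommRing k] [Algebra k K] {E : Derivation k K K}
    (hE : ∀ i, E (c i) = 0) (u : Option J → K) (t : Option J) :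
    E (lagrangian Y c u t) = lagrangian Y c (fun t => E (u t)) t := by
  simp only [lagrangian_apply, vertexMap_apply, map_sum, Derivation.leibniz, map_sub,
    Derivation.map_intCast, hE, derivation_formalEval, smul_eq_mul, mul_zero, add_zero]

end Relations

section Lagrangian

variable {k K I J : Type*} [CommRing k] [Field K] [Algebra k K] [Fintype I] [Fintype J]
  [DecidableEq J] {n : ℕ} {Y : I → Option J → ℤ} {o : I} {V : Fin n → Option J → K}
  {D : J → Fin n → Derivation k K K} {c : I → K}

omit [Fintype I] in
theorem IsFormalConfig.sign_mul_self (hY : IsFormalConfig Y) (i : I) :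
    Y i none * Y i none = 1 := by
  rcases hY.sign i with h | h <;> simp [h]

omit [Fintype I] in
theorem IsFormalConfig.cast_sign_mul_self (hY : IsFormalConfig Y) (i : I) :
    (Y i none : K) * Y i none = 1 := by
  exact_mod_cast congrArg (Int.cast (R := K)) (hY.sign_mul_self i)

theorem IsFormalConfig.lagrangian_none (hY : IsFormalConfig Y) (u : Option J → K) :
    lagrangian Y c u none = ∑ i, c i * formalEval (Y i) u - (∑ i, c i) * u none := by
  rw [lagrangian_apply, Finset.sum_mul, ← Finset.sum_sub_distrib]
  refine Finset.sum_congr rfl fun i _ => ?_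
  rw [vertexMap_apply]
  linear_combination (c i * formalEval (Y i) u - c i * u none) * hY.cast_sign_mul_self (K := K) i

omit [DecidableEq J] in
theorem IsDegenerate.sum_vertexMap_mul_derivation [CharZero K] (hV : IsDegenerate Y o V)
    (E : Derivation k K K) (i : I) : ∑ a, ∑ t, vertexMap K (Y i) (V a) t * E (V a t) = 0 := by
  have h := congrArg E (hV.quad i)
  simp only [map_sum, map_zero, derivation_vertexForm, vertexForm_comm _ _ (V _), ← two_mul,
    ← Finset.mul_sum] at h
  simpa only [vertexForm_eq_sum_vertexMap, mul_eq_zero, two_ne_zero, false_or] using h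

omit [DecidableEq J] in
theorem IsDegenerate.sum_lagrangian_mul_derivation [CharZero K] (hV : IsDegenerate Y o V)
    (E : Derivation k K K) : ∑ a, ∑ t, lagrangian Y c (V a) t * E (V a t) = 0 := by
  calc ∑ a, ∑ t, lagrangian Y c (V a) t * E (V a t)
      = ∑ i, (Y i none : K) * c i * ∑ a, ∑ t, vertexMap K (Y i) (V a) t * E (V a t) := by
        simp only [Finset.mul_sum, lagrangian_apply, Finset.sum_mul, mul_assoc]
        rw [Finset.sum_comm (s := (Finset.univ : Finset I))]
        exact Finset.sum_congr rfl fun a _ => Finset.sum_comm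
    _ = 0 := Finset.sum_eq_zero fun i _ => by
        rw [hV.sum_vertexMap_mul_derivation, mul_zero]

theorem lagrangian_eq_zero [CharZero K] (hY : IsFormalConfig Y) (hV : IsDegenerate Y o V)
    (hD : IsDualFamily D V) (hc : IsFormalRelation Y V c) (b : Fin n) :
    lagrangian Y c (V b) = 0 := by
  have h_none (b : Fin n) : lagrangian Y c (V b) none = 0 := by
    rw [hY.lagrangian_none, hc.sum, hc.sum_mul, zero_mul, sub_zero]
  ext t
  cases t with
  | none => exact h_none b
  | some l =>
    have h := hV.sum_lagrangian_mul_derivation (c := c) (D l b)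
    simp only [Fintype.sum_option, h_none, zero_mul, zero_add, hD l b] at h
    rw [Fintype.sum_eq_single b fun a ha => by simp [ha],
      Fintype.sum_eq_single l fun j hj => by simp [hj]] at h
    simpa using h

omit [Fintype J] in
theorem IsDualFamily.exists_ne (hn : 1 ≤ n) (hD : IsDualFamily D V) {h k : J} (hhk : h ≠ k) :
    ∃ a, V a (some k) ≠ V a (some h) := by
  refine ⟨⟨0, hn⟩, fun h_eq => ?_⟩
  have := congrArg (D h ⟨0, hn⟩) h_eq
  rw [hD, hD] at this
  simp [hhk.symm] at this

theorem exists_factorization_vertexForm [Nontrivial I] (hn : 1 ≤ n) (hY : IsFormalConfig Y)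
    (hV : IsDegenerate Y o V) (hD : IsDualFamily D V) :
    ∃ u w : Option J → ℤ, (∃ a, formalEval u (V a) ≠ 0) ∧ (∃ a, formalEval w (V a) ≠ 0) ∧
      ∃ (i l : I) (ε : ℤ), ∀ x : Option J → K, 2 * (formalEval u x * formalEval w x) =
        vertexForm (Y i) x x + ε * vertexForm (Y l) x x := by
  obtain ⟨G, hG, hGe⟩ := hY.conn
  obtain ⟨i, hadj⟩ := hG.preconnected.exists_adj_of_nontrivial o
  obtain ⟨h, k, hhk⟩ := hGe _ _ hadj
  obtain ⟨w, ε, hw, hmul⟩ := hhk.exists_mul_eq K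
  have h_special (j : J) : ∃ a, formalEval (Y o - Pi.single (some j) 1) (V a) ≠ 0 := by
    obtain ⟨a, ha⟩ := hV.not_special o j
    exact ⟨a, by rwa [formalEval_sub_left, formalEval_single, Int.cast_one, one_mul, sub_ne_zero]⟩
  refine ⟨_, w, h_special h, ?_, i, o, ε, hmul⟩
  rcases hw with rfl | rfl
  · obtain ⟨a, ha⟩ := hD.exists_ne hn hhk.1
    refine ⟨a, ?_⟩
    rwa [formalEval_sub_left, formalEval_single, formalEval_single, Int.cast_one, one_mul, one_mul,
      sub_ne_zero]
  · exact h_special k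

end Lagrangian

/-- The coefficients of the symbols `v j` in a formal point `± none + ∑ Y (some j) • v j`, the point
being normalised so that the symbol `none` has coefficient `1`. -/
def signedPoint {J : Type*} (Y : Option J → ℤ) (j : J) : ℤ := Y none * Y (some j)

section SignedPoint

variable {J : Type*} {Y Y' : Option J → ℤ}

theorem sum_signedPoint [Fintype J] (hs : Y none * Y none = 1) (hm : ∑ t, Y t = 1) :
    ∑ j, signedPoint Y j = Y none - 1 := by
  rw [Fintype.sum_option] at hm
  simp only [signedPoint, ← Finset.mul_sum]
  linear_combination Y none * hm - hs

theorem eq_of_signedPoint_eq (hs : Y none * Y none = 1) (h : Y none = Y' none)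
    (h' : signedPoint Y = signedPoint Y') : Y = Y' := by
  ext t
  cases t with
  | none => exact h
  | some j =>
    have hj := congrFun h' j
    simp only [signedPoint, ← h] at hj
    linear_combination Y none * hj + (Y' (some j) - Y (some j)) * hs

theorem IsFormalEdge.isRoot_signedPoint_sub [DecidableEq J] {h k : J} (H : IsFormalEdge h k Y Y')
    (hs : Y none = 1 ∨ Y none = -1) : IsRoot (signedPoint Y - signedPoint Y') := by
  obtain ⟨hhk, H⟩ := H
  obtain ⟨ε, hε⟩ : ∃ ε : ℤ, ∀ j, signedPoint Y j - signedPoint Y' j =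
      Y none * ((Pi.single h 1 : J → ℤ) j + ε * (Pi.single k 1 : J → ℤ) j) ∧ (ε = 1 ∨ ε = -1) := by
    rcases H with H | H
    · refine ⟨-1, fun j => ⟨?_, Or.inr rfl⟩⟩
      have h0 := congrFun H none
      have hj := congrFun H (some j)
      simp only [Pi.sub_apply, Pi.single_apply, Option.some_inj, reduceCtorEq, if_false] at h0 hj ⊢
      simp only [signedPoint]
      linear_combination -Y none * hj - Y' (some j) * h0
    · refine ⟨1, fun j => ⟨?_, Or.inl rfl⟩⟩
      have h0 := congrFun H none
      have hj := congrFun H (some j)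
      simp only [Pi.add_apply, Pi.single_apply, Option.some_inj, reduceCtorEq, if_false] at h0 hj ⊢
      simp only [signedPoint]
      linear_combination Y none * hj - Y' (some j) * h0
  obtain ⟨-, hε'⟩ := hε h
  have h_unit {x : ℤ} (hx : x = 1 ∨ x = -1) : Y none * x = 1 ∨ Y none * x = -1 := by
    rcases hs with h1 | h1 <;> rcases hx with h2 | h2 <;> simp [h1, h2]
  refine ⟨h, k, hhk, ?_, ?_, fun j hjh hjk => ?_⟩ <;> rw [Pi.sub_apply, (hε _).1]
  · rw [Pi.single_eq_same, Pi.single_eq_of_ne hhk, mul_zero, add_zero]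
    exact h_unit (Or.inl rfl)
  · rw [Pi.single_eq_same, Pi.single_eq_of_ne hhk.symm, mul_one, zero_add]
    exact h_unit hε'
  · rw [Pi.single_eq_of_ne hjh, Pi.single_eq_of_ne hjk, mul_zero, add_zero, mul_zero]

theorem eq_of_signedPoint_sub_eq_single_two [Fintype J] [DecidableEq J]
    (hs : Y none = 1 ∨ Y none = -1) (hs' : Y' none = 1 ∨ Y' none = -1) (hm : ∑ t, Y t = 1)
    (hm' : ∑ t, Y' t = 1) {j : J} (h : signedPoint Y - signedPoint Y' = Pi.single j 2) :
    Y' = Pi.single (some j) 2 - Y := by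
  have h_sum : (∑ x, signedPoint Y x) - ∑ x, signedPoint Y' x = 2 := by
    simp_rw [← Finset.sum_sub_distrib, ← Pi.sub_apply, h, Finset.sum_pi_single']
    simp
  rw [sum_signedPoint (by rcases hs with h | h <;> simp [h]) hm,
    sum_signedPoint (by rcases hs' with h | h <;> simp [h]) hm'] at h_sum
  have hY : Y none = 1 := by omega
  have hY' : Y' none = -1 := by omega
  ext t
  cases t with
  | none => simp [hY, hY']
  | some x =>
    have hx := congrFun h x
    simp only [Pi.sub_apply, signedPoint, hY, hY', Pi.single_apply, Option.some_inj] at hx ⊢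
    linear_combination hx

end SignedPoint

section NeZero

variable {K I J : Type*} [Fintype I] [Fintype J] [DecidableEq J] {n : ℕ} {Y : I → Option J → ℤ}
  {o : I} {V : Fin n → Option J → K} {c : I → K}

omit [Fintype I] in
theorem IsFormalConfig.injective_signedPoint (hY : IsFormalConfig Y) :
    Function.Injective fun i => signedPoint (Y i) := fun i l h => by
  refine hY.inj (eq_of_signedPoint_eq (hY.sign_mul_self i) ?_ h)
  have h_sum := congrArg (fun z => ∑ j, z j) h
  rwa [sum_signedPoint (hY.sign_mul_self i) (hY.mass i),
    sum_signedPoint (hY.sign_mul_self l) (hY.mass l), sub_left_inj] at h_sum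

theorem isResonantRelation_of_lagrangian_eq_zero [Field K] (hY : IsFormalConfig Y)
    (hV : IsDegenerate Y o V) (hc : IsFormalRelation Y V c) (ho : c o = 1)
    (hL : lagrangian Y c = 0) :
    IsResonantRelation (fun i => signedPoint (Y i)) fun i => (Y i none : K) * c i := by
  have hσ (i : I) : (Y i none : K) * Y i none = 1 := hY.cast_sign_mul_self i
  have h_mat (t t' : Option J) : ∑ i, (Y i none : K) * c i * vertexMatrix (Y i) t t' = 0 := by
    rw [← lagrangian_single, hL, LinearMap.zero_apply, Pi.zero_apply]
  refine ⟨fun h => ?_, ?_, fun j => ?_, fun j l hjl => ?_, fun d hd hd' => ?_,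
    hY.injective_signedPoint⟩
  · have h_o := congrFun h o
    rw [ho, mul_one, Pi.zero_apply] at h_o
    simpa [h_o] using hσ o
  · rw [← hc.sum, ← add_zero (∑ i, c i), ← h_mat none none, ← Finset.sum_add_distrib]
    refine Finset.sum_congr rfl fun i _ => ?_
    simp only [vertexMatrix_apply, if_true]
    push_cast
    linear_combination (c i - Y i none * c i) * hσ i
  · rw [← h_mat none (some j)]
    refine Finset.sum_congr rfl fun i _ => ?_
    simp [vertexMatrix_apply, signedPoint]
  · rw [← h_mat (some j) (some l)]
    refine Finset.sum_congr rfl fun i _ => ?_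
    simp only [vertexMatrix_apply, signedPoint, Option.some_inj, hjl, if_false]
    push_cast
    linear_combination (Y i none * c i * Y i (some j) * Y i (some l) : K) * hσ i
  · have h_rel : IsFormalRelation Y V fun i => (Y i none : K) * d i := by
      refine .of_sum_mul_eq_zero hY.mass fun t => ?_
      cases t with
      | none => simpa only [mul_right_comm _ (d _), hσ, one_mul] using hd
      | some j =>
        simpa only [signedPoint, Int.cast_mul, mul_left_comm (d _), ← mul_assoc] using hd' j
    refine ⟨Y o none * d o, fun i => ?_⟩
    linear_combination (Y i none : K) * hV.eq_mul hc ho h_rel i - d i * hσ i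

/-- A resonant relation would provide two points `x` and `x' = 2 v_j - x`, whose equations add up to
`2 |x - v_j|² = 0`. -/
theorem lagrangian_ne_zero [Field K] [LinearOrder K] [IsStrictOrderedRing K]
    (hY : IsFormalConfig Y) (hV : IsDegenerate Y o V) (hc : IsFormalRelation Y V c)
    (ho : c o = 1) : lagrangian Y c ≠ 0 := fun hL => by
  obtain ⟨G, hG, hGe⟩ := hY.conn
  obtain ⟨i, l, j, h⟩ :=
    (isResonantRelation_of_lagrangian_eq_zero hY hV hc ho hL).exists_sub_eq_single_two hG
      fun i l hadj => by
        obtain ⟨h, k, H⟩ := hGe i l hadj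
        exact H.isRoot_signedPoint_sub (hY.sign i)
  have hl := eq_of_signedPoint_sub_eq_single_two (hY.sign i) (hY.sign l) (hY.mass i) (hY.mass l) h
  have h_sq (a : Fin n) : (formalEval (Y i) (V a) - V a (some j)) ^ 2 * 2 =
      vertexForm (Y i) (V a) (V a) + vertexForm (Y l) (V a) (V a) := by
    simp only [vertexForm_self, hl, formalEval_sub_left, formalEval_single]
    push_cast
    ring
  have h_sum : ∑ a, (formalEval (Y i) (V a) - V a (some j)) ^ 2 = 0 := by
    rw [← mul_eq_zero_iff_right (two_ne_zero' K), Finset.sum_mul, Finset.sum_congr rfl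
      fun a _ => h_sq a, Finset.sum_add_distrib, hV.quad, hV.quad, add_zero]
  obtain ⟨a, ha⟩ := hV.not_special i j
  exact ha (sub_eq_zero.1 (sq_eq_zero_iff.1
    ((Finset.sum_eq_zero_iff_of_nonneg fun a _ => sq_nonneg _).1 h_sum a (Finset.mem_univ a))))

end NeZero

theorem exists_ker_map_eq {K U W W' : Type*} [Field K] [AddCommGroup U] [Module K U]
    [FiniteDimensional K U] [AddCommGroup W] [Module K W] [FiniteDimensional K W]
    [AddCommGroup W'] [Module K W'] [FiniteDimensional K W'] {Φ : U →ₗ[K] W} {ψ : U →ₗ[K] W'}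
    {P : Submodule K W} (hΦ : Function.Injective Φ) (hP : ∀ u, ψ u = 0 → Φ u ∈ P)
    (hdim : Module.finrank K W' + Module.finrank K P ≤ Module.finrank K U) {x : W} (hx : x ∈ P) :
    ∃ u, ψ u = 0 ∧ Φ u = x := by
  have h_le : (LinearMap.ker ψ).map Φ ≤ P := Submodule.map_le_iff_le_comap.2 fun u hu => hP u hu
  have h_rank := ψ.finrank_range_add_finrank_ker
  have h_range := (LinearMap.range ψ).finrank_le
  have h_map : Module.finrank K ((LinearMap.ker ψ).map Φ) = Module.finrank K (LinearMap.ker ψ) :=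
    ((LinearMap.ker ψ).equivMapOfInjective Φ hΦ).finrank_eq.symm
  rw [← Submodule.eq_of_le_of_finrank_le h_le (by omega)] at hx
  exact hx

theorem finrank_ker_compLeft_le {K ι M M' : Type*} [Field K] [AddCommGroup M] [Module K M]
    [FiniteDimensional K M] [AddCommGroup M'] [Module K M'] [Fintype ι] (L : M →ₗ[K] M') :
    Module.finrank K (LinearMap.ker (L.compLeft ι)) ≤
      Fintype.card ι * Module.finrank K (LinearMap.ker L) := by
  let f : LinearMap.ker (L.compLeft ι) →ₗ[K] (ι → LinearMap.ker L) :=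
    LinearMap.pi fun a => (LinearMap.proj a).restrict fun x hx => congrFun hx a
  have hf : Function.Injective f := fun x y h =>
    Subtype.ext (funext fun a => congrArg Subtype.val (congrFun h a))
  simpa [Module.finrank_pi_fintype] using LinearMap.finrank_le_finrank_of_injective hf

theorem formalEval_eq_zero_or_of_mul {K ι : Type*} [Field K] [Fintype ι]
    {P : Submodule K (ι → K)} {u w : ι → ℤ}
    (h : ∀ x ∈ P, formalEval u x * formalEval w x = 0) :
    (∀ x ∈ P, formalEval u x = 0) ∨ ∀ x ∈ P, formalEval w x = 0 := by
  by_contra! hne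
  obtain ⟨⟨x, hx, hux⟩, y, hy, hwy⟩ := hne
  have hwx : formalEval w x = 0 := (mul_eq_zero.1 (h x hx)).resolve_left hux
  have huy : formalEval u y = 0 := (mul_eq_zero.1 (h y hy)).resolve_right hwy
  have hxy := h (x + y) (P.add_mem hx hy)
  rw [formalEval_add, formalEval_add, hwx, huy, add_zero, zero_add] at hxy
  exact mul_ne_zero hux hwy hxy

theorem IsDualFamily.exists_linearMap {k K J : Type*} [CommRing k] [Field K] [Algebra k K]
    [Finite J] [DecidableEq J] {n : ℕ} {V : Fin n → Option J → K}
    {D : J → Fin n → Derivation k K K} (hD : IsDualFamily D V) :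
    ∃ T : (J → Fin n → K) →ₗ[K] Derivation k K K, ∀ u j a, T u (V a (some j)) = u j a := by
  cases nonempty_fintype J
  let coord (l : J) (b : Fin n) : (J → Fin n → K) →ₗ[K] K := LinearMap.proj b ∘ₗ LinearMap.proj l
  refine ⟨∑ l, ∑ b, (coord l b).smulRight (D l b), fun u j a => ?_⟩
  let ev : Derivation k K K →ₗ[K] K :=
    { toFun := fun E => E (V a (some j)), map_add' := fun _ _ => rfl, map_smul' := fun _ _ => rfl }
  change ev _ = _
  simp only [LinearMap.coe_sum, Finset.sum_apply, map_sum, LinearMap.smulRight_apply,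
    coord, LinearMap.comp_apply, LinearMap.proj_apply, map_smul, smul_eq_mul]
  rw [Fintype.sum_eq_single j fun l hl => Finset.sum_eq_zero fun b _ => ?_,
    Fintype.sum_eq_single a fun b hb => ?_]
  all_goals simp only [ev, LinearMap.coe_mk, AddHom.coe_mk, hD _ _ j a]
  · simp
  · simp [hb.symm]
  · simp [hl.symm]

theorem finrank_add_finrank_ker_compLeft_le {K J : Type*} [Field K] [Finite J] {n : ℕ}
    {L : (Option J → K) →ₗ[K] Option J → K}
    (hr : 2 ≤ Module.finrank K (LinearMap.range L)) {d : ℕ} (hd : d ≤ n) :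
    d + Module.finrank K (LinearMap.ker (L.compLeft (Fin n))) ≤
      Module.finrank K (J → Fin n → K) := by
  cases nonempty_fintype J
  have h_ker := finrank_ker_compLeft_le (ι := Fin n) L
  have h_rank := L.finrank_range_add_finrank_ker
  rw [Module.finrank_fintype_fun_eq_card, Fintype.card_option] at h_rank
  have h_mul := Nat.mul_le_mul_left n
    (show Module.finrank K (LinearMap.ker L) + 1 ≤ Fintype.card J by omega)
  rw [Fintype.card_fin] at h_ker
  simp only [Module.finrank_pi_fintype, Module.finrank_self, Fintype.card_fin, Finset.sum_const,
    Finset.card_univ, smul_eq_mul, mul_one]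
  rw [mul_comm (Fintype.card J)]
  rw [mul_add, mul_one] at h_mul
  omega

section Rank

variable {k K I J : Type*} [CommRing k] [Field K] [Algebra k K] [Fintype I] [Fintype J]
  [DecidableEq J] {n : ℕ} {Y : I → Option J → ℤ} {o : I} {V : Fin n → Option J → K}
  {D : J → Fin n → Derivation k K K} {c : I → K}

theorem derivation_eq_zero_of_sum_eq_zero {E : Derivation k K K} {i₁ : I} (hi₁ : i₁ ≠ o)
    (hc : ∑ i, c i = 0) (ho : c o = 1) (h : ∀ i, i ≠ o → i ≠ i₁ → E (c i) = 0) (i : I) :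
    E (c i) = 0 := by
  classical
  have h_o : E (c o) = 0 := by rw [ho, E.map_one_eq_zero]
  have h_ne (i : I) (hi : i ≠ i₁) : E (c i) = 0 := by
    rcases eq_or_ne i o with rfl | hio
    · exact h_o
    · exact h i hio hi
  rcases eq_or_ne i i₁ with rfl | hi
  · rw [← Fintype.sum_eq_single (f := fun i => E (c i)) i h_ne, ← map_sum, hc, map_zero]
  · exact h_ne i hi

/-- Fixing the coefficients `c i` imposes at most `n` conditions on the derivation, whereas rank at
least two makes the kernel of the Lagrangian small enough for the `n` coordinate vectors to fill it
up under these conditions. -/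
theorem exists_derivation_of_two_le_finrank_range [Nontrivial I] (hcard : Fintype.card I ≤ n + 2)
    (hD : IsDualFamily D V) (hc : ∑ i, c i = 0) (ho : c o = 1)
    (hL : ∀ b, lagrangian Y c (V b) = 0)
    (hr : 2 ≤ Module.finrank K (LinearMap.range (lagrangian Y c)))
    {x : Fin n → Option J → K} (hx : ∀ a, lagrangian Y c (x a) = 0) :
    ∃ E : Derivation k K K, (∀ i, E (c i) = 0) ∧ ∀ a t, E (V a t) = x a t := by
  classical
  obtain ⟨i₁, hi₁⟩ := exists_ne o
  obtain ⟨T, hT⟩ := hD.exists_linearMap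
  let ev (y : K) : Derivation k K K →ₗ[K] K :=
    { toFun := fun E => E y, map_add' := fun _ _ => rfl, map_smul' := fun _ _ => rfl }
  let Φ : (J → Fin n → K) →ₗ[K] Fin n → Option J → K :=
    LinearMap.pi fun a => LinearMap.pi fun t => ev (V a t) ∘ₗ T
  let ψ : (J → Fin n → K) →ₗ[K] (({o, i₁}ᶜ : Finset I) → K) :=
    LinearMap.pi fun i => ev (c i) ∘ₗ T
  have hψ (u) (hu : ψ u = 0) (i : I) : T u (c i) = 0 :=
    derivation_eq_zero_of_sum_eq_zero hi₁ hc ho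
      (fun i hio hi => congrFun hu ⟨i, by simp [hio, hi]⟩) i
  have hΦ : Function.Injective Φ := fun u w h => by
    ext j a
    rw [← hT u j a, ← hT w j a]
    exact congrFun (congrFun h a) (some j)
  have hP (u) (hu : ψ u = 0) : Φ u ∈ LinearMap.ker ((lagrangian Y c).compLeft (Fin n)) := by
    ext a t
    exact (derivation_lagrangian (hψ u hu) (V a) t).symm.trans (by rw [hL]; exact map_zero _)
  have h_conditions : Module.finrank K (({o, i₁}ᶜ : Finset I) → K) ≤ n := by
    rw [Module.finrank_fintype_fun_eq_card, Fintype.card_coe, Finset.card_compl,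
      Finset.card_pair hi₁.symm]
    omega
  obtain ⟨u, hu, hux⟩ := exists_ker_map_eq hΦ hP
    (finrank_add_finrank_ker_compLeft_le hr h_conditions) (x := x) (by ext a t; simp [hx])
  exact ⟨T u, hψ u hu, fun a t => congrFun (congrFun hux a) t⟩

section

variable [CharZero K]
  (hE : ∀ x : Fin n → Option J → K, (∀ a, lagrangian Y c (x a) = 0) →
    ∃ E : Derivation k K K, (∀ i, E (c i) = 0) ∧ ∀ a t, E (V a t) = x a t)
include hE

omit [DecidableEq J] in
theorem IsDegenerate.vertexForm_eq_zero_of_exists_derivation (hV : IsDegenerate Y o V)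
    {x : Option J → K} (hx : lagrangian Y c x = 0) (i : I) (a : Fin n) :
    vertexForm (Y i) (V a) x = 0 := by
  obtain ⟨E, -, hEV⟩ := hE (Pi.single a x) fun b => by
    rcases eq_or_ne b a with rfl | hb
    · rwa [Pi.single_eq_same]
    · rw [Pi.single_eq_of_ne hb, map_zero]
  have h := congrArg E (hV.quad i)
  simp only [map_sum, map_zero, derivation_vertexForm, hEV, vertexForm_comm _ _ (V _),
    ← two_mul] at h
  rw [Fintype.sum_eq_single a fun b hb => ?_, Pi.single_eq_same] at h
  · exact (mul_eq_zero.1 h).resolve_left two_ne_zero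
  · rw [Pi.single_eq_of_ne hb]
    exact (congrArg _ (vertexForm_zero_right _ _)).trans (mul_zero _)

omit [DecidableEq J] in
theorem IsDegenerate.vertexForm_self_eq_zero_of_exists_derivation (hn : 1 ≤ n)
    (hV : IsDegenerate Y o V) {x : Option J → K} (hx : lagrangian Y c x = 0) (i : I) :
    vertexForm (Y i) x x = 0 := by
  let a : Fin n := ⟨0, hn⟩
  obtain ⟨E, hEc, hEV⟩ := hE (fun _ => x) fun _ => hx
  have h := congrArg E (hV.vertexForm_eq_zero_of_exists_derivation hE hx i a)
  have h_ker : lagrangian Y c (fun t => E (x t)) = 0 := by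
    ext t
    rw [← derivation_lagrangian hEc, hx]
    exact map_zero E
  rwa [derivation_vertexForm, map_zero, hV.vertexForm_eq_zero_of_exists_derivation hE h_ker,
    add_zero, funext (hEV a)] at h

end

theorem finrank_range_lagrangian_le_one [CharZero K] [Nontrivial I] (hn : 1 ≤ n)
    (hcard : Fintype.card I ≤ n + 2) (hY : IsFormalConfig Y) (hV : IsDegenerate Y o V)
    (hD : IsDualFamily D V) (hc : IsFormalRelation Y V c) (ho : c o = 1) :
    Module.finrank K (LinearMap.range (lagrangian Y c)) ≤ 1 := by
  by_contra! hr
  have hL := lagrangian_eq_zero hY hV hD hc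
  have hE (x : Fin n → Option J → K) (hx : ∀ a, lagrangian Y c (x a) = 0) :=
    exists_derivation_of_two_le_finrank_range hcard hD hc.sum ho hL hr hx
  obtain ⟨u, w, ⟨a, ha⟩, ⟨b, hb⟩, i, l, ε, h_mul⟩ := exists_factorization_vertexForm hn hY hV hD
  have h_zero (x) (hx : x ∈ LinearMap.ker (lagrangian Y c)) :
      formalEval u x * formalEval w x = 0 := by
    have h := h_mul x
    rw [hV.vertexForm_self_eq_zero_of_exists_derivation hE hn hx,
      hV.vertexForm_self_eq_zero_of_exists_derivation hE hn hx, mul_zero, add_zero] at h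
    exact (mul_eq_zero.1 h).resolve_left two_ne_zero
  rcases formalEval_eq_zero_or_of_mul h_zero with h | h
  · exact ha (h _ (hL a))
  · exact hb (h _ (hL b))

end Rank

section StandardPart

open ArchimedeanClass

variable {K ι κ : Type*} [Field K] [LinearOrder K] [IsStrictOrderedRing K]

theorem mk_sum_nonneg_and_stdPart_sum {s : Finset ι} {f : ι → K} (hf : ∀ i ∈ s, 0 ≤ mk (f i)) :
    0 ≤ mk (∑ i ∈ s, f i) ∧ stdPart (∑ i ∈ s, f i) = ∑ i ∈ s, stdPart (f i) := by
  classical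
  induction s using Finset.induction_on with
  | empty => simp
  | insert a s ha ih =>
    obtain ⟨h_mk, h_std⟩ := ih fun i hi => hf i (Finset.mem_insert_of_mem hi)
    have h_a := hf a (Finset.mem_insert_self _ _)
    rw [Finset.sum_insert ha, Finset.sum_insert ha, ← h_std]
    exact ⟨(le_min h_a h_mk).trans (min_le_mk_add _ _), stdPart_add h_a h_mk⟩

theorem mk_nonneg_of_abs_le_one {x : K} (hx : |x| ≤ 1) : 0 ≤ mk x := by
  rw [← mk_one (R := K), mk_le_mk]
  exact ⟨1, by simpa using hx⟩

variable [Algebra ℝ K]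

/-- The structure map of an ordered field over `ℝ`, which is automatically monotone since the
nonnegative real numbers are squares. -/
def realOrderHom (K : Type*) [Field K] [LinearOrder K] [IsStrictOrderedRing K] [Algebra ℝ K] :
    ℝ →+*o K :=
  { algebraMap ℝ K with
    monotone' :=
      ringHom_monotone (fun r hr => ⟨√r, (Real.mul_self_sqrt hr).symm⟩) (algebraMap ℝ K) }

theorem mk_algebraMap_real_nonneg (r : ℝ) : 0 ≤ mk (algebraMap ℝ K r) :=
  mk_map_nonneg_of_archimedean (realOrderHom K) r

theorem stdPart_algebraMap_real (r : ℝ) : stdPart (algebraMap ℝ K r) = r :=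
  stdPart_map_real (realOrderHom K) r

variable [Finite ι] [Fintype κ] {x : ι → K} {s : κ → K} {M : κ → ι → ℤ}

theorem dual_stdPart_eq_zero (hx : ∀ e, 0 ≤ mk (x e)) (h : ∀ e, x e = ∑ i, s i * M i e)
    {φ : Module.Dual ℝ (ι → ℝ)} (hφ : ∀ i, φ (fun e => (M i e : ℝ)) = 0) :
    φ (fun e => stdPart (x e)) = 0 := by
  classical
  cases nonempty_fintype ι
  let c (e : ι) : ℝ := φ fun e' => if e = e' then 1 else 0
  have hφc (y : ι → ℝ) : φ y = ∑ e, y e * c e := φ.pi_apply_eq_sum_univ y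
  have h_zero : ∑ e, x e * algebraMap ℝ K (c e) = 0 := by
    calc ∑ e, x e * algebraMap ℝ K (c e)
        = ∑ i, s i * algebraMap ℝ K (∑ e, M i e * c e) := by
          simp only [h, Finset.sum_mul, map_sum, map_mul, map_intCast, Finset.mul_sum, mul_assoc]
          exact Finset.sum_comm
      _ = 0 := Finset.sum_eq_zero fun i _ => by rw [← hφc, hφ, map_zero, mul_zero]
  have h_mk (e : ι) (_ : e ∈ Finset.univ) : 0 ≤ mk (x e * algebraMap ℝ K (c e)) := by
    rw [mk_mul]
    exact add_nonneg (hx e) (mk_algebraMap_real_nonneg _)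
  rw [hφc, ← stdPart_zero (K := K), ← h_zero, (mk_sum_nonneg_and_stdPart_sum h_mk).2]
  exact Finset.sum_congr rfl fun e _ => by
    rw [stdPart_mul (hx e) (mk_algebraMap_real_nonneg _), stdPart_algebraMap_real]

theorem exists_stdPart_eq_sum (hx : ∀ e, 0 ≤ mk (x e)) (h : ∀ e, x e = ∑ i, s i * M i e) :
    ∃ r : κ → ℝ, ∀ e, stdPart (x e) = ∑ i, r i * M i e := by
  let W : Submodule ℝ (ι → ℝ) := Submodule.span ℝ (Set.range fun i e => (M i e : ℝ))
  have h_mem : (fun e => stdPart (x e)) ∈ W := by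
    by_contra h_notMem
    obtain ⟨φ, hφ, hφW⟩ := W.exists_dual_map_eq_bot_of_notMem h_notMem inferInstance
    refine hφ (dual_stdPart_eq_zero hx h fun i => ?_)
    have hi := Submodule.mem_map_of_mem (f := φ) (Submodule.subset_span ⟨i, rfl⟩ : _ ∈ W)
    rwa [hφW, Submodule.mem_bot] at hi
  obtain ⟨r, hr⟩ := (Submodule.mem_span_range_iff_exists_fun ℝ).1 h_mem
  exact ⟨r, fun e => by simp [← congrFun hr e]⟩

end StandardPart

section RankOne

variable {K ι : Type*} [Field K] [LinearOrder K] [IsStrictOrderedRing K] [Finite ι]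
  [DecidableEq ι] {L : (ι → K) →ₗ[K] (ι → K)}

omit [LinearOrder K] [IsStrictOrderedRing K] in
theorem exists_single_eq_mul_of_finrank_range_le_one
    (hr : Module.finrank K (LinearMap.range L) ≤ 1) :
    ∃ f w : ι → K, ∀ t t', L (Pi.single t' 1) t = f t' * w t := by
  cases nonempty_fintype ι
  obtain ⟨w, hw⟩ := finrank_le_one_iff.1 hr
  choose f hf using fun t' => hw ⟨L (Pi.single t' 1), _, rfl⟩
  exact ⟨f, w.1, fun t t' => (congrFun (congrArg Subtype.val (hf t')) t).symm⟩

/-- Normalising by an entry of maximal absolute value keeps the standard parts finite and not all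
zero. -/
theorem exists_single_eq_mul_of_symm (hr : Module.finrank K (LinearMap.range L) ≤ 1)
    (hL : L ≠ 0) (hsymm : ∀ t t', L (Pi.single t' 1) t = L (Pi.single t 1) t') :
    ∃ ξ : ι → K, (∀ t, |ξ t| ≤ 1) ∧ (∃ t, ξ t = 1) ∧
      ∃ θ ≠ 0, ∀ t t', L (Pi.single t' 1) t = θ * (ξ t * ξ t') := by
  obtain ⟨f, w, hfw⟩ := exists_single_eq_mul_of_finrank_range_le_one hr
  obtain ⟨t', t, ht⟩ : ∃ t' t, f t' * w t ≠ 0 := by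
    by_contra! h
    refine hL (LinearMap.pi_ext' fun t' => LinearMap.ext_ring (funext fun t => ?_))
    exact (hfw t t').trans (h t' t)
  have : Nonempty ι := ⟨t⟩
  obtain ⟨t₀, ht₀⟩ := Finite.exists_max fun t => |w t|
  have hw₀ : w t₀ ≠ 0 := fun h => by
    have h_le := ht₀ t
    rw [h, abs_zero] at h_le
    exact ht (by rw [abs_nonpos_iff.1 h_le, mul_zero])
  have hf (t : ι) : f t * w t₀ = f t₀ * w t := by rw [← hfw, hsymm, hfw]
  refine ⟨fun t => w t / w t₀, fun t => ?_, ⟨t₀, div_self hw₀⟩, f t₀ * w t₀, ?_, fun t t' => ?_⟩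
  · rw [abs_div]
    exact div_le_one_of_le₀ (ht₀ t) (abs_nonneg _)
  · refine mul_ne_zero (fun h => ht ?_) hw₀
    have h_zero := hf t'
    rw [h, zero_mul] at h_zero
    rw [(mul_eq_zero.1 h_zero).resolve_right hw₀, zero_mul]
  · rw [hfw]
    field_simp
    linear_combination w t * hf t'

end RankOne

section RealRelation

variable {K I J : Type*} [Field K] [Fintype I] [Fintype J] {n : ℕ} {Y : I → Option J → ℤ} {o : I}
  {V : Fin n → Option J → K} {c : I → K}

open ArchimedeanClass in
theorem exists_mul_eq_sum_vertexMatrix [LinearOrder K] [IsStrictOrderedRing K] [Algebra ℝ K]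
    [DecidableEq J] (hr : Module.finrank K (LinearMap.range (lagrangian Y c)) ≤ 1)
    (hL : lagrangian Y c ≠ 0) :
    ∃ x : Option J → ℝ, x ≠ 0 ∧
      ∃ r : I → ℝ, ∀ t t', x t * x t' = ∑ i, r i * vertexMatrix (Y i) t t' := by
  obtain ⟨ξ, hξ, ⟨t₀, ht₀⟩, θ, hθ, hLξ⟩ := exists_single_eq_mul_of_symm hr hL fun t t' => by
    simp only [lagrangian_single, vertexMatrix_comm _ t]
  have h_mk (t : Option J) : 0 ≤ mk (ξ t) := mk_nonneg_of_abs_le_one (hξ t)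
  have hξξ (e : Option J × Option J) : ξ e.1 * ξ e.2 =
      ∑ i, (Y i none * c i / θ) * (vertexMatrix (Y i) e.1 e.2 : ℤ) := by
    rw [eq_div_of_mul_eq hθ ((mul_comm _ _).trans (hLξ e.1 e.2).symm), lagrangian_single,
      Finset.sum_div]
    exact Finset.sum_congr rfl fun i _ => by ring
  obtain ⟨r, hr⟩ := exists_stdPart_eq_sum
    (fun e => by rw [mk_mul]; exact add_nonneg (h_mk e.1) (h_mk e.2)) hξξ
  refine ⟨fun t => stdPart (ξ t), fun h => ?_, r, fun t t' => ?_⟩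
  · simpa [ht₀] using congrFun h t₀
  · rw [← stdPart_mul (h_mk t) (h_mk t'), hr (t, t')]

theorem sq_sum_eq_sum_vertexForm {k ι : Type*} [CommRing k] [Algebra k K] [Fintype ι]
    [DecidableEq ι] {Y : I → ι → ℤ} {x : ι → k} {r : I → k}
    (h : ∀ t t', x t * x t' = ∑ i, r i * vertexMatrix (Y i) t t') (v : ι → K) :
    (∑ t, algebraMap k K (x t) * v t) ^ 2 =
      ∑ i, algebraMap k K (r i) * vertexForm (Y i) v v := by
  simp only [vertexForm_eq_sum_vertexMatrix, sq, Fintype.sum_mul_sum]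
  simp only [Finset.mul_sum]
  rw [Finset.sum_comm (s := (Finset.univ : Finset I))]
  refine Finset.sum_congr rfl fun t _ => ?_
  rw [Finset.sum_comm (s := (Finset.univ : Finset I))]
  refine Finset.sum_congr rfl fun t' _ => ?_
  rw [mul_mul_mul_comm, ← map_mul, h, map_sum, Finset.sum_mul]
  exact Finset.sum_congr rfl fun i _ => by rw [map_mul, map_intCast, mul_assoc]

theorem exists_real_relation [LinearOrder K] [IsStrictOrderedRing K] [Algebra ℝ K]
    (hV : IsDegenerate Y o V) (hr : Module.finrank K (LinearMap.range (lagrangian Y c)) ≤ 1)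
    (hL : lagrangian Y c ≠ 0) :
    ∃ x : Option J → ℝ, x ≠ 0 ∧ ∀ a, ∑ t, algebraMap ℝ K (x t) * V a t = 0 := by
  classical
  obtain ⟨x, hx, r, hxr⟩ := exists_mul_eq_sum_vertexMatrix hr hL
  refine ⟨x, hx, fun a => ?_⟩
  have h_sum : ∑ a, (∑ t, algebraMap ℝ K (x t) * V a t) ^ 2 = 0 := by
    simp only [sq_sum_eq_sum_vertexForm hxr]
    rw [Finset.sum_comm]
    exact Finset.sum_eq_zero fun i _ => by rw [← Finset.mul_sum, hV.quad, mul_zero]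
  exact sq_eq_zero_iff.1
    ((Finset.sum_eq_zero_iff_of_nonneg fun a _ => sq_nonneg _).1 h_sum a (Finset.mem_univ a))

end RealRelation

section NoRelation

variable {k K J : Type*} [Field k] [Field K] [Algebra k K] [Fintype J] {n : ℕ}
  {V : Fin n → Option J → K} {D : J → Fin n → Derivation k K K}

theorem IsDualFamily.exists_none_eq_sum [DecidableEq J] (hn : 1 ≤ n) (hD : IsDualFamily D V)
    {x : Option J → k} (hx : x ≠ 0) (h : ∀ a, ∑ t, algebraMap k K (x t) * V a t = 0) :
    ∃ y : J → k, ∀ a, V a none = ∑ j, algebraMap k K (y j) * V a (some j) := by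
  have hx_none : x none ≠ 0 := fun h_none => hx <| funext fun t => by
    cases t with
    | none => exact h_none
    | some l =>
      have hl := congrArg (D l ⟨0, hn⟩) (h ⟨0, hn⟩)
      rw [Fintype.sum_option, h_none] at hl
      simp only [map_zero, zero_mul, zero_add, map_sum, Derivation.leibniz,
        Derivation.map_algebraMap, smul_zero, add_zero, hD l ⟨0, hn⟩] at hl
      simpa using hl
  have hx_none' : algebraMap k K (x none) ≠ 0 := by simpa using hx_none
  refine ⟨fun j => -x (some j) / x none, fun a => ?_⟩
  have ha := h a
  rw [Fintype.sum_option, mul_comm, ← eq_neg_iff_add_eq_zero, ← eq_div_iff hx_none'] at ha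
  rw [ha, ← Finset.sum_neg_distrib, Finset.sum_div]
  refine Finset.sum_congr rfl fun j _ => ?_
  rw [map_div₀, map_neg]
  ring

variable {y : J → k} (hy : ∀ a, V a none = ∑ j, algebraMap k K (y j) * V a (some j))
include hy

theorem formalEval_eq_sum_of_none_eq_sum (U : Option J → ℤ) (a : Fin n) :
    formalEval U (V a) = ∑ j, algebraMap k K (U none * y j + U (some j)) * V a (some j) := by
  rw [formalEval, Fintype.sum_option, hy, Finset.mul_sum, ← Finset.sum_add_distrib]
  exact Finset.sum_congr rfl fun j _ => by rw [map_add, map_mul, map_intCast, map_intCast]; ring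

theorem IsDualFamily.formalEval_eq_ite [DecidableEq J] (hD : IsDualFamily D V)
    (U : Option J → ℤ) (l : J) (b a : Fin n) : D l b (formalEval U (V a)) =
      if a = b then algebraMap k K (U none * y l + U (some l)) else 0 := by
  rw [formalEval_eq_sum_of_none_eq_sum hy]
  simp only [map_sum, Derivation.leibniz, Derivation.map_algebraMap, add_zero, hD l b,
    smul_eq_mul, mul_ite, mul_one, mul_zero]
  by_cases hab : a = b <;> simp [hab]

theorem IsDualFamily.mul_formalEval_add_mul_formalEval [DecidableEq J] (hD : IsDualFamily D V)
    {u w : Option J → ℤ} (huw : ∑ a, formalEval u (V a) * formalEval w (V a) = 0) (l : J)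
    (b : Fin n) :
    algebraMap k K (w none * y l + w (some l)) * formalEval u (V b) +
      algebraMap k K (u none * y l + u (some l)) * formalEval w (V b) = 0 := by
  have h := congrArg (D l b) huw
  simp only [map_sum, map_zero, Derivation.leibniz, hD.formalEval_eq_ite hy, smul_eq_mul, mul_ite,
    mul_zero, Finset.sum_add_distrib, Finset.sum_ite_eq', Finset.mem_univ, if_true] at h
  linear_combination h

theorem IsDualFamily.eq_zero_or_of_sum_mul_eq_zero [LinearOrder K] [IsStrictOrderedRing K]
    [DecidableEq J] (hD : IsDualFamily D V) {u w : Option J → ℤ}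
    (huw : ∑ a, formalEval u (V a) * formalEval w (V a) = 0) :
    (∀ a, formalEval u (V a) = 0) ∨ ∀ a, formalEval w (V a) = 0 := by
  by_cases hu : ∀ l, (u none * y l + u (some l) : k) = 0
  · exact Or.inl fun a => by
      rw [formalEval_eq_sum_of_none_eq_sum hy, Finset.sum_eq_zero fun j _ => ?_]
      rw [hu, map_zero, zero_mul]
  obtain ⟨l, hl⟩ := not_forall.1 hu
  have h_lin := hD.mul_formalEval_add_mul_formalEval hy huw l
  have h_sum : algebraMap k K (u none * y l + u (some l)) * ∑ a, formalEval w (V a) ^ 2 = 0 := by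
    rw [← neg_eq_zero, ← mul_zero (algebraMap k K (w none * y l + w (some l))), ← huw,
      Finset.mul_sum, Finset.mul_sum, ← Finset.sum_neg_distrib]
    exact Finset.sum_congr rfl fun a _ => by linear_combination -formalEval w (V a) * h_lin a
  have h_sq := (mul_eq_zero.1 h_sum).resolve_left ((map_ne_zero _).2 hl)
  exact Or.inr fun a => sq_eq_zero_iff.1
    ((Finset.sum_eq_zero_iff_of_nonneg fun a _ => sq_nonneg _).1 h_sq a (Finset.mem_univ a))

end NoRelation

theorem IsDegenerate.eq_zero_of_sum_algebraMap_mul_eq_zero {k K I J : Type*} [Field k] [Field K]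
    [LinearOrder K] [IsStrictOrderedRing K] [Algebra k K] [Fintype I] [Nontrivial I] [Fintype J]
    [DecidableEq J] {n : ℕ} {Y : I → Option J → ℤ} {o : I} {V : Fin n → Option J → K}
    {D : J → Fin n → Derivation k K K} (hn : 1 ≤ n) (hY : IsFormalConfig Y)
    (hV : IsDegenerate Y o V) (hD : IsDualFamily D V) {x : Option J → k}
    (hx : ∀ a, ∑ t, algebraMap k K (x t) * V a t = 0) : x = 0 := by
  by_contra hx_ne
  obtain ⟨y, hy⟩ := hD.exists_none_eq_sum hn hx_ne hx
  obtain ⟨u, w, ⟨a, ha⟩, ⟨b, hb⟩, i, l, ε, h_mul⟩ := exists_factorization_vertexForm hn hY hV hD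
  have huw : ∑ a, formalEval u (V a) * formalEval w (V a) = 0 := by
    rw [← mul_eq_zero_iff_left (two_ne_zero' K), Finset.mul_sum,
      Finset.sum_congr rfl fun a _ => h_mul (V a), Finset.sum_add_distrib, ← Finset.mul_sum,
      hV.quad, hV.quad, mul_zero, add_zero]
  rcases hD.eq_zero_or_of_sum_mul_eq_zero hy huw with h | h
  · exact ha (h a)
  · exact hb (h b)

theorem not_isDegenerate_of_algebraicIndependent {K I J : Type*} [Field K] [LinearOrder K]
    [IsStrictOrderedRing K] [Algebra ℝ K] [Fintype I] [Nontrivial I] [Fintype J] [DecidableEq J]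
    {n : ℕ} (hn : 1 ≤ n) (hcard : Fintype.card I ≤ n + 2) {Y : I → Option J → ℤ} {o : I}
    {V : Fin n → Option J → K} (hY : IsFormalConfig Y)
    (hV : AlgebraicIndependent ℝ fun q : J × Fin n => V q.2 (some q.1)) :
    ¬ IsDegenerate Y o V := fun h_deg => by
  choose D hD using fun (l : J) (b : Fin n) =>
    exists_derivation_of_algebraicIndependent hV fun q => if q.1 = l ∧ q.2 = b then 1 else 0
  have hD_dual : IsDualFamily D V := fun l b j a => hD l b (j, a)
  obtain ⟨c, hc, ho⟩ := h_deg.dep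
  obtain ⟨x, hx_ne, hx⟩ := exists_real_relation h_deg
    (finrank_range_lagrangian_le_one hn hcard hY h_deg hD_dual hc ho)
    (lagrangian_ne_zero hY h_deg hc ho)
  exact hx_ne (h_deg.eq_zero_of_sum_algebraMap_mul_eq_zero hn hY hD_dual hx)

section Limit

variable {α k K I ι J : Type*} [CommRing k] [CommRing K] [Fintype I] [Fintype ι]
  {n : ℕ} {l : Filter α} {π : (α → k) →+* K}

theorem formalEval_map_pi (π : (α → k) →+* K) (y : ι → ℤ) (u : α → ι → k) :
    formalEval y (fun t => π fun N => u N t) = π fun N => formalEval y (u N) := by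
  rw [formalEval_map π]
  congr 1
  ext N
  exact (formalEval_map (Pi.evalRingHom _ N) y fun t N => u N t).symm

theorem vertexForm_map_pi (π : (α → k) →+* K) (y : ι → ℤ) (u w : α → ι → k) :
    vertexForm y (fun t => π fun N => u N t) (fun t => π fun N => w N t) =
      π fun N => vertexForm y (u N) (w N) := by
  rw [vertexForm_map π]
  congr 1
  ext N
  exact (vertexForm_map (Pi.evalRingHom _ N) y (fun t N => u N t) fun t N => w N t).symm

theorem isFormalRelation_iff {Y : I → ι → ℤ} {V : Fin n → ι → K} {c : I → K} :
    IsFormalRelation Y V c ↔ ∑ i, c i = 0 ∧ ∀ a, ∑ i, c i * formalEval (Y i) (V a) = 0 :=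
  ⟨fun h => ⟨h.sum, h.sum_mul⟩, fun h => ⟨h.1, h.2⟩⟩

theorem isFormalRelation_map_pi (hπ : ∀ f, π f = 0 ↔ ∀ᶠ N in l, f N = 0) {Y : I → ι → ℤ}
    {V : α → Fin n → ι → k} {c : I → α → k} :
    IsFormalRelation Y (fun a t => π fun N => V N a t) (fun i => π (c i)) ↔
      ∀ᶠ N in l, IsFormalRelation Y (V N) (fun i => c i N) := by
  simp only [isFormalRelation_iff, formalEval_map_pi, ← map_mul, ← map_sum, hπ,
    Filter.eventually_and, Filter.eventually_all, Finset.sum_apply, Pi.mul_apply]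

theorem IsDegenerate.map_pi [Fintype J] [l.NeBot] (hsurj : Function.Surjective π)
    (hπ : ∀ f, π f = 0 ↔ ∀ᶠ N in l, f N = 0) {Y : I → Option J → ℤ} {o : I}
    {V : α → Fin n → Option J → k} (hV : ∀ N, IsDegenerate Y o (V N)) :
    IsDegenerate Y o fun a t => π fun N => V N a t where
  quad i := by
    simp only [vertexForm_map_pi, ← map_sum, hπ, Finset.sum_apply, (hV _).quad,
      Filter.eventually_true]
  not_special i j := by
    by_contra! h
    simp only [formalEval_map_pi, ← sub_eq_zero (b := π _), ← map_sub, hπ, Pi.sub_apply,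
      ← Filter.eventually_all, sub_eq_zero] at h
    obtain ⟨N, hN⟩ := h.exists
    obtain ⟨a, ha⟩ := (hV N).not_special i j
    exact ha (hN a)
  indep c hc ho := by
    obtain ⟨d, rfl⟩ : ∃ d : I → α → k, c = fun i => π (d i) :=
      ⟨fun i => (hsurj (c i)).choose, funext fun i => (hsurj (c i)).choose_spec.symm⟩
    ext i
    refine (hπ _).2 ?_
    filter_upwards [(isFormalRelation_map_pi hπ).1 hc, (hπ _).1 ho] with N hN hNo
    exact congrFun ((hV N).indep _ hN hNo) i
  dep := by
    choose c hc hco using fun N => (hV N).dep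
    exact ⟨fun i => π fun N => c N i,
      (isFormalRelation_map_pi hπ).2 (Filter.Eventually.of_forall hc),
      (congrArg π (funext hco)).trans (map_one π)⟩

end Limit

theorem exists_dual_ne_zero_forall_eq_intCast {E : Type*} [AddCommGroup E] [Module ℚ E]
    (s : Finset E) {x : E} (hx : x ≠ 0) :
    ∃ φ : Module.Dual ℚ E, φ x ≠ 0 ∧ ∀ y ∈ s, ∃ g : ℤ, φ y = g := by
  classical
  obtain ⟨φ, hφ⟩ : ∃ φ : Module.Dual ℚ E, φ x ≠ 0 := by
    by_contra! h
    exact hx ((Module.forall_dual_apply_eq_zero_iff ℚ _).1 h)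
  obtain ⟨b, hb⟩ :=
    IsLocalization.exist_integer_multiples_of_finset (nonZeroDivisors ℤ) (s.image φ)
  have hb_ne : (b : ℚ) ≠ 0 := by exact_mod_cast nonZeroDivisors.coe_ne_zero b
  refine ⟨(b : ℚ) • φ, mul_ne_zero hb_ne hφ, fun y hy => ?_⟩
  obtain ⟨g, hg⟩ := hb _ (Finset.mem_image_of_mem φ hy)
  exact ⟨g, by simpa using hg.symm⟩

-- Apply to the coefficients of `P` a `ℚ`-linear functional taking integral values on them.
theorem exists_int_mvPolynomial {σ k : Type*} [CommRing k] [Algebra ℚ k] {P : MvPolynomial σ k}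
    (hP : P ≠ 0) :
    ∃ Q : MvPolynomial σ ℤ, Q ≠ 0 ∧ ∀ v : σ → ℤ,
      MvPolynomial.eval (fun q => (v q : k)) P = 0 → MvPolynomial.eval v Q = 0 := by
  classical
  obtain ⟨s, hs⟩ := MvPolynomial.ne_zero_iff.1 hP
  obtain ⟨φ, hφ, hφ_int⟩ :=
    exists_dual_ne_zero_forall_eq_intCast (P.support.image P.coeff) hs
  choose! g hg using fun t (ht : t ∈ P.support) => hφ_int _ (Finset.mem_image_of_mem P.coeff ht)
  have h_supp : s ∈ P.support := MvPolynomial.mem_support_iff.2 hs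
  refine ⟨∑ t ∈ P.support, MvPolynomial.monomial t (g t), fun h => hφ ?_, fun v hv => ?_⟩
  · have h_coeff := congrArg (MvPolynomial.coeff s) h
    simp only [MvPolynomial.coeff_sum, MvPolynomial.coeff_monomial, Finset.sum_ite_eq', h_supp,
      if_true, MvPolynomial.coeff_zero] at h_coeff
    rw [hg s h_supp, h_coeff, Int.cast_zero]
  · have h_eval : φ (MvPolynomial.eval (fun q => (v q : k)) P) =
        (MvPolynomial.eval v (∑ t ∈ P.support, MvPolynomial.monomial t (g t)) : ℤ) := by
      rw [MvPolynomial.eval_eq, map_sum, map_sum, Int.cast_sum]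
      refine Finset.sum_congr rfl fun t ht => ?_
      have h_smul : P.coeff t * ∏ i ∈ t.support, (v i : k) ^ t i =
          (∏ i ∈ t.support, v i ^ t i) • P.coeff t := by
        rw [zsmul_eq_mul, mul_comm]
        push_cast
        rfl
      rw [h_smul, map_zsmul, hg t ht, MvPolynomial.eval_monomial, Finsupp.prod, zsmul_eq_mul,
        Int.cast_mul, mul_comm]
    rw [hv, map_zero] at h_eval
    exact_mod_cast h_eval.symm

theorem countable_mvPolynomial (σ R : Type*) [Countable σ] [CommSemiring R] [Countable R] :
    Countable (MvPolynomial σ R) := by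
  rw [← Cardinal.mk_le_aleph0_iff]
  exact MvPolynomial.cardinalMk_le_max_lift.trans
    (max_le (max_le (Cardinal.lift_le_aleph0.2 Cardinal.mk_le_aleph0)
      (Cardinal.lift_le_aleph0.2 Cardinal.mk_le_aleph0)) le_rfl)

theorem exists_seq_eventually_dvd (A : Type*) [CommMonoidWithZero A] [Nontrivial A]
    [NoZeroDivisors A] [Countable A] :
    ∃ R : ℕ → A, (∀ N, R N ≠ 0) ∧ ∀ Q ≠ 0, ∀ᶠ N in Filter.atTop, Q ∣ R N := by
  have : Nonempty {Q : A // Q ≠ 0} := ⟨⟨1, one_ne_zero⟩⟩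
  obtain ⟨e, he⟩ := exists_surjective_nat {Q : A // Q ≠ 0}
  refine ⟨fun N => ∏ i ∈ Finset.range N, (e i : A),
    fun N => Finset.prod_ne_zero_iff.2 fun i _ => (e i).2, fun Q hQ => ?_⟩
  obtain ⟨i, hi⟩ := he ⟨Q, hQ⟩
  filter_upwards [Filter.eventually_gt_atTop i] with N hN
  have h_dvd := Finset.dvd_prod_of_mem (fun i => (e i : A)) (Finset.mem_range.2 hN)
  rwa [hi] at h_dvd

section Limit

variable {α k K σ : Type*} [CommRing k] [CommRing K] {l : Filter α} {π : (α → k) →+* K}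

theorem eval₂_map_pi (π : (α → k) →+* K) (f : α → σ → k) (P : MvPolynomial σ k) :
    MvPolynomial.eval₂ (π.comp (Pi.constRingHom α k)) (fun q => π fun N => f N q) P =
      π fun N => MvPolynomial.eval (f N) P := by
  have h := MvPolynomial.eval₂_comp_left π (Pi.constRingHom α k) (fun q N => f N q) P
  refine h.symm.trans (congrArg π (funext fun N => ?_))
  exact MvPolynomial.eval₂_comp_left (Pi.evalRingHom _ N) (Pi.constRingHom α k) _ P

theorem algebraicIndependent_map_pi [Algebra k K]
    (hk : algebraMap k K = π.comp (Pi.constRingHom α k)) (hπ : ∀ f, π f = 0 ↔ ∀ᶠ N in l, f N = 0)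
    {f : α → σ → k} (hf : ∀ P ≠ 0, ∃ᶠ N in l, MvPolynomial.eval (f N) P ≠ 0) :
    AlgebraicIndependent k fun q => π fun N => f N q := by
  rw [algebraicIndependent_iff]
  intro P hP
  by_contra hP_ne
  rw [MvPolynomial.aeval_def, hk, eval₂_map_pi, hπ] at hP
  exact hf P hP_ne (by simpa using hP)

end Limit

-- If every resonance failed, an ultraproduct of counterexamples to more and more resonances would
-- have algebraically independent coordinates.
theorem exists_resonance {I J : Type*} [Fintype I] [Nontrivial I] [Fintype J] [DecidableEq J]
    {n : ℕ} (hn : 1 ≤ n) (hcard : Fintype.card I ≤ n + 2) {Y : I → Option J → ℤ} (o : I)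
    (hY : IsFormalConfig Y) :
    ∃ R : MvPolynomial (J × Fin n) ℤ, R ≠ 0 ∧ ∀ v : J → Fin n → ℤ,
      MvPolynomial.eval (fun q => v q.1 q.2) R ≠ 0 →
      ∀ V : Fin n → Option J → ℝ, (∀ j a, V a (some j) = v j a) → ¬ IsDegenerate Y o V := by
  by_contra! h
  have := countable_mvPolynomial (J × Fin n) ℤ
  obtain ⟨R, hR, hR_dvd⟩ := exists_seq_eventually_dvd (MvPolynomial (J × Fin n) ℤ)
  choose v hv V hV h_deg using fun N => h (R N) (hR N)
  let l : Filter ℕ := Filter.hyperfilter ℕ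
  let π : (ℕ → ℝ) →+* l.Germ ℝ := Filter.Germ.coeRingHom l
  have hπ (f : ℕ → ℝ) : π f = 0 ↔ ∀ᶠ N in l, f N = 0 := Filter.Germ.coe_eq
  let : Algebra ℝ (l.Germ ℝ) := (π.comp (Pi.constRingHom ℕ ℝ)).toAlgebra
  have h_lim : IsDegenerate Y o fun a t => π fun N => V N a t :=
    IsDegenerate.map_pi (l := l) (π := π) Quot.exists_rep hπ h_deg
  refine not_isDegenerate_of_algebraicIndependent hn hcard hY
    (V := fun a t => π fun N => V N a t) ?_ h_lim
  refine algebraicIndependent_map_pi rfl hπ fun P hP => Filter.Eventually.frequently ?_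
  obtain ⟨Q, hQ_ne, hQ⟩ := exists_int_mvPolynomial hP
  filter_upwards [Nat.hyperfilter_le_atTop (hR_dvd Q hQ_ne)] with N hN hP_eval
  simp only [hV] at hP_eval
  obtain ⟨T, hT⟩ := hN
  exact hv N (by rw [hT, map_mul, hQ (fun q => v N q.1 q.2) hP_eval, zero_mul])

section Comp

variable {R ι κ : Type*} [CommRing R] [Fintype ι] [Fintype κ] {e : ι → κ} {y : κ → ℤ}

theorem formalEval_comp (he : e.Injective) (hy : ∀ t ∉ Set.range e, y t = 0) (u : κ → R) :
    formalEval (y ∘ e) (u ∘ e) = formalEval y u :=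
  Fintype.sum_of_injective e he _ (fun t => (y t : R) * u t) (fun t ht => by simp [hy t ht])
    fun _ => rfl

theorem vertexForm_comp (he : e.Injective) (hy : ∀ t ∉ Set.range e, y t = 0) (u w : κ → R) :
    vertexForm (y ∘ e) (u ∘ e) (w ∘ e) = vertexForm y u w := by
  rw [vertexForm, vertexForm, formalEval_comp he hy, formalEval_comp he hy]
  exact congrArg _ (formalEval_comp he hy fun t => u t * w t)

end Comp

section Reindex

variable {J J' : Type*} [DecidableEq J] [DecidableEq J'] {s : J' → J}

omit [DecidableEq J'] in
theorem IsFormalEdge.mem_range {h k : J} {y y' : Option J → ℤ} (H : IsFormalEdge h k y y')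
    (hy : ∀ t ∉ Set.range (Option.map s), y t = 0)
    (hy' : ∀ t ∉ Set.range (Option.map s), y' t = 0) :
    h ∈ Set.range s ∧ k ∈ Set.range s := by
  have h_range {j : J} (hj : j ∉ Set.range s) : some j ∉ Set.range (Option.map s) := by
    rintro ⟨_ | i, hi⟩
    · exact absurd hi (by simp)
    · exact hj ⟨i, Option.some_injective _ hi⟩
  have h_ne {j : J} (hj : j = h ∨ j = k) (h0 : y (some j) = 0) (h0' : y' (some j) = 0) :
      False := by
    have h_hk := H.1
    rcases H.2 with H | H <;> have H := congrFun H (some j) <;> rcases hj with rfl | rfl <;>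
      simp [h0, h0', h_hk, h_hk.symm] at H
  exact ⟨by_contra fun hh => h_ne (.inl rfl) (hy _ (h_range hh)) (hy' _ (h_range hh)),
    by_contra fun hk => h_ne (.inr rfl) (hy _ (h_range hk)) (hy' _ (h_range hk))⟩

theorem IsFormalEdge.comp (hs : s.Injective) {h k : J'} {y y' : Option J → ℤ}
    (H : IsFormalEdge (s h) (s k) y y') :
    IsFormalEdge h k (y ∘ Option.map s) (y' ∘ Option.map s) := by
  have h_single (i : J') : (Pi.single (some (s i)) 1 : Option J → ℤ) ∘ Option.map s =
      Pi.single (some i) 1 := by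
    ext (_ | j)
    · simp
    · simp [Pi.single_apply, hs.eq_iff]
  refine ⟨fun hhk => H.1 (congrArg s hhk), ?_⟩
  rw [← h_single, ← h_single]
  exact H.2.imp (fun H => funext fun t => congrFun H (Option.map s t))
    fun H => funext fun t => congrFun H (Option.map s t)

variable [Fintype J] [Fintype J'] {I : Type*} {Y : I → Option J → ℤ}

theorem IsFormalConfig.comp (hs : s.Injective) (H : IsFormalConfig Y)
    (hY : ∀ i, ∀ t ∉ Set.range (Option.map s), Y i t = 0) :
    IsFormalConfig fun i => Y i ∘ Option.map s where
  sign := H.sign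
  mass i := (Fintype.sum_of_injective _ (Option.map_injective hs) _ _ (hY i) fun _ => rfl).trans
    (H.mass i)
  inj i l hil := H.inj <| funext fun t => by
    by_cases ht : t ∈ Set.range (Option.map s)
    · obtain ⟨t, rfl⟩ := ht
      exact congrFun hil t
    · rw [hY i t ht, hY l t ht]
  conn := by
    obtain ⟨G, hG, h_edge⟩ := H.conn
    refine ⟨G, hG, fun i l hil => ?_⟩
    obtain ⟨h, k, hhk⟩ := h_edge i l hil
    obtain ⟨⟨h, rfl⟩, ⟨k, rfl⟩⟩ := hhk.mem_range (hY i) (hY l)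
    exact ⟨h, k, hhk.comp hs⟩

omit [DecidableEq J] [DecidableEq J'] in
theorem IsDegenerate.comp [Fintype I] {K : Type*} [CommRing K] {n : ℕ} {o : I}
    {V : Fin n → Option J → K} (hs : s.Injective) (H : IsDegenerate Y o V)
    (hY : ∀ i, ∀ t ∉ Set.range (Option.map s), Y i t = 0) :
    IsDegenerate (fun i => Y i ∘ Option.map s) o fun a => V a ∘ Option.map s := by
  have h_eval (i : I) (a : Fin n) := formalEval_comp (Option.map_injective hs) (hY i) (V a)
  have h_rel (c : I → K) : IsFormalRelation (fun i => Y i ∘ Option.map s)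
      (fun a => V a ∘ Option.map s) c ↔ IsFormalRelation Y V c := by
    simp only [isFormalRelation_iff, h_eval]
  constructor
  · simpa only [vertexForm_comp (Option.map_injective hs) (hY _)] using H.quad
  · intro i j
    simpa only [h_eval] using! H.not_special i (s j)
  · simpa only [h_rel] using H.indep
  · simpa only [h_rel] using H.dep

end Reindex

theorem IsGeneric.mono {n m : ℕ} {res res' : Finset (Σ p : ℕ, MvPolynomial (Fin p × Fin n) ℤ)}
    {v : Fin m → Fin n → ℤ} (hv : IsGeneric res' v) (h : res ⊆ res') : IsGeneric res v :=
  fun P hP => hv P (h hP)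

theorem exists_embedding_range_eq {ι : Type*} (S : Finset ι) :
    ∃ s : Fin S.card ↪ ι, Set.range s = S := by
  refine ⟨S.equivFin.symm.toEmbedding.trans (Function.Embedding.subtype _), ?_⟩
  ext j
  exact ⟨fun ⟨i, hi⟩ => hi ▸ Subtype.coe_prop _, fun hj => ⟨S.equivFin ⟨j, hj⟩, by simp⟩⟩

theorem finite_setSigma {ι : Type*} {α : ι → Type*} {s : Set ι} {t : ∀ i, Set (α i)}
    (hs : s.Finite) (ht : ∀ i, (t i).Finite) : (s.sigma t).Finite :=
  (hs.biUnion fun i _ => (ht i).image (Sigma.mk i)).subset fun _ ha =>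
    Set.mem_biUnion ha.1 (Set.mem_image_of_mem _ ha.2)

/-- The list `v` satisfies none of the algebraic relations that would allow a degenerate
configuration supported on at most `2 (n + 1)` of its vectors. -/
def IsConfigGeneric {n m : ℕ} (v : Fin m → Fin n → ℤ) : Prop :=
  ∀ (p k : ℕ) (s : Fin p ↪ Fin m), p ≤ 2 * (n + 1) → k ≤ n →
    ∀ Y : Fin (k + 2) → Option (Fin p) → ℤ, IsFormalConfig Y → (∀ i t, |Y i t| ≤ n + 2) →
      ∀ V : Fin n → Option (Fin p) → ℝ, (∀ j a, V a (some j) = v (s j) a) →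
        ¬ IsDegenerate Y (Fin.last _) V

/-- The list `v` avoids all resonances: it admits no degenerate configuration, no right angle, and
no two equal differences. -/
structure IsNonresonant {n m : ℕ} (v : Fin m → Fin n → ℤ) : Prop where
  isConfig : IsConfigGeneric v
  angle : ∀ i j k, i ≠ j → i ≠ k → j ≠ k → dotProduct (v i - v j) (v i - v k) ≠ 0
  diff : ∀ h k h' k', h ≠ k → v k - v h = v k' - v h' → h = h' ∧ k = k'

section Resonances

variable {n : ℕ}

theorem exists_config_resonances (hn : 1 ≤ n) :
    ∃ res : Finset (Σ p : ℕ, MvPolynomial (Fin p × Fin n) ℤ),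
      (∀ P ∈ res, P.1 ≤ 2 * (n + 1) ∧ P.2 ≠ 0) ∧
      ∀ (m : ℕ) (v : Fin m → Fin n → ℤ), IsGeneric res v → IsConfigGeneric v := by
  choose! R hR_ne hR using
    fun (p k : ℕ) (Y : Fin (k + 2) → Option (Fin p) → ℤ) (hk : k ≤ n) (hY : IsFormalConfig Y) =>
      exists_resonance hn (by simpa using hk) (Fin.last _) hY
  let B (p k : ℕ) : Set (Fin (k + 2) → Option (Fin p) → ℤ) :=
    {Y | IsFormalConfig Y ∧ ∀ i t, |Y i t| ≤ n + 2}
  have hB (p k : ℕ) : (B p k).Finite :=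
    (Set.finite_Icc (fun _ _ => -(n + 2 : ℤ)) fun _ _ => (n + 2 : ℤ)).subset fun Y hY =>
      ⟨fun i t => (abs_le.1 (hY.2 i t)).1, fun i t => (abs_le.1 (hY.2 i t)).2⟩
  have h_fin : ((Set.Iic (2 * (n + 1))).sigma fun p => ⋃ k ∈ Set.Iic n, R p k '' B p k).Finite :=
    finite_setSigma (Set.finite_Iic _) fun p =>
      (Set.finite_Iic n).biUnion fun k _ => (hB p k).image _
  refine ⟨h_fin.toFinset, fun P hP => ?_, fun m v hv p k s hp hk Y hY h_le => ?_⟩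
  · obtain ⟨hp, hP⟩ := h_fin.mem_toFinset.1 hP
    simp only [Set.mem_iUnion] at hP
    obtain ⟨k, hk, Y, hY, hYP⟩ := hP
    exact ⟨hp, hYP ▸ hR_ne _ k Y hk hY.1⟩
  · refine hR p k Y hk hY (fun j => v (s j)) (hv ⟨p, R p k Y⟩ (h_fin.mem_toFinset.2 ⟨hp, ?_⟩) s)
    exact Set.mem_biUnion (Set.mem_Iic.2 hk) ⟨Y, ⟨hY, h_le⟩, rfl⟩

theorem exists_linear_resonances (N : ℕ) (M : ℤ) (a : Fin n) :
    ∃ res : Finset (Σ p : ℕ, MvPolynomial (Fin p × Fin n) ℤ),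
      (∀ P ∈ res, P.1 ≤ N ∧ P.2 ≠ 0) ∧
      ∀ (m : ℕ) (v : Fin m → Fin n → ℤ), IsGeneric res v → ∀ c : Fin m → ℤ, c ≠ 0 →
        ∀ S : Finset (Fin m), S.card ≤ N → (∀ j ∉ S, c j = 0) → (∀ j, |c j| ≤ M) →
          ∑ j, c j * v j a ≠ 0 := by
  let R (p : ℕ) (c : Fin p → ℤ) : MvPolynomial (Fin p × Fin n) ℤ :=
    ∑ i, MvPolynomial.C (c i) * MvPolynomial.X (i, a)
  have hR (p : ℕ) (c : Fin p → ℤ) (v : Fin p × Fin n → ℤ) :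
      MvPolynomial.eval v (R p c) = ∑ i, c i * v (i, a) := by simp [R]
  let B (p : ℕ) : Set (Fin p → ℤ) := {c | c ≠ 0 ∧ ∀ i, |c i| ≤ M}
  have hB (p : ℕ) : (B p).Finite :=
    (Set.finite_Icc (fun _ => -M) fun _ => M).subset fun c hc =>
      ⟨fun i => (abs_le.1 (hc.2 i)).1, fun i => (abs_le.1 (hc.2 i)).2⟩
  have h_fin : ((Set.Iic N).sigma fun p => R p '' B p).Finite :=
    finite_setSigma (Set.finite_Iic N) fun p => (hB p).image _
  refine ⟨h_fin.toFinset, fun P hP => ?_, fun m v hv c hc S hS hcS h_le => ?_⟩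
  · obtain ⟨hp, c, ⟨hc, -⟩, hcP⟩ := h_fin.mem_toFinset.1 hP
    refine ⟨hp, fun hP_zero => hc (funext fun i => ?_)⟩
    have h_eval := hR _ c fun q => if q.1 = i then 1 else 0
    rw [hcP, hP_zero] at h_eval
    simpa using h_eval.symm
  · obtain ⟨s, hs⟩ := exists_embedding_range_eq S
    have h_supp (j : Fin m) (hj : j ∉ Set.range s) : c j = 0 := hcS j (by simpa [hs] using hj)
    have hcs : c ∘ s ≠ 0 := fun h0 => hc <| funext fun j => by
      by_cases hj : j ∈ Set.range s
      · obtain ⟨i, rfl⟩ := hj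
        exact congrFun h0 i
      · exact h_supp j hj
    have h_eval := hv ⟨S.card, R _ (c ∘ s)⟩
      (h_fin.mem_toFinset.2 ⟨hS, c ∘ s, ⟨hcs, fun i => h_le (s i)⟩, rfl⟩) s
    rw [hR] at h_eval
    rwa [← Fintype.sum_of_injective s s.injective _ _
      (fun j hj => by rw [h_supp j hj, zero_mul]) fun _ => rfl]

theorem exists_angle_resonance (hn : 1 ≤ n) :
    ∃ R : MvPolynomial (Fin 3 × Fin n) ℤ, R ≠ 0 ∧
      ∀ (m : ℕ) (v : Fin m → Fin n → ℤ), IsGeneric {⟨3, R⟩} v →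
        ∀ i j k, i ≠ j → i ≠ k → j ≠ k → dotProduct (v i - v j) (v i - v k) ≠ 0 := by
  let R : MvPolynomial (Fin 3 × Fin n) ℤ := ∑ a,
    (MvPolynomial.X (0, a) - MvPolynomial.X (1, a)) *
      (MvPolynomial.X (0, a) - MvPolynomial.X (2, a))
  have hR (v : Fin 3 → Fin n → ℤ) : MvPolynomial.eval (fun q => v q.1 q.2) R =
      dotProduct (v 0 - v 1) (v 0 - v 2) := by simp [R, dotProduct]
  refine ⟨R, fun h => ?_, fun m v hv i j k hij hik hjk => ?_⟩
  · have h_eval := hR fun i _ => if i = 0 then 1 else 0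
    simp only [h, map_zero, dotProduct] at h_eval
    simp at h_eval
    omega
  · have h_inj : Function.Injective ![i, j, k] := by
      intro a b
      fin_cases a <;> fin_cases b <;> simp [hij, hik, hjk, hij.symm, hik.symm, hjk.symm]
    have h_eval := hv ⟨3, R⟩ (Finset.mem_singleton_self _) ⟨![i, j, k], h_inj⟩
    exact (hR fun a => v (![i, j, k] a)) ▸ h_eval

theorem eq_of_single_sub_eq_single_sub {ι : Type*} [DecidableEq ι] {h k h' k' : ι} (hhk : h ≠ k)
    (H : (Pi.single k 1 - Pi.single h 1 : ι → ℤ) = Pi.single k' 1 - Pi.single h' 1) :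
    h = h' ∧ k = k' := by
  have H_h := congrFun H h
  have H_k := congrFun H k
  simp only [Pi.sub_apply, Pi.single_apply, if_true, hhk, hhk.symm, if_false] at H_h H_k
  constructor <;> by_contra h_ne <;> simp only [h_ne, if_false] at H_h H_k <;>
    split_ifs at H_h H_k <;> omega

theorem exists_resonances (hn : 1 ≤ n) :
    ∃ res : Finset (Σ p : ℕ, MvPolynomial (Fin p × Fin n) ℤ),
      (∀ P ∈ res, P.1 ≤ 2 * (n + 1) ∧ P.2 ≠ 0) ∧
      ∀ (m : ℕ) (v : Fin m → Fin n → ℤ), IsGeneric res v → IsNonresonant v := by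
  classical
  obtain ⟨res₁, h₁, h₁'⟩ := exists_config_resonances hn
  obtain ⟨res₂, h₂, h₂'⟩ := exists_linear_resonances 4 2 (⟨0, hn⟩ : Fin n)
  obtain ⟨R, hR, hR'⟩ := exists_angle_resonance hn
  refine ⟨res₁ ∪ res₂ ∪ {⟨3, R⟩}, fun P hP => ?_, fun m v hv => ⟨h₁' m v (hv.mono ?_),
    hR' m v (hv.mono Finset.subset_union_right), fun h k h' k' hhk heq => ?_⟩⟩
  · simp only [Finset.mem_union, Finset.mem_singleton] at hP
    rcases hP with (hP | hP) | rfl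
    · exact h₁ P hP
    · exact ⟨(h₂ P hP).1.trans (by omega), (h₂ P hP).2⟩
    · exact ⟨by dsimp only; omega, hR⟩
  · exact Finset.subset_union_left.trans Finset.subset_union_left
  · refine eq_of_single_sub_eq_single_sub hhk (sub_eq_zero.1 (by_contra fun hc => ?_))
    refine h₂' m v (hv.mono (Finset.subset_union_right.trans Finset.subset_union_left)) _ hc
      {k, h, k', h'} Finset.card_le_four (fun j hj => ?_) (fun j => ?_) ?_
    · simp only [Finset.mem_insert, Finset.mem_singleton, not_or] at hj
      simp [hj]
    · simp only [Pi.sub_apply, Pi.single_apply, abs_le]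
      constructor <;> split_ifs <;> omega
    · have h_zero := congrFun (sub_eq_zero.2 heq) ⟨0, hn⟩
      simpa [sub_mul, Finset.sum_sub_distrib, Pi.single_apply] using h_zero

end Resonances

/-- The point with formal expression `y` when `V a t` is the `a`-th coordinate of the value of the
symbol `t`. -/
def formalPoint {R ι : Type*} [CommRing R] [Fintype ι] {n : ℕ} (y : ι → ℤ) (V : Fin n → ι → R) :
    Fin n → R :=
  fun a => formalEval y (V a)

/-- The linear extension to formal points of the squared norm of the values of the symbols. On the
points of a component of `Γ_S` it agrees with the squared norm. -/
def formalNormSq {R ι : Type*} [CommRing R] [Fintype ι] {n : ℕ} (y : ι → ℤ) (V : Fin n → ι → R) :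
    R :=
  formalEval y fun t => ∑ a, V a t * V a t

/-- The values of the symbols `none` and `some j` when they stand for the point `x` and the vectors
`v j`, with the coordinate as first argument. -/
def symbolValue {R : Type*} {n m : ℕ} (x : Fin n → R) (v : Fin m → Fin n → R) (a : Fin n)
    (t : Option (Fin m)) : R :=
  t.elim (x a) fun j => v j a

section FormalPoint

variable {R ι : Type*} [CommRing R] [Fintype ι] {n m : ℕ} {x : Fin n → R} {v : Fin m → Fin n → R}

theorem formalPoint_add (y y' : ι → ℤ) (V : Fin n → ι → R) :
    formalPoint (y + y') V = formalPoint y V + formalPoint y' V :=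
  funext fun _ => formalEval_add_left _ _ _

theorem formalPoint_sub (y y' : ι → ℤ) (V : Fin n → ι → R) :
    formalPoint (y - y') V = formalPoint y V - formalPoint y' V :=
  funext fun _ => formalEval_sub_left _ _ _

theorem formalNormSq_add (y y' : ι → ℤ) (V : Fin n → ι → R) :
    formalNormSq (y + y') V = formalNormSq y V + formalNormSq y' V :=
  formalEval_add_left _ _ _

theorem formalNormSq_sub (y y' : ι → ℤ) (V : Fin n → ι → R) :
    formalNormSq (y - y') V = formalNormSq y V - formalNormSq y' V :=
  formalEval_sub_left _ _ _

theorem formalPoint_single (t : Option (Fin m)) :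
    formalPoint (Pi.single t 1) (symbolValue x v) = t.elim x v := by
  ext a
  rw [formalPoint, formalEval_single, Int.cast_one, one_mul]
  cases t <;> rfl

theorem formalNormSq_single (t : Option (Fin m)) : formalNormSq (Pi.single t 1) (symbolValue x v) =
    dotProduct (t.elim x v) (t.elim x v) := by
  rw [formalNormSq, formalEval_single, Int.cast_one, one_mul]
  cases t <;> rfl

theorem sum_vertexForm_eq_zero_iff {y : ι → ℤ} {V : Fin n → ι → R} :
    ∑ a, vertexForm y (V a) (V a) = 0 ↔
      dotProduct (formalPoint y V) (formalPoint y V) = formalNormSq y V := by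
  simp only [vertexForm, Finset.sum_sub_distrib, sub_eq_zero, dotProduct, formalPoint,
    formalNormSq, formalEval, Finset.mul_sum]
  rw [Finset.sum_comm (f := fun a t => (y t : R) * (V a t * V a t))]

theorem affineIndependent_formalPoint_iff {I : Type*} [Fintype I] {Y : I → ι → ℤ}
    {V : Fin n → ι → R} : AffineIndependent R (fun i => formalPoint (Y i) V) ↔
      ∀ c, IsFormalRelation Y V c → c = 0 := by
  rw [affineIndependent_iff_of_fintype]
  refine forall_congr' fun c => ?_
  rw [isFormalRelation_iff, and_imp]
  refine forall_congr' fun hc => imp_congr ?_ funext_iff.symm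
  rw [Finset.weightedVSub_eq_linear_combination _ hc, funext_iff]
  simp [Finset.sum_apply, formalPoint]

end FormalPoint

section FormalEdge

variable {J : Type*} [DecidableEq J] {h k j : J} {y y' : Option J → ℤ} {t : Option J}

theorem IsFormalEdge.symm (H : IsFormalEdge h k y y') : IsFormalEdge k h y' y := by
  refine ⟨H.1.symm, H.2.imp (fun H => ?_) fun H => ?_⟩
  · rw [← neg_sub, H, neg_sub]
  · rw [add_comm, H, add_comm]

theorem IsFormalEdge.apply_none (H : IsFormalEdge h k y y') :
    y' none = y none ∨ y' none = -y none := by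
  refine H.2.imp (fun H => ?_) fun H => ?_ <;> have H := congrFun H none <;> simp at H <;> omega

theorem IsFormalEdge.apply_some_eq_zero (H : IsFormalEdge h k y y') (hjh : j ≠ h) (hjk : j ≠ k)
    (hy : y (some j) = 0) : y' (some j) = 0 := by
  rcases H.2 with H | H <;> simpa [hjh, hjk, hy] using congrFun H (some j)

theorem IsFormalEdge.abs_apply_le (H : IsFormalEdge h k y y') : |y' t| ≤ |y t| + 1 := by
  have hhk : some h ≠ some k := fun hhk => H.1 (Option.some_injective _ hhk)
  rcases H.2 with H | H <;> have H := congrFun H t <;>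
    simp only [Pi.sub_apply, Pi.add_apply, Pi.single_apply] at H <;> grind

theorem IsFormalEdge.sum_eq_one [Fintype J] (H : IsFormalEdge h k y y') (hy : ∑ t, y t = 1) :
    ∑ t, y' t = 1 := by
  rcases H.2 with H | H <;> have H := congrArg (fun f => ∑ t, f t) H <;>
    simp only [Pi.sub_apply, Pi.add_apply, Finset.sum_sub_distrib, Finset.sum_add_distrib,
      Finset.sum_pi_single', Finset.mem_univ, if_true] at H <;> omega

end FormalEdge

section EdgeLift

variable {R : Type*} [CommRing R] {n m : ℕ} {v : Fin m → Fin n → R} {x b : Fin n → R}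
  {h k : Fin m} {y : Option (Fin m) → ℤ}

theorem IsBlackEdge.exists_isFormalEdge (hhk : h ≠ k)
    (H : IsBlackEdge v h k (formalPoint y (symbolValue x v)) b)
    (hy : dotProduct (formalPoint y (symbolValue x v)) (formalPoint y (symbolValue x v)) =
      formalNormSq y (symbolValue x v)) :
    ∃ y', formalPoint y' (symbolValue x v) = b ∧ IsFormalEdge h k y y' ∧
      dotProduct b b = formalNormSq y' (symbolValue x v) := by
  refine ⟨y + (Pi.single (some k) 1 - Pi.single (some h) 1), ?_, ⟨hhk, .inl (by simp)⟩, ?_⟩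
  · rw [formalPoint_add, formalPoint_sub, formalPoint_single, formalPoint_single]
    exact add_eq_of_eq_sub' H.1.symm
  · rw [formalNormSq_add, formalNormSq_sub, formalNormSq_single, formalNormSq_single, ← hy]
    exact eq_add_of_sub_eq' H.2

theorem IsRedEdge.exists_isFormalEdge (hhk : h ≠ k)
    (H : IsRedEdge v h k (formalPoint y (symbolValue x v)) b)
    (hy : dotProduct (formalPoint y (symbolValue x v)) (formalPoint y (symbolValue x v)) =
      formalNormSq y (symbolValue x v)) :
    ∃ y', formalPoint y' (symbolValue x v) = b ∧ IsFormalEdge h k y y' ∧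
      dotProduct b b = formalNormSq y' (symbolValue x v) := by
  refine ⟨Pi.single (some h) 1 + Pi.single (some k) 1 - y, ?_, ⟨hhk, .inr (by simp)⟩, ?_⟩
  · rw [formalPoint_sub, formalPoint_add, formalPoint_single, formalPoint_single]
    exact sub_eq_of_eq_add' H.1.symm
  · rw [formalNormSq_sub, formalNormSq_add, formalNormSq_single, formalNormSq_single, ← hy]
    exact eq_sub_of_add_eq' H.2

theorem exists_isFormalEdge_of_adj
    (H : (geomGraph v).Adj (formalPoint y (symbolValue x v)) b)
    (hy : ∑ a, vertexForm y (symbolValue x v a) (symbolValue x v a) = 0) :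
    ∃ y' h k, formalPoint y' (symbolValue x v) = b ∧ IsFormalEdge h k y y' ∧
      ∑ a, vertexForm y' (symbolValue x v a) (symbolValue x v a) = 0 := by
  simp only [sum_vertexForm_eq_zero_iff] at hy ⊢
  obtain ⟨-, h, k, hhk, H | H⟩ := H
  · obtain ⟨y', rfl, hy'⟩ := H.exists_isFormalEdge hhk hy
    exact ⟨y', h, k, rfl, hy'⟩
  · obtain ⟨y', rfl, hy'⟩ := H.exists_isFormalEdge hhk hy
    exact ⟨y', h, k, rfl, hy'⟩

end EdgeLift

section Snoc

theorem exists_connected_snoc {α : Type*} {k : ℕ} {f : Fin k → α} {a : α} {r : α → α → Prop}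
    (hf : ∃ G : SimpleGraph (Fin k), G.Connected ∧ ∀ i l, G.Adj i l → r (f i) (f l))
    (hr : ∀ a b, r a b → r b a) {i : Fin k} (hi : r (f i) a) :
    ∃ G : SimpleGraph (Fin (k + 1)), G.Connected ∧ ∀ i l, G.Adj i l →
      r (Fin.snoc (α := fun _ => α) f a i) (Fin.snoc (α := fun _ => α) f a l) := by
  obtain ⟨G, hG, hGr⟩ := hf
  let G' := SimpleGraph.fromRel fun i l =>
    r (Fin.snoc (α := fun _ => α) f a i) (Fin.snoc (α := fun _ => α) f a l)
  let castSuccHom : G →g G' :=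
    ⟨Fin.castSucc, fun {b c} hbc => by simpa [G', hbc.ne] using Or.inl (hGr b c hbc)⟩
  have h_last : G'.Reachable i.castSucc (Fin.last k) :=
    SimpleGraph.Adj.reachable (by simpa [G', (Fin.castSucc_lt_last i).ne] using Or.inl hi)
  exact ⟨G', SimpleGraph.connected_iff_exists_forall_reachable _ |>.2 ⟨i.castSucc,
    Fin.lastCases h_last fun l => (hG.preconnected i l).map castSuccHom⟩,
    fun b c hbc => hbc.2.elim id (hr _ _)⟩

theorem IsFormalConfig.snoc {J : Type*} [Fintype J] [DecidableEq J] {k : ℕ}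
    {Y : Fin k → Option J → ℤ} (H : IsFormalConfig Y) {y : Option J → ℤ}
    (hy : ∀ i, Y i ≠ y) {i : Fin k} {h l : J} (hi : IsFormalEdge h l (Y i) y) :
    IsFormalConfig (Fin.snoc (α := fun _ => Option J → ℤ) Y y) where
  sign := by
    simp only [Fin.forall_fin_succ', Fin.snoc_castSucc, Fin.snoc_last]
    have h_sign := H.sign i
    have h_none := hi.apply_none
    exact ⟨H.sign, by omega⟩
  mass := by
    simp only [Fin.forall_fin_succ', Fin.snoc_castSucc, Fin.snoc_last]
    exact ⟨H.mass, hi.sum_eq_one (H.mass i)⟩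
  inj := Fin.snoc_injective_iff.2 ⟨H.inj, fun ⟨a, ha⟩ => hy a ha⟩
  conn := exists_connected_snoc (r := fun y y' => ∃ h k, IsFormalEdge h k y y') H.conn
    (fun _ _ ⟨h, k, H⟩ => ⟨k, h, H.symm⟩) ⟨h, l, hi⟩

theorem isDegenerate_snoc {K J : Type*} [Field K] [Fintype J] {n k : ℕ}
    {Y : Fin k → Option J → ℤ} {y : Option J → ℤ} {V : Fin n → Option J → K}
    (hY : AffineIndependent K fun i => formalPoint (Y i) V)
    (hdep : ¬ AffineIndependent K fun i =>
      formalPoint (Fin.snoc (α := fun _ => Option J → ℤ) Y y i) V)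
    (hquad : ∀ i, ∑ a, vertexForm (Fin.snoc (α := fun _ => Option J → ℤ) Y y i) (V a) (V a) = 0)
    (hspecial : ∀ i j, ∃ a,
      formalEval (Fin.snoc (α := fun _ => Option J → ℤ) Y y i) (V a) ≠ V a (some j)) :
    IsDegenerate (Fin.snoc (α := fun _ => Option J → ℤ) Y y) (Fin.last k) V := by
  rw [affineIndependent_formalPoint_iff] at hY hdep
  have h_indep (c : Fin (k + 1) → K)
      (hc : IsFormalRelation (Fin.snoc (α := fun _ => Option J → ℤ) Y y) V c)
      (h_last : c (Fin.last k) = 0) : c = 0 := by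
    have h_init := hY (fun i => c i.castSucc)
      ⟨by simpa [Fin.sum_univ_castSucc, h_last] using hc.sum,
        fun a => by simpa [Fin.sum_univ_castSucc, h_last] using hc.sum_mul a⟩
    exact funext (Fin.lastCases h_last (congrFun h_init))
  refine ⟨hquad, hspecial, h_indep, ?_⟩
  push Not at hdep
  obtain ⟨c, hc, hc_ne⟩ := hdep
  have h_last : c (Fin.last k) ≠ 0 := fun h => hc_ne (h_indep c hc h)
  refine ⟨fun i => (c (Fin.last k))⁻¹ * c i, ⟨?_, fun a => ?_⟩, inv_mul_cancel₀ h_last⟩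
  · rw [← Finset.mul_sum, hc.sum, mul_zero]
  · simp only [mul_assoc, ← Finset.mul_sum, hc.sum_mul, mul_zero]

end Snoc

/-- The formal points `Y i` describe a connected set of `k + 1` points of the component `C`, reached
from its point `x` with the help of at most `2 k` of the vectors `v j`. -/
structure IsGrowth {R : Type*} [CommRing R] {n m : ℕ} (v : Fin m → Fin n → R)
    (C : (geomGraph v).ConnectedComponent) (x : Fin n → R) {k : ℕ}
    (Y : Fin (k + 1) → Option (Fin m) → ℤ) : Prop where
  isConfig : IsFormalConfig Y
  bound : ∀ i t, |Y i t| ≤ k + 1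
  supp : ∃ S : Finset (Fin m), S.card ≤ 2 * k ∧ ∀ i, ∀ j ∉ S, Y i (some j) = 0
  quad : ∀ i, ∑ a, vertexForm (Y i) (symbolValue x v a) (symbolValue x v a) = 0
  mem : ∀ i, formalPoint (Y i) (symbolValue x v) ∈ C.supp

section Growth

variable {R : Type*} [CommRing R] {n m k : ℕ} {v : Fin m → Fin n → R}
  {C : (geomGraph v).ConnectedComponent} {x : Fin n → R} {Y : Fin (k + 1) → Option (Fin m) → ℤ}

theorem isGrowth_single (hx : x ∈ C.supp) :
    IsGrowth (k := 0) v C x fun _ : Fin 1 => Pi.single none 1 where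
  isConfig :=
    { sign := fun _ => .inl (by simp)
      mass := fun _ => by simp
      inj := Function.injective_of_subsingleton (α := Fin 1) _
      conn := ⟨⊤, SimpleGraph.connected_top,
        fun _ _ h => absurd (Fin.subsingleton_one.elim _ _) h.ne⟩ }
  bound _ t := by
    rw [Pi.single_apply]
    split_ifs <;> simp
  supp := ⟨∅, by simp, fun _ j _ => by simp⟩
  quad _ := by rw [sum_vertexForm_eq_zero_iff, formalPoint_single, formalNormSq_single]
  mem _ := by rwa [formalPoint_single]

theorem IsGrowth.snoc (H : IsGrowth v C x Y) {i : Fin (k + 1)} {b : Fin n → R}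
    (hadj : (geomGraph v).Adj (formalPoint (Y i) (symbolValue x v)) b)
    (hb : ∀ i, formalPoint (Y i) (symbolValue x v) ≠ b) :
    ∃ y : Option (Fin m) → ℤ, IsGrowth v C x (k := k + 1) (Fin.snoc (α := fun _ => _) Y y) := by
  obtain ⟨y, h, l, rfl, hy, hy_quad⟩ := exists_isFormalEdge_of_adj hadj (H.quad i)
  obtain ⟨S, hS, hSY⟩ := H.supp
  refine ⟨y, H.isConfig.snoc (fun i hi => hb i (hi ▸ rfl)) hy, ?_,
    ⟨insert h (insert l S), ?_, ?_⟩, ?_, ?_⟩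
  · rw [Fin.forall_fin_succ']
    simp only [Fin.snoc_castSucc, Fin.snoc_last]
    push_cast
    exact ⟨fun i t => (H.bound i t).trans (by simp),
      fun t => hy.abs_apply_le.trans (add_le_add_left (H.bound i t) 1)⟩
  · have h_insert := Finset.card_insert_le h (insert l S)
    have h_insert' := Finset.card_insert_le l S
    omega
  · rw [Fin.forall_fin_succ']
    simp only [Fin.snoc_castSucc, Fin.snoc_last, Finset.mem_insert, not_or]
    exact ⟨fun i j hj => hSY i j hj.2.2,
      fun j hj => hy.apply_some_eq_zero hj.1 hj.2.1 (hSY i j hj.2.2)⟩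
  · rw [Fin.forall_fin_succ']
    simp only [Fin.snoc_castSucc, Fin.snoc_last]
    exact ⟨H.quad, hy_quad⟩
  · rw [Fin.forall_fin_succ']
    simp only [Fin.snoc_castSucc, Fin.snoc_last]
    exact ⟨H.mem, C.mem_supp_of_adj_mem_supp (H.mem i) hadj⟩

end Growth

theorem card_le_of_affineIndependent {K ι : Type*} [DivisionRing K] {n : ℕ} {p : ι → Fin n → K}
    (hp : AffineIndependent K p) : ENat.card ι ≤ n + 1 := by
  have := finite_of_fin_dim_affineIndependent K hp
  have := Fintype.ofFinite ι
  rw [ENat.card_eq_coe_fintype_card]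
  have h_card := hp.card_le_finrank_succ.trans (Nat.succ_le_succ (Submodule.finrank_le _))
  rw [Module.finrank_fin_fun] at h_card
  exact_mod_cast h_card

theorem exists_adj_of_subset_supp {V : Type*} {G : SimpleGraph V} {C : G.ConnectedComponent}
    {S : Set V} (hS : S ⊆ C.supp) (hne : S.Nonempty) (h : S ≠ C.supp) :
    ∃ a ∈ S, ∃ b ∉ S, G.Adj a b := by
  obtain ⟨y, hyC, hyS⟩ := Set.exists_of_ssubset (hS.ssubset_of_ne h)
  obtain ⟨x, hx⟩ := hne
  obtain ⟨a, ha, b, hb, hab⟩ := exists_adj_mem_notMem C.connected_toSimpleGraph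
    (S := {z : C.supp | z.1 ∈ S}) (x := ⟨x, hS hx⟩) (y := ⟨y, hyC⟩) hx hyS
  exact ⟨a, ha, b, hb, hab⟩

section AffineIndependent

variable {n m : ℕ} {v : Fin m → Fin n → ℤ}
  {C : (geomGraph fun i a => (v i a : ℝ)).ConnectedComponent}

theorem IsConfigGeneric.affineIndependent_snoc (hv : IsConfigGeneric v)
    (hC : ∀ j, (fun a => (v j a : ℝ)) ∉ C.supp) {k : ℕ} (hk : k ≤ n) {x : Fin n → ℝ}
    {Y : Fin (k + 1) → Option (Fin m) → ℤ} {y : Option (Fin m) → ℤ}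
    (hY : AffineIndependent ℝ fun i => formalPoint (Y i) (symbolValue x fun i a => (v i a : ℝ)))
    (H : IsGrowth (fun i a => (v i a : ℝ)) C x (k := k + 1) (Fin.snoc (α := fun _ => _) Y y)) :
    AffineIndependent ℝ fun i => formalPoint
      (Fin.snoc (α := fun _ => Option (Fin m) → ℤ) Y y i)
      (symbolValue x fun i a => (v i a : ℝ)) := by
  by_contra hdep
  have hdeg := isDegenerate_snoc hY hdep H.quad fun i j =>
    Function.ne_iff.1 fun h => hC j (Eq.subst h (H.mem i))
  obtain ⟨S, hS, hSY⟩ := H.supp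
  obtain ⟨s, hs⟩ := exists_embedding_range_eq S
  have h_supp : ∀ i, ∀ t ∉ Set.range (Option.map s),
      Fin.snoc (α := fun _ => Option (Fin m) → ℤ) Y y i t = 0 := by
    rintro i (_ | j) ht
    · exact absurd ⟨none, rfl⟩ ht
    · refine hSY i j fun hj => ht ?_
      obtain ⟨l, rfl⟩ := hs.ge hj
      exact ⟨some l, rfl⟩
  refine hv S.card k s (by omega) hk _ (H.isConfig.comp s.injective h_supp)
    (fun i t => (H.bound i _).trans ?_) _ (fun j a => rfl) (hdeg.comp s.injective h_supp)
  push_cast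
  omega

theorem IsConfigGeneric.exists_growth_range_eq_supp (hv : IsConfigGeneric v)
    (hC : ∀ j, (fun a => (v j a : ℝ)) ∉ C.supp) {x : Fin n → ℝ} (hx : x ∈ C.supp) :
    ∃ (k : ℕ) (Y : Fin (k + 1) → Option (Fin m) → ℤ),
      (AffineIndependent ℝ fun i =>
        formalPoint (Y i) (symbolValue x fun i a => (v i a : ℝ))) ∧
      Set.range (fun i => formalPoint (Y i) (symbolValue x fun i a => (v i a : ℝ))) = C.supp := by
  by_contra! h_ne
  have h_grow (k : ℕ) : ∃ Y : Fin (k + 1) → Option (Fin m) → ℤ,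
      IsGrowth (fun i a => (v i a : ℝ)) C x Y ∧
      AffineIndependent ℝ fun i => formalPoint (Y i) (symbolValue x fun i a => (v i a : ℝ)) := by
    induction k with
    | zero =>
      have : Subsingleton (Fin (0 + 1)) := Fin.subsingleton_one
      exact ⟨_, isGrowth_single hx, affineIndependent_of_subsingleton ℝ _⟩
    | succ k ih =>
      obtain ⟨Y, hY, h_indep⟩ := ih
      have hk := card_le_of_affineIndependent h_indep
      rw [ENat.card_eq_coe_fintype_card, Fintype.card_fin] at hk
      obtain ⟨_, ⟨i, rfl⟩, b, hb, hab⟩ := exists_adj_of_subset_supp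
        (Set.range_subset_iff.2 hY.mem) (Set.range_nonempty _) (h_ne k Y h_indep)
      obtain ⟨y, hy⟩ := hY.snoc hab fun i hi => hb ⟨i, hi⟩
      exact ⟨_, hy, hv.affineIndependent_snoc hC (by norm_cast at hk; omega) h_indep hy⟩
  obtain ⟨Y, -, h_indep⟩ := h_grow (n + 1)
  have hn := card_le_of_affineIndependent h_indep
  rw [ENat.card_eq_coe_fintype_card, Fintype.card_fin] at hn
  norm_cast at hn
  omega

theorem IsConfigGeneric.affineIndependent_supp (hv : IsConfigGeneric v)
    (hC : ∀ j, (fun a => (v j a : ℝ)) ∉ C.supp) :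
    AffineIndependent ℝ (fun x : C.supp => (x : Fin n → ℝ)) := by
  obtain ⟨x, hx⟩ := C.nonempty_supp
  obtain ⟨k, Y, hY, h_range⟩ := hv.exists_growth_range_eq_supp hC hx
  rw [← h_range]
  exact hY.range

end AffineIndependent

section SpecialComponent

variable {R : Type*} [CommRing R] {n m : ℕ} {v : Fin m → Fin n → R} {h k j : Fin m}
  {a b : Fin n → R} {C : (geomGraph v).ConnectedComponent}

theorem isBlackEdge_iff [NoZeroDivisors R] [CharZero R] :
    IsBlackEdge v h k a b ↔ b - a = v k - v h ∧ dotProduct (v h - a) (v h - v k) = 0 := by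
  refine and_congr_right fun h_sub => ?_
  obtain rfl : b = a + (v k - v h) := by rw [← h_sub, add_sub_cancel]
  have h_twice : dotProduct (a + (v k - v h)) (a + (v k - v h)) - dotProduct a a -
      (dotProduct (v k) (v k) - dotProduct (v h) (v h)) =
      2 * dotProduct (v h - a) (v h - v k) := by
    simp only [dotProduct_add, add_dotProduct, dotProduct_sub, sub_dotProduct,
      dotProduct_comm (v h) a, dotProduct_comm (v k) a, dotProduct_comm (v k) (v h)]
    ring
  rw [← sub_eq_zero, h_twice, mul_eq_zero, or_iff_right two_ne_zero]

theorem IsRedEdge.dotProduct_sub_eq_zero [NoZeroDivisors R] [CharZero R]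
    (H : IsRedEdge v h k a b) : dotProduct (a - v h) (a - v k) = 0 := by
  obtain rfl : b = v h + v k - a := by rw [← H.1, add_sub_cancel_left]
  have h_norm := H.2
  refine (mul_eq_zero.1 ?_).resolve_left (two_ne_zero (α := R))
  simp only [dotProduct_add, add_dotProduct, dotProduct_sub, sub_dotProduct,
    dotProduct_comm (v h) a, dotProduct_comm (v k) a, dotProduct_comm (v k) (v h)] at h_norm ⊢
  linear_combination h_norm

theorem range_subset_supp (hj : v j ∈ C.supp) : Set.range v ⊆ C.supp := by
  rintro _ ⟨i, rfl⟩
  by_cases hji : v j = v i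
  · rwa [← hji]
  · exact C.mem_supp_of_adj_mem_supp hj ⟨hji, j, i, fun h => hji (h ▸ rfl), .inr ⟨rfl, rfl⟩⟩

variable [LinearOrder R] [IsStrictOrderedRing R]
  (hv : ∀ i j k, i ≠ j → i ≠ k → j ≠ k → dotProduct (v i - v j) (v i - v k) ≠ 0)

include hv

theorem IsBlackEdge.mem_range (hhk : h ≠ k) (H : IsBlackEdge v h k (v j) b) : b ∈ Set.range v := by
  obtain rfl | hjh := eq_or_ne j h
  · exact ⟨k, (sub_left_injective H.1).symm⟩
  · obtain rfl | hjk := eq_or_ne j k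
    · have h_eq := sub_eq_zero.1 (dotProduct_self_eq_zero.1 (isBlackEdge_iff.1 H).2)
      refine ⟨j, ?_⟩
      rw [← sub_eq_zero, ← neg_sub, H.1, h_eq, sub_self, neg_zero]
    · exact absurd (isBlackEdge_iff.1 H).2 (hv h j k hjh.symm hhk hjk)

theorem IsRedEdge.mem_range (hhk : h ≠ k) (H : IsRedEdge v h k (v j) b) : b ∈ Set.range v := by
  obtain rfl | hjh := eq_or_ne j h
  · exact ⟨k, (add_left_cancel H.1).symm⟩
  · obtain rfl | hjk := eq_or_ne j k
    · exact ⟨h, (add_left_cancel (H.1.trans (add_comm _ _))).symm⟩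
    · exact absurd H.dotProduct_sub_eq_zero (hv j h k hjh hjk hhk)

theorem supp_eq_range_of_mem_supp (hj : v j ∈ C.supp) : C.supp = Set.range v := by
  by_contra h_ne
  obtain ⟨_, ⟨i, rfl⟩, b, hb, -, h, k, hhk, H | H⟩ :=
    exists_adj_of_subset_supp (range_subset_supp hj) ⟨_, j, rfl⟩ (Ne.symm h_ne)
  · exact hb (H.mem_range hv hhk)
  · exact hb (H.mem_range hv hhk)

end SpecialComponent

section BaseChange

variable {R S : Type*} [CommRing R] [CommRing S] {n m : ℕ} {v : Fin m → Fin n → R} {h k : Fin m}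
  {a b : Fin n → R}

theorem IsBlackEdge.map (f : R →+* S) (H : IsBlackEdge v h k a b) :
    IsBlackEdge (fun i c => f (v i c)) h k (fun c => f (a c)) fun c => f (b c) := by
  refine ⟨funext fun c => ?_, ?_⟩
  · simpa only [Pi.sub_apply, map_sub] using congrArg f (congrFun H.1 c)
  · simpa only [map_sub, RingHom.map_dotProduct] using! congrArg f H.2

theorem IsRedEdge.map (f : R →+* S) (H : IsRedEdge v h k a b) :
    IsRedEdge (fun i c => f (v i c)) h k (fun c => f (a c)) fun c => f (b c) := by
  refine ⟨funext fun c => ?_, ?_⟩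
  · simpa only [Pi.add_apply, map_add] using congrArg f (congrFun H.1 c)
  · simpa only [map_add, RingHom.map_dotProduct] using! congrArg f H.2

/-- The homomorphism of geometric graphs given by an extension of scalars. -/
def geomGraphMap (f : R →+* S) (hf : Function.Injective f) (v : Fin m → Fin n → R) :
    geomGraph v →g geomGraph fun i c => f (v i c) where
  toFun a c := f (a c)
  map_rel' := fun ⟨h_ne, h, k, hhk, H⟩ =>
    ⟨fun h_eq => h_ne (hf.comp_left h_eq), h, k, hhk, H.imp (·.map f) (·.map f)⟩

end BaseChange

section Nonresonant

variable {n m : ℕ} {v : Fin m → Fin n → ℤ}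

theorem IsNonresonant.angle_real (hv : IsNonresonant v) (i j k : Fin m) (hij : i ≠ j)
    (hik : i ≠ k) (hjk : j ≠ k) : dotProduct ((fun a => (v i a : ℝ)) - fun a => (v j a : ℝ))
      ((fun a => (v i a : ℝ)) - fun a => (v k a : ℝ)) ≠ 0 := by
  have h_cast (l : Fin m) : ((fun a => (v i a : ℝ)) - fun a => (v l a : ℝ)) =
      Int.castRingHom ℝ ∘ (v i - v l) := by ext; simp
  rw [h_cast, h_cast, ← RingHom.map_dotProduct]
  exact Int.cast_ne_zero.2 (hv.angle i j k hij hik hjk)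

theorem IsNonresonant.affineIndependent_supp_real (hv : IsNonresonant v)
    {C : (geomGraph fun i a => (v i a : ℝ)).ConnectedComponent}
    (hC : C.supp ≠ Set.range fun i a => (v i a : ℝ)) :
    AffineIndependent ℝ (fun x : C.supp => (x : Fin n → ℝ)) :=
  hv.isConfig.affineIndependent_supp fun _ hj =>
    hC (supp_eq_range_of_mem_supp hv.angle_real hj)

theorem IsNonresonant.affineIndependent_supp_int (hv : IsNonresonant v)
    {C : (geomGraph v).ConnectedComponent} (hC : C.supp ≠ Set.range v) :
    AffineIndependent ℝ (fun (x : C.supp) (a : Fin n) => ((x : Fin n → ℤ) a : ℝ)) := by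
  let φ := geomGraphMap (Int.castRingHom ℝ) Int.cast_injective v
  have h_inj : Function.Injective φ := fun x y hxy => Int.cast_injective.comp_left hxy
  have h_mem : ∀ x ∈ C.supp, φ x ∈ (C.map φ).supp := by
    rintro x rfl
    rfl
  have hC' : (C.map φ).supp ≠ Set.range fun i a => (v i a : ℝ) := fun h_range => by
    obtain ⟨x, hx⟩ := C.nonempty_supp
    obtain ⟨j, hj⟩ := h_range.le (h_mem x hx)
    obtain rfl : v j = x := h_inj hj
    exact hC (supp_eq_range_of_mem_supp hv.angle hx)
  exact (hv.affineIndependent_supp_real hC').comp_embedding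
    ⟨fun x : C.supp => ⟨φ x, h_mem x x.2⟩,
      fun x y h => Subtype.ext (h_inj (congrArg Subtype.val h))⟩

theorem subsingleton_of_supp_eq_range {C : (geomGraph v).ConnectedComponent}
    (hC : C.supp = Set.range v) (h_red : ¬ HasRedEdge v C) : C.supp.Subsingleton := by
  intro a ha b hb
  by_contra hab
  obtain ⟨i, rfl⟩ := hC.le ha
  obtain ⟨j, rfl⟩ := hC.le hb
  exact h_red ⟨v i, ha, v j, hb, hab, i, j, fun h => hab (h ▸ rfl), rfl, rfl⟩

theorem IsNonresonant.affineIndependent_of_not_hasRedEdge (hv : IsNonresonant v)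
    {C : (geomGraph v).ConnectedComponent} (hC : ¬ HasRedEdge v C) :
    AffineIndependent ℝ (fun (x : C.supp) (a : Fin n) => ((x : Fin n → ℤ) a : ℝ)) := by
  by_cases h_range : C.supp = Set.range v
  · have := (subsingleton_of_supp_eq_range h_range hC).coe_sort
    exact affineIndependent_of_subsingleton ℝ _
  · exact hv.affineIndependent_supp_int h_range

end Nonresonant

section RedEdges

variable {n m : ℕ}

theorem finite_setOf_dotProduct_self_le (N : ℤ) : {x : Fin n → ℤ | dotProduct x x ≤ N}.Finite := by
  refine (Set.finite_Icc (fun _ => -N) fun _ => N).subset fun x hx => ?_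
  have h_abs (a : Fin n) : |x a| ≤ N := calc
    |x a| ≤ |x a| ^ 2 := Int.le_self_sq _
    _ = x a * x a := by rw [sq_abs, sq]
    _ ≤ dotProduct x x := Finset.single_le_sum (f := fun a => x a * x a)
      (fun a _ => mul_self_nonneg _) (Finset.mem_univ a)
    _ ≤ N := hx
  exact ⟨fun a => (abs_le.1 (h_abs a)).1, fun a => (abs_le.1 (h_abs a)).2⟩

theorem finite_setOf_isRedEdge (v : Fin m → Fin n → ℤ) :
    {a : Fin n → ℤ | ∃ b h k, IsRedEdge v h k a b}.Finite := by
  refine (Set.finite_iUnion fun q : Fin m × Fin m => finite_setOf_dotProduct_self_le (n := n)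
    (dotProduct (v q.1) (v q.1) + dotProduct (v q.2) (v q.2))).subset ?_
  rintro a ⟨b, h, k, H⟩
  exact Set.mem_iUnion.2 ⟨(h, k), H.2 ▸ le_add_of_nonneg_right (dotProduct_self_star_nonneg b)⟩

theorem finite_setOf_hasRedEdge (v : Fin m → Fin n → ℤ) :
    {C : (geomGraph v).ConnectedComponent | HasRedEdge v C}.Finite := by
  refine ((finite_setOf_isRedEdge v).image (geomGraph v).connectedComponentMk).subset ?_
  rintro C ⟨a, ha, b, -, -, h, k, -, H⟩
  exact ⟨a, ⟨b, h, k, H⟩, ha⟩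

end RedEdges

section Families

variable {n m : ℕ} {v : Fin m → Fin n → ℤ}

instance EdgeColor.instFinite : Finite EdgeColor :=
  Finite.of_surjective (fun b : Bool => if b then black else red) fun
    | black => ⟨true, rfl⟩
    | red => ⟨false, rfl⟩

instance MGraph.instFinite (m : ℕ) (V : Type*) [Finite V] : Finite (MGraph m V) := by
  have h_dart (G : SimpleGraph V) : Finite G.Dart :=
    Finite.of_injective (fun d : G.Dart => d.toProd) fun d d' h => SimpleGraph.Dart.ext d d' h
  refine Finite.of_injective (β := Σ G : SimpleGraph V, (G.Dart → EdgeColor) ×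
    (G.Dart → Fin m × Fin m)) (fun G => ⟨G.graph, G.color, G.mark⟩) ?_
  rintro ⟨G, _, color, _, mark, _, _⟩ ⟨G', _, color', _, mark', _, _⟩ h_data
  simp only [Sigma.mk.injEq] at h_data
  obtain ⟨rfl, h_maps⟩ := h_data
  obtain ⟨rfl, rfl⟩ := Prod.mk.inj (eq_of_heq h_maps)
  rfl

theorem IsNonresonant.black_marking_unique (hv : IsNonresonant v) {h k h' k' : Fin m}
    {a b : Fin n → ℤ} (hhk : h ≠ k) (H : IsBlackEdge v h k a b) (H' : IsBlackEdge v h' k' a b) :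
    (h, k) = (h', k') := by
  obtain ⟨rfl, rfl⟩ := hv.diff h k h' k' hhk (H.1.symm.trans H'.1)
  rfl

theorem exists_isBlackEdge_of_not_hasRedEdge {C : (geomGraph v).ConnectedComponent}
    (hC : ¬ HasRedEdge v C) {a b : Fin n → ℤ} (ha : a ∈ C.supp) (hb : b ∈ C.supp)
    (h_adj : (geomGraph v).Adj a b) : ∃ h k, h ≠ k ∧ IsBlackEdge v h k a b := by
  obtain ⟨hab, h, k, hhk, H | H⟩ := h_adj
  · exact ⟨h, k, hhk, H⟩
  · exact absurd ⟨a, ha, b, hb, hab, h, k, hhk, H⟩ hC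

theorem IsNonresonant.exists_isRealization_equiv (hv : IsNonresonant v)
    {C : (geomGraph v).ConnectedComponent} (hC : ¬ HasRedEdge v C) {V : Type*} (e : V ≃ C.supp) :
    ∃ G : MGraph m V, G.IsBlack ∧ G.IsRealization v C fun i => e i := by
  let G : SimpleGraph V := C.toSimpleGraph.comap e
  have h_connected : G.Connected :=
    (SimpleGraph.Iso.connected_iff (SimpleGraph.Iso.comap e _)).2 C.connected_toSimpleGraph
  have h_black (d : G.Dart) : ∃ h k, h ≠ k ∧ IsBlackEdge v h k (e d.fst) (e d.snd) :=
    exists_isBlackEdge_of_not_hasRedEdge hC (e d.fst).2 (e d.snd).2 d.adj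
  choose h k h_ne h_edge using h_black
  refine ⟨⟨G, h_connected, fun _ => EdgeColor.black, fun _ => rfl, fun d => (h d, k d), h_ne,
    fun d => hv.black_marking_unique (h_ne _) (h_edge d.symm) (h_edge d).symm⟩, fun _ => rfl,
    Subtype.val_injective.comp e.injective, ?_, fun _ _ => Iff.rfl,
    fun d => ⟨fun _ => h_edge d, fun h_red => nomatch h_red⟩⟩
  rw [Set.range_comp' Subtype.val, e.surjective.range_eq, Set.image_univ]
  exact Subtype.range_val

theorem IsNonresonant.exists_isRealization (hv : IsNonresonant v)
    {C : (geomGraph v).ConnectedComponent} (hC : ¬ HasRedEdge v C) :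
    ∃ F : Σ k : ℕ, MGraph m (Fin (k + 1)), F.1 ≤ n ∧ F.2.IsBlack ∧
      ∃ x : Fin (F.1 + 1) → Fin n → ℤ, F.2.IsRealization v C x := by
  have h_card : C.supp.encard ≤ (n + 1 : ℕ) :=
    card_le_of_affineIndependent (hv.affineIndependent_of_not_hasRedEdge hC)
  have h_fin : C.supp.Finite := Set.finite_of_encard_le_coe h_card
  obtain ⟨k, hk⟩ := Nat.exists_eq_add_one.2 ((Set.ncard_pos h_fin).2 C.nonempty_supp)
  have h_le : k + 1 ≤ n + 1 := by
    rw [← h_fin.cast_ncard_eq, hk] at h_card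
    exact_mod_cast h_card
  have := h_fin.to_subtype
  obtain ⟨G, h_black, h_real⟩ :=
    hv.exists_isRealization_equiv hC (Finite.equivFinOfCardEq hk).symm
  exact ⟨⟨k, G⟩, Nat.le_of_succ_le_succ h_le, h_black, _, h_real⟩

/-- The components of `Γ_S` on which the abstract marked graph `G` has a realization: the family of
components indexed by `G`. -/
def MGraph.realizedComponents {R : Type*} [CommRing R] {n m : ℕ} {V : Type*} (G : MGraph m V)
    (v : Fin m → Fin n → R) : Set (geomGraph v).ConnectedComponent :=
  {C | ∃ x : V → Fin n → R, G.IsRealization v C x}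

theorem MGraph.IsRealization.exists_equiv {V V' : Type*} {F : MGraph m V} {F' : MGraph m V'}
    {C : (geomGraph v).ConnectedComponent} {x : V → Fin n → ℤ} {x' : V' → Fin n → ℤ}
    (hx : F.IsRealization v C x) (hx' : F'.IsRealization v C x') :
    ∃ e : V' ≃ V, ∀ a, x (e a) = x' a :=
  ⟨(Equiv.ofInjective x' hx'.1).trans ((Equiv.setCongr (hx'.2.1.trans hx.2.1.symm)).trans
    (Equiv.ofInjective x hx.1).symm), fun _ => Equiv.apply_ofInjective_symm hx.1 _⟩

theorem IsNonresonant.realizedComponents_subset (hv : IsNonresonant v) {V V' : Type*}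
    {F : MGraph m V} {F' : MGraph m V'} (hF : F.IsBlack) (hF' : F'.IsBlack)
    {C : (geomGraph v).ConnectedComponent} (hC : C ∈ F.realizedComponents v)
    (hC' : C ∈ F'.realizedComponents v) : F.realizedComponents v ⊆ F'.realizedComponents v := by
  obtain ⟨x, hx⟩ := hC
  obtain ⟨x', hx'⟩ := hC'
  obtain ⟨e, he⟩ := hx.exists_equiv hx'
  have h_adj (a b : V') : F'.graph.Adj a b ↔ F.graph.Adj (e a) (e b) := by
    rw [hx'.2.2.1, hx.2.2.1, he, he]
  rintro D ⟨y, hy⟩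
  refine ⟨y ∘ e, hy.1.comp e.injective, by rw [e.surjective.range_comp, hy.2.1],
    fun a b => (h_adj a b).trans (hy.2.2.1 _ _), fun d => ⟨fun _ => ?_, fun h_red => ?_⟩⟩
  · let d' : F.graph.Dart := ⟨(e d.fst, e d.snd), (h_adj _ _).1 d.adj⟩
    have h_edge : IsBlackEdge v (F.mark d').1 (F.mark d').2 (x' d.fst) (x' d.snd) := by
      rw [← he, ← he]
      exact (hx.2.2.2 d').1 (hF d')
    have h_mark : F'.mark d = F.mark d' :=
      hv.black_marking_unique (F'.mark_ne d) ((hx'.2.2.2 d).1 (hF' d)) h_edge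
    rw [h_mark]
    exact (hy.2.2.2 d').1 (hF d')
  · exact nomatch (hF' d).symm.trans h_red

theorem IsNonresonant.affineIndependent_of_isRealization (hv : IsNonresonant v) {V : Type*}
    {G : MGraph m V} {C : (geomGraph v).ConnectedComponent} (hC : ¬ HasRedEdge v C)
    {x : V → Fin n → ℤ} (hx : G.IsRealization v C x) :
    AffineIndependent ℝ fun a i => (x a i : ℝ) :=
  (hv.affineIndependent_of_not_hasRedEdge hC).comp_embedding
    ⟨fun a => (⟨x a, hx.2.1.le ⟨a, rfl⟩⟩ : C.supp), fun _ _ h => hx.1 (congrArg Subtype.val h)⟩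

theorem finite_setOf_mgraph_le (m n : ℕ) :
    {F : Σ k : ℕ, MGraph m (Fin (k + 1)) | F.1 ≤ n}.Finite := by
  refine (Set.finite_range fun F : Σ k : Fin (n + 1), MGraph m (Fin (k + 1)) =>
    (⟨F.1, F.2⟩ : Σ k : ℕ, MGraph m (Fin (k + 1)))).subset ?_
  rintro ⟨k, G⟩ hk
  exact ⟨⟨⟨k, Nat.lt_succ_of_le hk⟩, G⟩, rfl⟩

-- Two black graphs that share a component have the same family, so one graph is chosen for each
-- family.
theorem IsNonresonant.exists_families (hv : IsNonresonant v) :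
    ∃ fam : Set (Σ k : ℕ, MGraph m (Fin (k + 1))), fam.Finite ∧
      (∀ F ∈ fam, F.1 ≤ n ∧ F.2.IsBlack ∧ ∃ C ∈ F.2.realizedComponents v, ¬ HasRedEdge v C) ∧
      ∀ C : (geomGraph v).ConnectedComponent, ¬ HasRedEdge v C →
        ∃! F, F ∈ fam ∧ C ∈ F.2.realizedComponents v := by
  let T : Set (Σ k : ℕ, MGraph m (Fin (k + 1))) :=
    {F | F.1 ≤ n ∧ F.2.IsBlack ∧ ∃ C ∈ F.2.realizedComponents v, ¬ HasRedEdge v C}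
  obtain ⟨fam, h_sub, h_bij⟩ := Set.exists_subset_bijOn T fun F => F.2.realizedComponents v
  refine ⟨fam, ((finite_setOf_mgraph_le m n).subset fun F hF => hF.1).subset h_sub, h_sub,
    fun C hC => ?_⟩
  obtain ⟨F, h_le, h_black, hCF⟩ := hv.exists_isRealization hC
  obtain ⟨F', hF', h_eq⟩ := h_bij.surjOn ⟨F, ⟨h_le, h_black, C, hCF, hC⟩, rfl⟩
  refine ⟨F', ⟨hF', h_eq.ge hCF⟩, fun F'' ⟨hF'', hC''⟩ => h_bij.injOn hF'' hF' ?_⟩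
  have h_black' := (h_sub hF').2.1
  have h_black'' := (h_sub hF'').2.1
  exact (hv.realizedComponents_subset h_black'' h_black' hC'' (h_eq.ge hCF)).antisymm
    (hv.realizedComponents_subset h_black' h_black'' (h_eq.ge hCF) hC'')

end Families

section Rank

variable {R M : Type*} [CommRing R] [AddCommGroup M] [Module R M]

theorem finrank_range_add_finrank_ker_of_isDomain [IsDomain R] [Module.Finite R M] {N : Type*}
    [AddCommGroup N] [Module R N] (f : M →ₗ[R] N) :
    Module.finrank R (LinearMap.range f) + Module.finrank R (LinearMap.ker f) =
      Module.finrank R M := by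
  rw [← f.quotKerEquivRange.finrank_eq, Submodule.finrank_quotient_add_finrank]

theorem injective_mulVecLin_mul_transpose [LinearOrder R] [IsStrictOrderedRing R] {ι κ : Type*}
    [Fintype ι] [Fintype κ] {A : Matrix ι κ R} (hA : LinearIndependent R A.row) :
    Function.Injective (A * A.transpose).mulVecLin := by
  refine (injective_iff_map_eq_zero _).2 fun c hc => ?_
  have h_zero : A.mulVec (Matrix.vecMul c A) = 0 := by
    rw [← Matrix.mulVec_transpose, Matrix.mulVec_mulVec]
    exact hc
  have h_norm : dotProduct (Matrix.vecMul c A) (Matrix.vecMul c A) = 0 := by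
    rw [← Matrix.dotProduct_mulVec, h_zero, dotProduct_zero]
  exact Matrix.vecMul_injective_iff.2 hA ((dotProduct_self_eq_zero.1 h_norm).trans
    (Matrix.zero_vecMul A).symm)

theorem finrank_ker_mulVecLin_add_card [LinearOrder R] [IsStrictOrderedRing R] {ι κ : Type*}
    [Fintype ι] [Fintype κ] {A : Matrix ι κ R} (hA : LinearIndependent R A.row) :
    Module.finrank R (LinearMap.ker A.mulVecLin) + Fintype.card ι = Fintype.card κ := by
  have h_sub : LinearMap.range (A * A.transpose).mulVecLin ≤ LinearMap.range A.mulVecLin := by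
    rw [Matrix.mulVecLin_mul]
    exact LinearMap.range_comp_le_range _ _
  have h_range : Module.finrank R (LinearMap.range A.mulVecLin) = Fintype.card ι := by
    refine le_antisymm ?_ ?_
    · exact (Submodule.finrank_le _).trans_eq (Module.finrank_fintype_fun_eq_card R)
    · rw [← Module.finrank_fintype_fun_eq_card R (η := ι),
        ← LinearMap.finrank_range_of_inj (injective_mulVecLin_mul_transpose hA)]
      exact Submodule.finrank_mono h_sub
  rw [← h_range, add_comm, finrank_range_add_finrank_ker_of_isDomain,
    Module.finrank_fintype_fun_eq_card]

theorem finrank_inf_ker_lt [IsDomain R] {L : Submodule R M} [Module.Finite R L] {f : M →ₗ[R] R}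
    {z : M} (hz : z ∈ L) (hfz : f z ≠ 0) :
    Module.finrank R (L ⊓ LinearMap.ker f : Submodule R M) < Module.finrank R L := by
  have h_nullity := finrank_range_add_finrank_ker_of_isDomain (f.domRestrict L)
  have h_pos : 0 < Module.finrank R (LinearMap.range (f.domRestrict L)) := by
    rw [Module.finrank_pos_iff]
    exact ⟨⟨f z, ⟨z, hz⟩, rfl⟩, 0, fun h => hfz (congrArg Subtype.val h)⟩
  have h_ker : Module.finrank R (L ⊓ LinearMap.ker f : Submodule R M) =
      Module.finrank R (LinearMap.ker (f.domRestrict L)) := by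
    rw [LinearMap.ker_domRestrict, ← Submodule.map_comap_subtype]
    exact (Submodule.equivMapOfInjective _ L.subtype_injective _).symm.finrank_eq
  lia

end Rank

section Thin

variable {R M : Type*} [CommRing R] [AddCommGroup M] [Module R M] {L : Submodule R M}

/-- The set `s` is covered by finitely many cosets of submodules of `L` of rank smaller than that of
`L`. A coset `c + N` is encoded as the pair `(c, N)`. -/
def IsThin (L : Submodule R M) (s : Set M) : Prop :=
  ∃ exc : Set (M × Submodule R M), exc.Finite ∧
    (∀ e ∈ exc, e.2 ≤ L ∧ Module.finrank R e.2 < Module.finrank R L) ∧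
    ∀ y ∈ s, ∃ e ∈ exc, y - e.1 ∈ e.2

theorem IsThin.mono {s t : Set M} (ht : IsThin L t) (hst : s ⊆ t) : IsThin L s := by
  obtain ⟨exc, h_fin, h_lt, h_cover⟩ := ht
  exact ⟨exc, h_fin, h_lt, fun y hy => h_cover y (hst hy)⟩

theorem IsThin.iUnion {ι : Type*} [Finite ι] {s : ι → Set M} (hs : ∀ i, IsThin L (s i)) :
    IsThin L (⋃ i, s i) := by
  choose exc h_fin h_lt h_cover using hs
  refine ⟨⋃ i, exc i, Set.finite_iUnion h_fin, fun e he => ?_, fun y hy => ?_⟩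
  · obtain ⟨i, hi⟩ := Set.mem_iUnion.1 he
    exact h_lt i e hi
  · obtain ⟨i, hi⟩ := Set.mem_iUnion.1 hy
    obtain ⟨e, he, hye⟩ := h_cover i y hi
    exact ⟨e, Set.mem_iUnion.2 ⟨i, he⟩, hye⟩

theorem IsThin.union {s t : Set M} (hs : IsThin L s) (ht : IsThin L t) : IsThin L (s ∪ t) := by
  rw [Set.union_eq_iUnion]
  exact IsThin.iUnion (Bool.forall_bool.2 ⟨ht, hs⟩)

theorem isThin_empty : IsThin L ∅ :=
  ⟨∅, Set.finite_empty, fun _ he => he.elim, fun _ hy => hy.elim⟩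

theorem isThin_of_finite [Nontrivial R] (hL : 0 < Module.finrank R L) {s : Set M}
    (hs : s.Finite) : IsThin L s :=
  ⟨(·, ⊥) '' s, hs.image _, Set.forall_mem_image.2 fun _ _ => ⟨bot_le, by rwa [finrank_bot]⟩,
    fun y hy => ⟨(y, ⊥), Set.mem_image_of_mem _ hy, by rw [sub_self]; exact zero_mem _⟩⟩

theorem isThin_setOf_apply_eq [IsDomain R] [Module.Finite R L] {f : M →ₗ[R] R} {z : M} (hz : z ∈ L)
    (hfz : f z ≠ 0) (c : R) : IsThin L {y | y ∈ L ∧ f y = c} := by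
  obtain h_empty | ⟨y₀, hy₀, hc⟩ := {y | y ∈ L ∧ f y = c}.eq_empty_or_nonempty
  · exact h_empty ▸ isThin_empty
  · refine ⟨{(y₀, L ⊓ LinearMap.ker f)}, Set.finite_singleton _, ?_, fun y ⟨hy, hyc⟩ => ?_⟩
    · rintro _ rfl
      exact ⟨inf_le_left, finrank_inf_ker_lt hz hfz⟩
    · exact ⟨_, rfl, L.sub_mem hy hy₀, LinearMap.sub_mem_ker_iff.2 (hyc.trans hc.symm)⟩

end Thin

section SolutionLattice

variable {R : Type*} [CommRing R] {n m : ℕ} {V : Type*}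

/-- The lattice of all vectors orthogonal to the differences of the points `x₀ a`. When `x₀` is a
solution of a black marked graph, these are the translations that preserve its equations. -/
def solutionLattice (x₀ : V → Fin n → R) : Submodule R (Fin n → R) where
  carrier := {y | ∀ a b, dotProduct (x₀ a) y = dotProduct (x₀ b) y}
  zero_mem' _ _ := by simp only [dotProduct_zero]
  add_mem' hy hz a b := by rw [dotProduct_add, dotProduct_add, hy a b, hz a b]
  smul_mem' c y hy a b := by rw [dotProduct_smul, dotProduct_smul, hy a b]

theorem mem_solutionLattice_iff_forall {x₀ : V → Fin n → R} (a₀ : V) {y : Fin n → R} :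
    y ∈ solutionLattice x₀ ↔ ∀ a, dotProduct (x₀ a) y = dotProduct (x₀ a₀) y :=
  ⟨fun h a => h a a₀, fun h a b => (h a).trans (h b).symm⟩

theorem linearIndependent_sub_of_affineIndependent_cast {x₀ : V → Fin n → ℤ}
    (h : AffineIndependent ℝ fun a i => (x₀ a i : ℝ)) (a₀ : V) :
    LinearIndependent ℤ fun a : {a // a ≠ a₀} => x₀ a - x₀ a₀ := by
  let φ : (Fin n → ℤ) →ₗ[ℤ] Fin n → ℝ := LinearMap.compLeft (Int.castAddHom ℝ).toIntLinearMap _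
  have h_cast : (φ ∘ fun a : {a // a ≠ a₀} => x₀ a - x₀ a₀) =
      fun a : {a // a ≠ a₀} => (fun i => (x₀ a i : ℝ)) -ᵥ fun i => (x₀ a₀ i : ℝ) := by
    ext a i
    exact Int.cast_sub _ _
  refine LinearIndependent.of_comp φ ?_
  rw [h_cast]
  exact ((affineIndependent_iff_linearIndependent_vsub ℝ _ a₀).1 h).restrict_scalars
    (by simpa only [zsmul_one] using Int.cast_injective)

theorem finrank_solutionLattice_add_card [Fintype V] {x₀ : V → Fin n → ℤ}
    (h : AffineIndependent ℝ fun a i => (x₀ a i : ℝ)) (a₀ : V) :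
    Module.finrank ℤ (solutionLattice x₀) + Fintype.card V = n + 1 := by
  classical
  have h_ker : solutionLattice x₀ =
      LinearMap.ker (Matrix.of fun a : {a // a ≠ a₀} => x₀ a - x₀ a₀).mulVecLin := by
    ext y
    simp only [mem_solutionLattice_iff_forall a₀, LinearMap.mem_ker, funext_iff,
      Matrix.mulVecLin_apply, Matrix.mulVec, Matrix.of_apply, sub_dotProduct, Pi.zero_apply,
      sub_eq_zero, Subtype.forall]
    exact forall_congr' fun a =>
      ⟨fun h _ => h, fun h => (eq_or_ne a a₀).elim (fun h_eq => h_eq ▸ rfl) h⟩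
  have h_card := finrank_ker_mulVecLin_add_card
    (A := Matrix.of fun a : {a // a ≠ a₀} => x₀ a - x₀ a₀)
    (linearIndependent_sub_of_affineIndependent_cast h a₀)
  rw [← h_ker, Fintype.card_subtype_compl, Fintype.card_subtype_eq, Fintype.card_fin] at h_card
  have := Fintype.card_pos_iff.2 ⟨a₀⟩
  lia

end SolutionLattice

section Solutions

variable {R : Type*} [CommRing R] {n m : ℕ} {V : Type*} {v : Fin m → Fin n → R}
  {G : MGraph m V} {x x₀ : V → Fin n → R} {h k : Fin m} {a b y : Fin n → R}

theorem isBlackEdge_add_right_iff [NoZeroDivisors R] [CharZero R]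
    (hy : dotProduct (v h - v k) y = 0) :
    IsBlackEdge v h k (a + y) (b + y) ↔ IsBlackEdge v h k a b := by
  rw [isBlackEdge_iff, isBlackEdge_iff, add_sub_add_right_eq_sub, ← sub_sub, sub_dotProduct _ y,
    dotProduct_comm y, hy, sub_zero]

theorem IsBlackEdge.add_right_iff [NoZeroDivisors R] [CharZero R] (H : IsBlackEdge v h k a b) :
    IsBlackEdge v h k (a + y) (b + y) ↔ dotProduct a y = dotProduct b y := by
  obtain ⟨h_sub, h_orth⟩ := isBlackEdge_iff.1 H
  rw [isBlackEdge_iff, add_sub_add_right_eq_sub, and_iff_right h_sub, ← sub_sub,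
    sub_dotProduct _ y, h_orth, zero_sub, neg_eq_zero, dotProduct_comm, ← neg_sub (v k), ← h_sub,
    neg_sub, sub_dotProduct, sub_eq_zero]

theorem eq_of_reachable {α : Type*} {H : SimpleGraph V} {f : V → α}
    (hf : ∀ a b, H.Adj a b → f a = f b) {a b : V} (hab : H.Reachable a b) : f a = f b := by
  obtain ⟨w⟩ := hab
  induction w with
  | nil => rfl
  | cons h_adj _ ih => exact (hf _ _ h_adj).trans ih

theorem MGraph.IsBlack.isSolution_iff_forall_adj (hG : G.IsBlack) :
    G.IsSolution v x ↔
      ∀ d : G.graph.Dart, IsBlackEdge v (G.mark d).1 (G.mark d).2 (x d.fst) (x d.snd) :=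
  forall_congr' fun d => ⟨fun H => H.1 (hG d),
    fun H => ⟨fun _ => H, fun h_red => nomatch (hG d).symm.trans h_red⟩⟩

theorem MGraph.IsBlack.isSolution_add_iff [NoZeroDivisors R] [CharZero R] (hG : G.IsBlack)
    (hx₀ : G.IsSolution v x₀) :
    (G.IsSolution v fun a => x₀ a + y) ↔ y ∈ solutionLattice x₀ := by
  rw [hG.isSolution_iff_forall_adj] at hx₀ ⊢
  simp only [(hx₀ _).add_right_iff]
  exact ⟨fun H a b => eq_of_reachable (f := fun a => dotProduct (x₀ a) y)
    (fun a b hab => H ⟨(a, b), hab⟩) (G.connected.preconnected a b), fun H d => H _ _⟩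

theorem MGraph.IsBlack.exists_eq_add (hG : G.IsBlack) (hx₀ : G.IsSolution v x₀)
    (hx : G.IsSolution v x) : ∃ y, x = fun a => x₀ a + y := by
  rw [hG.isSolution_iff_forall_adj] at hx₀ hx
  have h_const (a b : V) : x a - x₀ a = x b - x₀ b :=
    eq_of_reachable (f := fun a => x a - x₀ a) (fun a b hab => by
      have h_diff : x b - x a = x₀ b - x₀ a :=
        (hx ⟨(a, b), hab⟩).1.trans (hx₀ ⟨(a, b), hab⟩).1.symm
      linear_combination -h_diff) (G.connected.preconnected a b)
  obtain ⟨a₀⟩ := G.connected.nonempty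
  exact ⟨x a₀ - x₀ a₀, funext fun a => by rw [h_const a₀ a, add_sub_cancel]⟩

theorem MGraph.IsBlack.isSolution_iff [NoZeroDivisors R] [CharZero R] (hG : G.IsBlack)
    (hx₀ : G.IsSolution v x₀) (x : V → Fin n → R) :
    G.IsSolution v x ↔ ∃ y ∈ solutionLattice x₀, x = fun a => x₀ a + y := by
  refine ⟨fun hx => ?_, ?_⟩
  · obtain ⟨y, rfl⟩ := hG.exists_eq_add hx₀ hx
    exact ⟨y, (hG.isSolution_add_iff hx₀).1 hx, rfl⟩
  · rintro ⟨y, hy, rfl⟩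
    exact (hG.isSolution_add_iff hx₀).2 hy

theorem eq_of_range_add_eq {M : Type*} [AddCommGroup M] [IsAddTorsionFree M] [Finite V]
    [Nonempty V] {x : V → M} (hx : Function.Injective x) {y y' : M}
    (h : Set.range (fun a => x a + y) = Set.range fun a => x a + y') : y = y' := by
  have := Fintype.ofFinite V
  have h_sum (z : M) : ∑ᶠ p ∈ Set.range (fun a => x a + z), p =
      ∑ a, x a + Fintype.card V • z := by
    have h_inj : Function.Injective fun a => x a + z := (add_left_injective z).comp hx
    rw [finsum_mem_range h_inj, finsum_eq_sum_of_fintype,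
      Finset.sum_add_distrib, Finset.sum_const, Finset.card_univ]
  have h_eq : ∑ a, x a + Fintype.card V • y = ∑ a, x a + Fintype.card V • y' := by
    rw [← h_sum, h, h_sum]
  exact nsmul_right_injective Fintype.card_ne_zero (add_left_cancel h_eq)

theorem MGraph.IsSolution.adj (hx : G.IsSolution v x) (h_inj : Function.Injective x) {a b : V}
    (hab : G.graph.Adj a b) : (geomGraph v).Adj (x a) (x b) := by
  refine ⟨h_inj.ne hab.ne, _, _, G.mark_ne ⟨(a, b), hab⟩, ?_⟩
  cases h_color : G.color ⟨(a, b), hab⟩ with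
  | black => exact .inl ((hx _).1 h_color)
  | red => exact .inr ((hx _).2 h_color)

theorem MGraph.IsSolution.exists_isRealization (hx : G.IsSolution v x)
    (h_inj : Function.Injective x)
    (h_closed : ∀ a p, (geomGraph v).Adj (x a) p → ∃ b, x b = p ∧ G.graph.Adj a b) :
    ∃ C, G.IsRealization v C x := by
  let φ : G.graph →g geomGraph v := ⟨x, hx.adj h_inj⟩
  obtain ⟨a₀⟩ := G.connected.nonempty
  refine ⟨(geomGraph v).connectedComponentMk (x a₀), h_inj, ?_,
    fun a b => ⟨hx.adj h_inj, fun hab => ?_⟩, hx⟩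
  · by_contra h_ne
    have h_sub : Set.range x ⊆ ((geomGraph v).connectedComponentMk (x a₀)).supp := by
      rintro _ ⟨a, rfl⟩
      exact SimpleGraph.ConnectedComponent.sound ((G.connected.preconnected a a₀).map φ)
    obtain ⟨_, ⟨a, rfl⟩, p, hp, hap⟩ := exists_adj_of_subset_supp h_sub ⟨_, a₀, rfl⟩ h_ne
    obtain ⟨b, rfl, -⟩ := h_closed a p hap
    exact hp ⟨b, rfl⟩
  · obtain ⟨c, hc, hac⟩ := h_closed a _ hab
    rwa [← h_inj hc]

end Solutions

section ExceptionalTranslates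

variable {n m : ℕ} {V : Type*} {v : Fin m → Fin n → ℤ} {G : MGraph m V} {x₀ : V → Fin n → ℤ}
  {C₀ : (geomGraph v).ConnectedComponent} {y : Fin n → ℤ}

theorem exists_isRealization_add (hG : G.IsBlack) (hx₀ : G.IsRealization v C₀ x₀)
    (hy : y ∈ solutionLattice x₀) (h_red : ∀ a b h k, ¬ IsRedEdge v h k (x₀ a + y) b)
    (h_orth : ∀ a b h k, IsBlackEdge v h k (x₀ a + y) b → dotProduct (v h - v k) y = 0) :
    ∃ C, G.IsRealization v C fun a => x₀ a + y := by
  refine ((hG.isSolution_add_iff hx₀.2.2.2).2 hy).exists_isRealization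
    ((add_left_injective y).comp hx₀.1) ?_
  rintro a p ⟨h_ne, h, k, hhk, H | H⟩
  · obtain ⟨q, rfl⟩ : ∃ q, p = q + y := ⟨p - y, (sub_add_cancel p y).symm⟩
    have h_adj : (geomGraph v).Adj (x₀ a) q :=
      ⟨fun h_eq => h_ne (h_eq ▸ rfl), h, k, hhk,
        .inl ((isBlackEdge_add_right_iff (h_orth a _ h k H)).1 H)⟩
    obtain ⟨b, rfl⟩ : q ∈ Set.range x₀ := by
      rw [hx₀.2.1]
      exact C₀.mem_supp_of_adj_mem_supp (hx₀.2.1.le ⟨a, rfl⟩) h_adj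
    exact ⟨b, rfl, (hx₀.2.2.1 a b).2 h_adj⟩
  · exact absurd H (h_red a p h k)

theorem isThin_setOf_isRedEdge [Finite V] (hL : 0 < Module.finrank ℤ (solutionLattice x₀)) :
    IsThin (solutionLattice x₀) {y | ∃ a b h k, IsRedEdge v h k (x₀ a + y) b} := by
  refine (isThin_of_finite hL (Set.finite_iUnion fun a =>
    (finite_setOf_isRedEdge v).image (· - x₀ a))).mono ?_
  rintro y ⟨a, b, h, k, H⟩
  exact Set.mem_iUnion.2 ⟨a, _, ⟨b, h, k, H⟩, add_sub_cancel_left _ _⟩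

theorem isThin_setOf_isBlackEdge [Finite V] :
    IsThin (solutionLattice x₀) {y | y ∈ solutionLattice x₀ ∧ ∃ a b h k,
      IsBlackEdge v h k (x₀ a + y) b ∧ dotProduct (v h - v k) y ≠ 0} := by
  have h_thin (t : V × Fin m × Fin m) : IsThin (solutionLattice x₀)
      {y | y ∈ solutionLattice x₀ ∧ (∃ b, IsBlackEdge v t.2.1 t.2.2 (x₀ t.1 + y) b) ∧
        dotProduct (v t.2.1 - v t.2.2) y ≠ 0} := by
    obtain ⟨a, h, k⟩ := t
    obtain h_empty | ⟨z, hz, -, h_ne⟩ := Set.eq_empty_or_nonempty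
      {y | y ∈ solutionLattice x₀ ∧ (∃ b, IsBlackEdge v h k (x₀ a + y) b) ∧
        dotProduct (v h - v k) y ≠ 0}
    · exact h_empty ▸ isThin_empty
    · refine (isThin_setOf_apply_eq (f := dotProductBilin ℤ ℤ (v h - v k)) hz h_ne
        (dotProduct (v h - x₀ a) (v h - v k))).mono ?_
      rintro y ⟨hy, ⟨b, H⟩, -⟩
      refine ⟨hy, ?_⟩
      have h_eq := (isBlackEdge_iff.1 H).2
      rw [← sub_sub, sub_dotProduct _ y, sub_eq_zero] at h_eq
      exact (dotProduct_comm _ _).trans h_eq.symm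
  refine (IsThin.iUnion h_thin).mono ?_
  rintro y ⟨hy, a, b, h, k, H, h_ne⟩
  exact Set.mem_iUnion.2 ⟨(a, h, k), hy, ⟨b, H⟩, h_ne⟩

theorem isThin_setOf_not_isRealization [Finite V] (hG : G.IsBlack)
    (hx₀ : G.IsRealization v C₀ x₀) : IsThin (solutionLattice x₀)
      {y | y ∈ solutionLattice x₀ ∧ ¬ ∃ C, G.IsRealization v C fun a => x₀ a + y} := by
  obtain h_zero | h_pos := Nat.eq_zero_or_pos (Module.finrank ℤ (solutionLattice x₀))
  · convert isThin_empty
    refine Set.eq_empty_of_forall_notMem fun y ⟨hy, h_not⟩ => h_not ⟨C₀, ?_⟩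
    rw [Submodule.finrank_eq_zero.1 h_zero, Submodule.mem_bot] at hy
    simpa only [hy, add_zero] using hx₀
  · refine ((isThin_setOf_isRedEdge (v := v) h_pos).union
      (isThin_setOf_isBlackEdge (v := v))).mono fun y ⟨hy, h_not⟩ => ?_
    by_contra h_good
    exact h_not (exists_isRealization_add hG hx₀ hy
      (fun a b h k H => h_good (.inl ⟨a, b, h, k, H⟩))
      fun a b h k H => by_contra fun h_ne => h_good (.inr ⟨hy, a, b, h, k, H, h_ne⟩))

end ExceptionalTranslates

theorem mainTheorem4 (n : ℕ) (hn : 1 ≤ n) :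
    ∃ res : Finset (Σ p : ℕ, MvPolynomial (Fin p × Fin n) ℤ),
      (∀ P ∈ res, P.1 ≤ 2 * (n + 1) ∧ P.2 ≠ 0) ∧
      ∀ (m : ℕ) (v : Fin m → Fin n → ℤ), IsGeneric res v →
        -- components in `ℝⁿ` other than the special one
        (∀ C : (geomGraph (fun i a => (v i a : ℝ))).ConnectedComponent,
          C.supp ≠ Set.range (fun i a => (v i a : ℝ)) →
            AffineIndependent ℝ (fun x : C.supp => (x : Fin n → ℝ)) ∧
            C.supp.encard ≤ n + 1) ∧
        -- components in `ℤⁿ` other than the special one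
        (∀ C : (geomGraph v).ConnectedComponent, C.supp ≠ Set.range v →
            AffineIndependent ℝ (fun (x : C.supp) (a : Fin n) => ((x : Fin n → ℤ) a : ℝ)) ∧
            C.supp.encard ≤ n + 1) ∧
        -- components with red edges
        {C : (geomGraph v).ConnectedComponent | HasRedEdge v C}.Finite ∧
        -- components with black edges only
        ∃ fam : Set (Σ k : ℕ, MGraph m (Fin (k + 1))),
          fam.Finite ∧
          (∀ F ∈ fam, F.1 ≤ n ∧ F.2.IsBlack) ∧
          (∀ C : (geomGraph v).ConnectedComponent, ¬ HasRedEdge v C →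
            ∃! F : Σ k : ℕ, MGraph m (Fin (k + 1)),
              F ∈ fam ∧ ∃ x : Fin (F.1 + 1) → Fin n → ℤ, F.2.IsRealization v C x) ∧
          ∀ F ∈ fam, ∃ (x₀ : Fin (F.1 + 1) → Fin n → ℤ) (L : Submodule ℤ (Fin n → ℤ)),
            Module.finrank ℤ L + F.1 = n ∧
            (∀ x : Fin (F.1 + 1) → Fin n → ℤ,
              F.2.IsSolution v x ↔ ∃ y ∈ L, x = fun a => x₀ a + y) ∧
            (∀ C : (geomGraph v).ConnectedComponent,
              (∃ x : Fin (F.1 + 1) → Fin n → ℤ, F.2.IsRealization v C x) →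
                ∃! y : Fin n → ℤ, y ∈ L ∧ F.2.IsRealization v C (fun a => x₀ a + y)) ∧
            ∃ exc : Set ((Fin n → ℤ) × Submodule ℤ (Fin n → ℤ)),
              exc.Finite ∧
              (∀ e ∈ exc, e.2 ≤ L ∧ Module.finrank ℤ e.2 < Module.finrank ℤ L) ∧
              ∀ y ∈ L, (∀ e ∈ exc, y - e.1 ∉ e.2) →
                ∃ C : (geomGraph v).ConnectedComponent,
                  F.2.IsRealization v C (fun a => x₀ a + y) := by
  obtain ⟨res, h_res, h_generic⟩ := exists_resonances hn
  refine ⟨res, h_res, fun m v hv => ?_⟩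
  replace hv : IsNonresonant v := h_generic m v hv
  obtain ⟨fam, h_fin, h_fam, h_unique⟩ := hv.exists_families
  refine ⟨fun C hC => ⟨hv.affineIndependent_supp_real hC,
      card_le_of_affineIndependent (hv.affineIndependent_supp_real hC)⟩,
    fun C hC => ⟨hv.affineIndependent_supp_int hC,
      card_le_of_affineIndependent (hv.affineIndependent_supp_int hC)⟩,
    finite_setOf_hasRedEdge v, fam, h_fin, fun F hF => ⟨(h_fam F hF).1, (h_fam F hF).2.1⟩,
    h_unique, fun F hF => ?_⟩
  obtain ⟨-, h_black, C₀, ⟨x₀, hx₀⟩, hC₀⟩ := h_fam F hF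
  have h_indep := hv.affineIndependent_of_isRealization hC₀ hx₀
  obtain ⟨exc, h_exc, h_lt, h_cover⟩ := isThin_setOf_not_isRealization h_black hx₀
  refine ⟨x₀, solutionLattice x₀, ?_, h_black.isSolution_iff hx₀.2.2.2, ?_, exc, h_exc, h_lt, ?_⟩
  · simpa [← add_assoc] using finrank_solutionLattice_add_card h_indep 0
  · rintro C ⟨x, hx⟩
    obtain ⟨y, hy, rfl⟩ := (h_black.isSolution_iff hx₀.2.2.2 x).1 hx.2.2.2
    exact ⟨y, ⟨hy, hx⟩, fun y' hy' => eq_of_range_add_eq hx₀.1 (hy'.2.2.1.trans hx.2.1.symm)⟩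
  · intro y hy h_avoid
    by_contra h_not
    obtain ⟨e, he, hye⟩ := h_cover y ⟨hy, h_not⟩
    exact h_avoid e he hye
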